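/- **Setting.** Let $d\ge 1$ and let $(H_s)_{s\in\mathbb Z^d}$ be a stationary, $\{0,1\}$-valued random field ($H_s=0$ means that the $s$-th null hypothesis is true), $\pi_0=\mathbb P(H_s=0)$, $\pi_1=1-\pi_0$. For $n_1,\dots,n_d\in\mathbb N$ let $C=\prod_{k\le d}\{1,\dots,n_k\}$, $n=n_1\cdots n_d$ and $N_C=\sum_{s\in C}H_s$. All limits are taken as $\min_k n_k\to\infty$. Assume $\{\mathbb E(N_C-n\pi_1)^2\}^{1/2}=O(\sqrt n)$ and $n^{-1/2}(N_C-n\pi_1)\Rightarrow N(0,\sigma^2)$ for some $\sigma^2<\infty$. Let $G$ be a distribution function on $[0,1]$ with $G(0)=0$, $G(1)=1$, which has a bounded derivative $g=G'$ on $[0,1]$. Given $(H_s)$, the p-values $X_s$ are independent, uniform on $(0,1)$ if $H_s=0$ and with distribution function $G$ if $H_s=1$. Put $\Lambda(t)=\pi_0t$, $F(t)=\pi_0t+\pi_1G(t)$, $f=\pi_0+\pi_1g$, $\alpha_*=1/f(0)$, $$\Lambda_n(t)=\frac1n\sum_{i\in C}(1-H_i)\mathbf 1_{X_i\le t},\quad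 F_n(t)=\frac1n\sum_{i\in C}\mathbf 1_{X_i\le t},\quad \tilde\Delta_n(t)=\frac1n\sum_{i\in C}H_i\mathbf 1_{X_i>t},$$ $$\Gamma_n(t)=\frac{n\Lambda_n(t)}{nF_n(t)+\prod_{i\in C}\mathbf 1_{X_i>t}},\qquad \Xi_n(t)=\frac{\tilde\Delta_n(t)}{1-F_n(t)+\mathbf 1_{\max_{i\in C}X_i\le t}/n},\qquad \Xi(t)=\frac{\pi_1[1-G(t)]}{1-F(t)}.$$ For $\alpha\in(0,1)$ let $\nu_{\rm BH}=\sup\{t\in[0,1]:t/\alpha\le F_n(t)\}$ and $\nu_0=\sup\{t\in[0,1]:t/\alpha\le F(t)\}$. Here $\Gamma_n(\nu_{\rm BH})$ is the false discovery proportion and $\Xi_n(\nu_{\rm BH})$ the false nondiscovery proportion of the Benjamini–Hochberg procedure at level $\alpha$. **Theorem.** Assume $\alpha_*^{-1}>\alpha^{-1}>f(\nu_0)$. (i) $$\Gamma_n(\nu_{\rm BH})-\alpha\pi_0=\frac{\alpha}{\nu_0}[\Lambda_n(\nu_0)-\Lambda(\nu_0)]+O_{\mathbb P}(n^{-3/4}),$$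 and $\sqrt n[\Gamma_n(\nu_{\rm BH})-\alpha\pi_0]\Rightarrow N(0,\sigma_0^2)$ for some $\sigma_0^2<\infty$. (ii) Let $c=\pi_0(\alpha-1)/[1-\alpha f(\nu_0)]+1-\nu_0/\alpha$. If $g(t)-g(\nu_0)=O(|t-\nu_0|)$ as $t\to\nu_0$ (for instance, if $g$ is differentiable at $\nu_0$), then $$\Xi_n(\nu_{\rm BH})-\Xi(\nu_0)=\frac{c\,[F_n(\nu_0)-F(\nu_0)]}{(1-\nu_0/\alpha)^2}+\frac{\tilde\Delta_n(\nu_0)-\mathbb E\tilde\Delta_n(\nu_0)}{1-\nu_0/\alpha}+O_{\mathbb P}(n^{-3/4}).$$ Without this extra condition on $g$, $\sqrt n[\Xi_n(\nu_{\rm BH})-\Xi(\nu_0)]\Rightarrow N(0,\sigma_1^2)$ for some $\sigma_1^2<\infty$. (Always $\nu_0\le\alpha$; in the degenerate case $\nu_0=\alpha$, which can occur only if $\pi_0=0$, fractions with denominator $0$ are read as $0$.) Variances may be $0$; $N(0,0)$ is the point mass at $0$. -/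

import Mathlib

open MeasureTheory ProbabilityTheory Filter Topology
open scoped NNReal ENNReal

noncomputable section

namespace FDP

/-! ### Index sets -/

/-- The cube `{1, ..., m 0} × ... × {1, ..., m (d-1)}` in `ℤ^d`. -/
def cube {d : ℕ} (m : Fin d → ℕ) : Finset (Fin d → ℤ) :=
  Fintype.piFinset fun k => Finset.Icc (1 : ℤ) (m k)

/-- The number `n = m 0 * ... * m (d-1)` of points of the cube. The limits below are along
`atTop : Filter (Fin d → ℕ)`, that is, as the smallest of the side lengths `m k` tends to infinity. -/
def size {d : ℕ} (m : Fin d → ℕ) : ℕ := ∏ k, m k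

/-! ### Stochastic boundedness and asymptotic normality -/

section General

variable {Ω ι : Type*} [MeasurableSpace Ω]

/-- `Y = O_P(r)` along the filter `l`. -/
def IsBigOP (P : Measure Ω) (l : Filter ι) (Y : ι → Ω → ℝ) (r : ι → ℝ) : Prop :=
  ∀ ε : ℝ, 0 < ε → ∃ K : ℝ, 0 < K ∧ ∀ᶠ i in l, P {ω | K * r i < |Y i ω|} ≤ ENNReal.ofReal ε

/-- `Y` converges weakly to the centered normal law with variance `v` (a point mass if `v = 0`). -/
def TendstoNormal (P : Measure Ω) [IsProbabilityMeasure P] (l : Filter ι) (Y : ι → Ω → ℝ)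
    (v : ℝ≥0) : Prop :=
  TendstoInDistribution Y l (id : ℝ → ℝ) (fun _ => P) (gaussianReal 0 v)

end General

/-! ### The hypotheses field -/

section Model

variable {d : ℕ} {Ω : Type*} [MeasurableSpace Ω]

/-- `π₀ = P(H_s = 0)`, the same for all `s` when the field `H` is stationary. -/
def pi0 (P : Measure Ω) (H : (Fin d → ℤ) → Ω → ℝ) : ℝ := P.real {ω | H 0 ω = 0}

/-- `π₁ = 1 - π₀`. -/
def pi1 (P : Measure Ω) (H : (Fin d → ℤ) → Ω → ℝ) : ℝ := 1 - pi0 P H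

/-- `N_C`, the sum of `H_s` over the cube. -/
def numFalse (H : (Fin d → ℤ) → Ω → ℝ) (m : Fin d → ℕ) (ω : Ω) : ℝ := ∑ s ∈ cube m, H s ω

/-- `H` is a stationary, `0/1`-valued random field on `ℤ^d` whose sums over cubes have
`L²` fluctuations of order `√n` and satisfy a central limit theorem. -/
structure IsStationaryBinaryField (P : Measure Ω) [IsProbabilityMeasure P]
    (H : (Fin d → ℤ) → Ω → ℝ) : Prop where
  measurable : ∀ s, Measurable (H s)
  binary : ∀ s ω, H s ω = 0 ∨ H s ω = 1
  stationary : ∀ a : Fin d → ℤ, IdentDistrib (fun ω s => H (s + a) ω) (fun ω s => H s ω) P P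
  l2_bound : (fun m : Fin d → ℕ => √(∫ ω, (numFalse H m ω - size m * pi1 P H) ^ 2 ∂P))
    =O[atTop] fun m => √(size m : ℝ)
  clt : ∃ v : ℝ≥0, TendstoNormal P atTop
    (fun (m : Fin d → ℕ) ω => (√(size m : ℝ))⁻¹ * (numFalse H m ω - size m * pi1 P H)) v

/-! ### The p-values -/

/-- `G` is a distribution function on `[0,1]` with bounded density `g = G'` (one-sided derivatives
at the end points). -/
structure IsAlternativeCDF (G g : ℝ → ℝ) : Prop where
  map_zero : G 0 = 0
  map_one : G 1 = 1
  mono : MonotoneOn G (Set.Icc 0 1)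
  deriv : ∀ x ∈ Set.Icc (0 : ℝ) 1, HasDerivWithinAt G (g x) (Set.Icc 0 1) x
  bounded : ∃ M : ℝ, ∀ x ∈ Set.Icc (0 : ℝ) 1, g x ≤ M

/-- The conditional independence model: given the field `H`, the p-values `X_s` are independent,
`X_s` being uniform on `(0,1)` if `H_s = 0` and having distribution function `G` if `H_s = 1`.
This is the joint law of `H` and `X_s = (1 - H_s) U_s + H_s G⁻¹(U_s)` with `U_s` i.i.d. uniform on
`(0,1)` and independent of `H`. -/
structure IsCondIndepModel (P : Measure Ω) (H X : (Fin d → ℤ) → Ω → ℝ) (G : ℝ → ℝ) : Prop where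
  measurable : ∀ s, Measurable (X s)
  law : ∀ (S : Finset (Fin d → ℤ)) (h t : (Fin d → ℤ) → ℝ),
    (∀ s, h s = 0 ∨ h s = 1) → (∀ s, t s ∈ Set.Icc (0 : ℝ) 1) →
    P.real {ω | ∀ s ∈ S, H s ω = h s ∧ X s ω ≤ t s} =
      P.real {ω | ∀ s ∈ S, H s ω = h s} * ∏ s ∈ S, if h s = 0 then t s else G (t s)

/-! ### Empirical processes -/

/-- `Λ_n(t)`. -/
def Lam_n (H X : (Fin d → ℤ) → Ω → ℝ) (m : Fin d → ℕ) (t : ℝ) (ω : Ω) : ℝ :=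
  (1 / (size m : ℝ)) * ∑ s ∈ cube m, (1 - H s ω) * if X s ω ≤ t then 1 else 0

/-- `F_n(t)`. -/
def F_n (X : (Fin d → ℤ) → Ω → ℝ) (m : Fin d → ℕ) (t : ℝ) (ω : Ω) : ℝ :=
  (1 / (size m : ℝ)) * ∑ s ∈ cube m, if X s ω ≤ t then 1 else 0

/-- The number of `H_s = 1` with `X_s > t`, divided by `n`. -/
def tildeDelta_n (H X : (Fin d → ℤ) → Ω → ℝ) (m : Fin d → ℕ) (t : ℝ) (ω : Ω) : ℝ :=
  (1 / (size m : ℝ)) * ∑ s ∈ cube m, H s ω * if t < X s ω then 1 else 0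

/-- The false discovery process `Γ_n(t)`. -/
def Gam_n (H X : (Fin d → ℤ) → Ω → ℝ) (m : Fin d → ℕ) (t : ℝ) (ω : Ω) : ℝ :=
  size m * Lam_n H X m t ω /
    (size m * F_n X m t ω + ∏ s ∈ cube m, if t < X s ω then 1 else 0)

/-- The false nondiscovery process `Ξ_n(t)`; the last indicator is that of `max_i X_i ≤ t`. -/
def Xi_n (H X : (Fin d → ℤ) → Ω → ℝ) (m : Fin d → ℕ) (t : ℝ) (ω : Ω) : ℝ :=
  tildeDelta_n H X m t ω /
    (1 - F_n X m t ω + (if ∀ s ∈ cube m, X s ω ≤ t then 1 else 0) / (size m : ℝ))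

/-- The threshold `ν_BH` of the Benjamini-Hochberg procedure at level `α`. -/
def nuBH (X : (Fin d → ℤ) → Ω → ℝ) (α : ℝ) (m : Fin d → ℕ) (ω : Ω) : ℝ :=
  sSup {t ∈ Set.Icc (0 : ℝ) 1 | t / α ≤ F_n X m t ω}

end Model

/-! ### Deterministic counterparts, with `p` the probability `π₀` -/

/-- `Λ(t) = E Λ_n(t) = t π₀`. -/
def Lam (p t : ℝ) : ℝ := t * p

/-- `F(t) = π₀ t + π₁ G(t)`, the marginal distribution function of the p-values on `[0,1]`. -/
def F (p : ℝ) (G : ℝ → ℝ) (t : ℝ) : ℝ := p * t + (1 - p) * G t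

/-- `f = F' = π₀ + π₁ g`. -/
def f (p : ℝ) (g : ℝ → ℝ) (t : ℝ) : ℝ := p + (1 - p) * g t

/-- `α_* = 1 / f(0)`. -/
def alphaStar (p : ℝ) (g : ℝ → ℝ) : ℝ := 1 / f p g 0

/-- `ν₀`. -/
def nu0 (p : ℝ) (G : ℝ → ℝ) (α : ℝ) : ℝ := sSup {t ∈ Set.Icc (0 : ℝ) 1 | t / α ≤ F p G t}

/-- `Ξ(t) = π₁ (1 - G(t)) / (1 - F(t))`. -/
def Xi (p : ℝ) (G : ℝ → ℝ) (t : ℝ) : ℝ := (1 - p) * (1 - G t) / (1 - F p G t)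

/-- The constant `c = π₀ (α - 1) / (1 - α f(ν₀)) + 1 - ν₀ / α`, with `ν` in place of `ν₀`. -/
def cConst (p : ℝ) (g : ℝ → ℝ) (α ν : ℝ) : ℝ := p * (α - 1) / (1 - α * f p g ν) + 1 - ν / α

end FDP

end

/-! The threshold is the last crossing of an empirical distribution function with the line t/α. For
a monotone function the last crossing is attained, so F_n(ν_BH) = ν_BH/α exactly, and likewise F(ν₀)
= ν₀/α (`apply_crossing`). Hence Γ_n(ν_BH) = (α/ν_BH) Λ_n(ν_BH) and Ξ_n(ν_BH) = Δ̃_n(ν_BH)/(1 -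
ν_BH/α), and the task is to expand smooth functions of ν_BH and of empirical processes at the random
point ν_BH.

The processes are controlled by conditioning on the values of H in the cube. There the p-values
become independent with two possible laws, and Λ_n, F_n and Δ̃_n, once centred, are combinations of
two conditionally centred counting processes and of N_C - nπ₁ (`linProc`). A Chernoff bound of
fourth order and dyadic chaining give a maximal inequality with constants that do not depend on the
configuration (`measure_exists_abs_centeredCount_sub_gt_le`), so it also holds unconditionally. On
[0,1] the normalized processes are O_P(n^{-1/2}). On a window of width of order n^{-1/2}, which
holds about n^{1/2} points, the counts fluctuate by n^{1/4}, so the normalized processes oscillate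
by O_P(n^{-3/4}): this is the source of the rate.

The condition f(ν₀) < 1/α makes F cross the line transversally, and the uniform n^{-1/2} bound then
forces ν_BH - ν₀ = O_P(n^{-1/2}) (`isBigOP_nuBH_sub`). So ν_BH may be replaced by ν₀ in each centred
process at cost O_P(n^{-3/4}). For Γ_n the deterministic part απ₀ is exact, because Λ is linear. For
Ξ_n one linearizes the quotient and eliminates ν_BH - ν₀ through (1/α - f(ν₀))(ν_BH - ν₀) ≈ F_n(ν₀)
- F(ν₀), which produces the constant c. The only extra error is the Taylor remainder of G at ν₀:
O_P(n^{-1}) under the condition on g, and o_P(n^{-1/2}) from differentiability alone.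

For the limit laws, `norm_charFun_sub_mul_le` shows that the characteristic function of a linear
process at a fixed t nearly factors into a Gaussian one, from the conditionally independent
p-values, and that of a multiple of N_C - nπ₁, whose limit is assumed. Slutsky's lemma absorbs the
remainders. -/

namespace FDP

/-! ### Tail bounds for sums of independent centred indicators -/

section Tail

variable {Ω ι : Type*} [MeasurableSpace Ω] {Q : Measure Ω} [IsProbabilityMeasure Q]

theorem integral_exp_centered_indicator_le {X : Ω → ℝ} (hX : Measurable X) {A : Set ℝ}
    (hA : MeasurableSet A) {q θ : ℝ} (hq : Q.real (X ⁻¹' A) = q) (hθ : |θ| ≤ 1) :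
    ∫ ω, Real.exp (θ * (A.indicator 1 (X ω) - q)) ∂Q ≤ Real.exp (q * θ ^ 2) := by
  have hq0 : 0 ≤ q := hq ▸ measureReal_nonneg
  have hpt : ∀ ω, Real.exp (θ * (A.indicator 1 (X ω) - q)) =
      Real.exp (-(θ * q)) * (1 + (Real.exp θ - 1) * (X ⁻¹' A).indicator 1 ω) := by
    intro ω
    by_cases h : X ω ∈ A
    · have h' : ω ∈ X ⁻¹' A := h
      simp only [h, h', Set.indicator_of_mem, Pi.one_apply]
      rw [show θ * (1 - q) = -(θ * q) + θ by ring, Real.exp_add]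
      ring
    · have h' : ω ∉ X ⁻¹' A := h
      simp only [h, h', Set.indicator_of_notMem, not_false_eq_true]
      ring_nf
  have hint : Integrable ((X ⁻¹' A).indicator (1 : Ω → ℝ)) Q :=
    (integrable_const (1 : ℝ)).indicator (hX hA)
  simp_rw [hpt]
  rw [integral_const_mul, integral_add (integrable_const _) (hint.const_mul _),
    integral_const_mul, integral_indicator_one (hX hA), hq]
  simp only [integral_const, probReal_univ, smul_eq_mul, mul_one]
  -- Uses e^θ - 1 ≤ θ + θ² for |θ| ≤ 1, then 1 + y ≤ e^y. The linear term cancels against the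
  -- centring, leaving qθ².
  have h1 : 1 + (Real.exp θ - 1) * q ≤ Real.exp (q * (θ + θ ^ 2)) := by
    have h2 := Real.add_one_le_exp ((Real.exp θ - 1) * q)
    have h3 := (abs_le.1 (Real.abs_exp_sub_one_sub_id_le hθ)).2
    have h4 : (Real.exp θ - 1) * q ≤ q * (θ + θ ^ 2) := by nlinarith
    have h5 := Real.exp_le_exp.2 h4
    linarith
  calc _ ≤ Real.exp (-(θ * q)) * Real.exp (q * (θ + θ ^ 2)) := by gcongr
    _ = _ := by rw [← Real.exp_add]; ring_nf

theorem integral_exp_sum_centered_indicator_le [Fintype ι] {X : ι → Ω → ℝ} (hindep : iIndepFun X Q)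
    (hX : ∀ i, Measurable (X i)) (T : Finset ι) {A : Set ℝ} (hA : MeasurableSet A) {q v θ : ℝ}
    (hq : ∀ i ∈ T, Q.real (X i ⁻¹' A) = q) (hv : T.card * q ≤ v) (hθ : |θ| ≤ 1) :
    mgf (∑ i ∈ T, fun ω => A.indicator 1 (X i ω) - q) Q θ ≤ Real.exp (v * θ ^ 2) := by
  have hm : Measurable (fun x : ℝ => A.indicator (1 : ℝ → ℝ) x - q) :=
    (measurable_one.indicator hA).sub_const q
  have hi : iIndepFun (fun i ω => A.indicator (1 : ℝ → ℝ) (X i ω) - q) Q :=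
    hindep.comp (fun _ x => A.indicator (1 : ℝ → ℝ) x - q) fun _ => hm
  rw [hi.mgf_sum (fun i => hm.comp (hX i))]
  calc _ ≤ ∏ i ∈ T, Real.exp (q * θ ^ 2) :=
        Finset.prod_le_prod (fun i _ => mgf_nonneg)
          fun i hiT => integral_exp_centered_indicator_le (hX i) hA (hq i hiT) hθ
    _ = Real.exp (T.card * q * θ ^ 2) := by
        rw [Finset.prod_const, ← Real.exp_nat_mul, mul_assoc]
    _ ≤ _ := by gcongr

/-- The fourth term of the exponential series gives e^y ≥ y⁴/24, and 24e < 66. -/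
theorem exp_one_sub_le {y : ℝ} (hy : 0 < y) : Real.exp (1 - y) ≤ 66 / y ^ 4 := by
  have h1 : y ^ 4 / 24 ≤ Real.exp y := by
    simpa [Nat.factorial] using Real.pow_div_factorial_le_exp y hy.le 4
  have h2 := Real.exp_one_lt_d9
  rw [Real.exp_sub, div_le_div_iff₀ (Real.exp_pos y) (by positivity)]
  have : 0 < y ^ 4 := by positivity
  nlinarith

/-- Fourth-order tail bound, derived from the moment generating function. -/
theorem measureReal_abs_sum_centered_indicator_ge_le [Fintype ι] {X : ι → Ω → ℝ}
    (hindep : iIndepFun X Q)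
    (hX : ∀ i, Measurable (X i)) (T : Finset ι) {A : Set ℝ} (hA : MeasurableSet A) {q v lam : ℝ}
    (hq : ∀ i ∈ T, Q.real (X i ⁻¹' A) = q) (hv : T.card * q ≤ v) (hv1 : 1 ≤ v) (hlam : 0 < lam) :
    Q.real {ω | lam ≤ |∑ i ∈ T, (A.indicator 1 (X i ω) - q)|} ≤ 132 * v ^ 2 / lam ^ 4 := by
  set S : Ω → ℝ := ∑ i ∈ T, fun ω => A.indicator 1 (X i ω) - q with hS
  have hSm : Measurable S := by
    have hm : Measurable (fun x : ℝ => A.indicator (1 : ℝ → ℝ) x - q) :=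
      (measurable_one.indicator hA).sub_const q
    have := Finset.measurable_sum T fun i _ => hm.comp (hX i)
    convert this using 1
    ext ω
    simp [hS]
  have hSb : ∀ ω, |S ω| ≤ T.card * (1 + |q|) := by
    intro ω
    rw [hS, Finset.sum_apply, ← nsmul_eq_mul]
    refine (Finset.abs_sum_le_sum_abs _ _).trans (Finset.sum_le_card_nsmul _ _ _ fun i _ => ?_)
    refine (abs_sub _ _).trans (add_le_add_left ?_ _)
    by_cases h : X i ω ∈ A <;> simp [h]
  have hint : ∀ t : ℝ, Integrable (fun ω => Real.exp (t * S ω)) Q := by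
    intro t
    refine Integrable.of_bound (by fun_prop) (Real.exp (|t| * (T.card * (1 + |q|)))) ?_
    filter_upwards with ω
    rw [Real.norm_eq_abs, Real.abs_exp]
    refine Real.exp_le_exp.2 ((le_abs_self _).trans ?_)
    rw [abs_mul]
    exact mul_le_mul_of_nonneg_left (hSb ω) (abs_nonneg _)
  have hsv : 0 < √v := Real.sqrt_pos.2 (by linarith)
  have hs1 : 1 ≤ √v := Real.one_le_sqrt.2 hv1
  have hsq : √v ^ 2 = v := Real.sq_sqrt (by linarith)
  -- This choice makes vθ² = 1, so each Chernoff bound is e^{1 - lam/√v}. The assumption v ≥ 1 is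
  -- what keeps θ ≤ 1.
  set θ := (√v)⁻¹ with hθdef
  have hθ0 : 0 < θ := inv_pos.2 hsv
  have hθ : |θ| ≤ 1 := by rw [abs_of_pos hθ0]; exact inv_le_one_of_one_le₀ hs1
  have hvθ : v * θ ^ 2 = 1 := by rw [hθdef, inv_pow, hsq]; field_simp
  have hvθ' : v * (-θ) ^ 2 = 1 := by rw [neg_sq, hvθ]
  have hy : 0 < θ * lam := by positivity
  have key : Real.exp (-θ * lam) * Real.exp 1 ≤ 66 * v ^ 2 / lam ^ 4 := by
    rw [← Real.exp_add, show -θ * lam + 1 = 1 - θ * lam by ring]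
    refine (exp_one_sub_le hy).trans (le_of_eq ?_)
    rw [mul_pow, hθdef, inv_pow, show √v ^ 4 = (√v ^ 2) ^ 2 by ring, hsq]
    field_simp
  have hu := measure_ge_le_exp_mul_mgf (μ := Q) (X := S) lam hθ0.le (hint θ)
  have hl := measure_le_le_exp_mul_mgf (μ := Q) (X := S) (-lam) (neg_nonpos.2 hθ0.le) (hint (-θ))
  have bu := integral_exp_sum_centered_indicator_le hindep hX T hA hq hv hθ
  have bl := integral_exp_sum_centered_indicator_le (θ := -θ) hindep hX T hA hq hv (by simpa using hθ)
  rw [hvθ] at bu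
  rw [hvθ'] at bl
  have hu' : Q.real {ω | lam ≤ S ω} ≤ 66 * v ^ 2 / lam ^ 4 :=
    hu.trans ((mul_le_mul_of_nonneg_left bu (Real.exp_pos _).le).trans key)
  have hl' : Q.real {ω | S ω ≤ -lam} ≤ 66 * v ^ 2 / lam ^ 4 := by
    refine hl.trans ((mul_le_mul_of_nonneg_left bl (Real.exp_pos _).le).trans ?_)
    rw [show - -θ * -lam = -θ * lam by ring]
    exact key
  have hsub : {ω | lam ≤ |∑ i ∈ T, (A.indicator 1 (X i ω) - q)|} ⊆
      {ω | lam ≤ S ω} ∪ {ω | S ω ≤ -lam} := by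
    intro ω hω
    have : S ω = ∑ i ∈ T, (A.indicator 1 (X i ω) - q) := by rw [hS, Finset.sum_apply]
    simp only [Set.mem_ofPred_eq, ← this] at hω
    rcases le_abs.1 hω with h | h
    · exact Or.inl h
    · exact Or.inr (by simp only [Set.mem_ofPred_eq]; linarith)
  calc _ ≤ Q.real ({ω | lam ≤ S ω} ∪ {ω | S ω ≤ -lam}) := measureReal_mono hsub
    _ ≤ _ := measureReal_union_le _ _
    _ ≤ 66 * v ^ 2 / lam ^ 4 + 66 * v ^ 2 / lam ^ 4 := add_le_add hu' hl'
    _ = _ := by ring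

end Tail

/-! ### Chaining for the centred empirical process -/

/-- A grid point of level K + 1 either lies on the grid of level K (even index) or is one step of
level K + 1 to the right of such a point (odd index). So a path from a uses at most one increment
per level. -/
theorem abs_sub_le_sum_of_dyadic_increments {z : ℝ → ℝ} {a δ : ℝ} {b : ℕ → ℝ} {K : ℕ}
    (h : ∀ k ≤ K, ∀ i < 2 ^ k,
      |z (a + ((i : ℕ) + 1) * (δ / 2 ^ k)) - z (a + i * (δ / 2 ^ k))| ≤ b k) :
    ∀ j ≤ 2 ^ K, |z (a + (j : ℕ) * (δ / 2 ^ K)) - z a| ≤ ∑ k ∈ Finset.range (K + 1), b k := by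
  induction K with
  | zero =>
    intro j hj
    have h0 := h 0 le_rfl 0 (by norm_num)
    have hb : 0 ≤ b 0 := (abs_nonneg _).trans h0
    simp only [pow_zero] at hj
    interval_cases j
    · simpa using hb
    · simpa using h0
  | succ K ih =>
    intro j hj
    have ih' := ih fun k hk => h k (hk.trans (Nat.le_succ K))
    have hb : 0 ≤ b (K + 1) := (abs_nonneg _).trans (h (K + 1) le_rfl 0 (by positivity))
    have half : ∀ i : ℕ, a + ((2 * i : ℕ) : ℝ) * (δ / 2 ^ (K + 1)) = a + i * (δ / 2 ^ K) := by
      intro i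
      push_cast
      field_simp
      ring
    rw [Finset.sum_range_succ]
    rw [pow_succ] at hj
    obtain ⟨i, rfl | rfl⟩ := j.even_or_odd'
    · rw [half]
      have := ih' i (by lia)
      linarith
    · have h1 := h (K + 1) le_rfl (2 * i) (by rw [pow_succ]; lia)
      have h2 := ih' i (by lia)
      rw [half] at h1
      push_cast at h1 ⊢
      have h3 := abs_add_le (z (a + (2 * (i : ℝ) + 1) * (δ / 2 ^ (K + 1))) - z (a + i * (δ / 2 ^ K)))
        (z (a + i * (δ / 2 ^ K)) - z a)
      rw [sub_add_sub_cancel] at h3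
      linarith

/-- The centred counting process `t ↦ #{i ∈ T : X i ≤ t} - #T Φ(t)`. -/
noncomputable def centeredCount {Ω ι : Type*} (Φ : ℝ → ℝ) (T : Finset ι) (X : ι → Ω → ℝ) (t : ℝ)
    (ω : Ω) : ℝ :=
  (∑ i ∈ T, if X i ω ≤ t then (1 : ℝ) else 0) - T.card * Φ t

theorem centeredCount_sub {Ω ι : Type*} (Φ : ℝ → ℝ) (T : Finset ι) (X : ι → Ω → ℝ) {s t : ℝ}
    (hst : s ≤ t) (ω : Ω) :
    centeredCount Φ T X t ω - centeredCount Φ T X s ω =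
      ∑ i ∈ T, ((Set.Ioc s t).indicator 1 (X i ω) - (Φ t - Φ s)) := by
  have h : ∀ i, (Set.Ioc s t).indicator (1 : ℝ → ℝ) (X i ω) =
      (if X i ω ≤ t then (1 : ℝ) else 0) - if X i ω ≤ s then (1 : ℝ) else 0 := by
    intro i
    simp only [Set.indicator_apply, Set.mem_Ioc, Pi.one_apply]
    by_cases h1 : X i ω ≤ s
    · simp [h1, h1.trans hst, not_lt.2 h1]
    · by_cases h2 : X i ω ≤ t <;> simp [h1, h2, not_le.1 h1]
  simp only [centeredCount, h, Finset.sum_sub_distrib, Finset.sum_const, nsmul_eq_mul]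
  ring

/-- Passage from a grid to all t: the count is monotone, so between two neighbouring grid points the
process leaves the range of its grid values by at most the growth e of the compensator over one
mesh. -/
theorem abs_centeredCount_sub_le {Ω ι : Type*} {Φ : ℝ → ℝ} {T : Finset ι} {X : ι → Ω → ℝ} {ω : Ω}
    {a δ c e L : ℝ} {N : ℕ} (hN : 0 < N) (hδ : 0 ≤ δ)
    (hΦ : ∀ s t, a ≤ s → s ≤ t → t ≤ a + δ → Φ t - Φ s ≤ L * (t - s))
    (he : T.card * L * (δ / N) ≤ e) (he0 : 0 ≤ T.card * L)
    (h : ∀ j ≤ N, |centeredCount Φ T X (a + (j : ℕ) * (δ / N)) ω - centeredCount Φ T X a ω| ≤ c)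
    {t : ℝ} (hat : a ≤ t) (htδ : t ≤ a + δ) :
    |centeredCount Φ T X t ω - centeredCount Φ T X a ω| ≤ c + e := by
  have hN' : (0 : ℝ) < N := by exact_mod_cast hN
  rcases hδ.eq_or_lt with rfl | hδ
  · have h1 := h 0 (Nat.zero_le _)
    obtain rfl : t = a := by linarith
    simp only [zero_div, mul_zero, add_zero, sub_self, abs_zero] at *
    linarith
  set η := δ / N with hη
  have hη0 : 0 < η := by positivity
  have hNη : N * η = δ := by rw [hη]; field_simp
  obtain ⟨j, hjN, hj1, hj2⟩ : ∃ j : ℕ, j + 1 ≤ N ∧ a + j * η ≤ t ∧ t ≤ a + (j + 1 : ℕ) * η := by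
    -- At the right end point the floor would return N, one cell too far; the last cell N - 1 is
    -- taken instead.
    rcases htδ.eq_or_lt with rfl | hlt
    · refine ⟨N - 1, by lia, ?_, ?_⟩
      · rw [Nat.cast_sub (by lia), sub_mul, hNη]
        push_cast
        linarith
      · rw [Nat.sub_add_cancel hN, hNη]
    · have h0 : 0 ≤ (t - a) / η := div_nonneg (by linarith) hη0.le
      refine ⟨⌊(t - a) / η⌋₊, ?_, ?_, ?_⟩
      · rw [Nat.add_one_le_iff, Nat.floor_lt h0, div_lt_iff₀ hη0, hNη]
        linarith
      · have := Nat.floor_le h0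
        rw [le_div_iff₀ hη0] at this
        linarith
      · have := Nat.lt_floor_add_one ((t - a) / η)
        rw [div_lt_iff₀ hη0] at this
        push_cast
        linarith
  have hj1N : ((j + 1 : ℕ) : ℝ) * η ≤ δ := by
    rw [← hNη]
    exact mul_le_mul_of_nonneg_right (by exact_mod_cast hjN) hη0.le
  have hjη : 0 ≤ (j : ℝ) * η := by positivity
  have mono : ∀ s t : ℝ, s ≤ t → (∑ i ∈ T, if X i ω ≤ s then (1 : ℝ) else 0) ≤
      ∑ i ∈ T, if X i ω ≤ t then (1 : ℝ) else 0 := by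
    intro s t hst
    refine Finset.sum_le_sum fun i _ => ?_
    by_cases h1 : X i ω ≤ s
    · simp [h1, h1.trans hst]
    · simp only [h1, if_false]
      split_ifs <;> norm_num
  have step : ∀ s t, a ≤ s → s ≤ t → t ≤ a + δ → t - s ≤ η → T.card * (Φ t - Φ s) ≤ e := by
    intro s t h1 h2 h3 h4
    calc _ ≤ T.card * (L * (t - s)) :=
          mul_le_mul_of_nonneg_left (hΦ s t h1 h2 h3) (Nat.cast_nonneg _)
      _ = (T.card * L) * (t - s) := by ring
      _ ≤ (T.card * L) * η := mul_le_mul_of_nonneg_left h4 he0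
      _ ≤ e := he
  have hη' : ((j + 1 : ℕ) : ℝ) * η = j * η + η := by push_cast; ring
  have s1 := step (a + j * η) t (by linarith) hj1 htδ (by linarith)
  have s2 := step t (a + (j + 1 : ℕ) * η) hat hj2 (by linarith) (by linarith)
  have h1 := abs_le.1 (h j (by lia))
  have h2 := abs_le.1 (h (j + 1) hjN)
  have m1 := mono _ _ hj1
  have m2 := mono _ _ hj2
  simp only [centeredCount] at h1 h2 ⊢
  rw [abs_le]
  constructor <;> linarith [h1.1, h2.2]

theorem sum_geom_nine_tenths_le (K : ℕ) : ∑ k ∈ Finset.range K, (9 / 10 : ℝ) ^ k ≤ 10 := by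
  rw [geom_sum_eq (by norm_num)]
  have : (0 : ℝ) ≤ (9 / 10) ^ K := by positivity
  linarith [show ((9 / 10 : ℝ) ^ K - 1) / (9 / 10 - 1) = 10 - 10 * (9 / 10) ^ K by ring]

theorem sum_geom_chaining_le (K : ℕ) : ∑ k ∈ Finset.range K, (5000 / 6561 : ℝ) ^ k ≤ 5 := by
  rw [geom_sum_eq (by norm_num)]
  have : (0 : ℝ) ≤ (5000 / 6561) ^ K := by positivity
  linarith [show ((5000 / 6561 : ℝ) ^ K - 1) / (5000 / 6561 - 1) =
    6561 / 1561 - 6561 / 1561 * (5000 / 6561) ^ K by ring]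

/-- Chaining with allowance lam (9/10)^k at level k, where there are 2^k increments of variance
proxy v/2^k. The fourth-order tail bound makes the failure probability of level k proportional to (2
(9/10)⁴)^{-k} = (5000/6561)^k, which is summable; a second-order bound would not suffice. The
allowances sum to at most 10 lam, and 660 = 132 · 5. -/
theorem measure_exists_abs_centeredCount_sub_gt_le {Ω ι : Type*} [Fintype ι] [MeasurableSpace Ω]
    {Q : Measure Ω} [IsProbabilityMeasure Q] {X : ι → Ω → ℝ} (hindep : iIndepFun X Q)
    (hX : ∀ i, Measurable (X i)) (T : Finset ι) {Φ : ℝ → ℝ} {a δ L v lam : ℝ} (hδ : 0 ≤ δ)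
    (hL : 0 ≤ L) (hcdf : ∀ i ∈ T, ∀ s t, a ≤ s → s ≤ t → t ≤ a + δ →
      Q.real (X i ⁻¹' Set.Ioc s t) = Φ t - Φ s)
    (hΦ : ∀ s t, a ≤ s → s ≤ t → t ≤ a + δ → Φ t - Φ s ≤ L * (t - s))
    (hv1 : 1 ≤ v) (hv : T.card * L * δ ≤ v) (hlam : 0 < lam) :
    Q {ω | ∃ t, a ≤ t ∧ t ≤ a + δ ∧
      10 * lam + 2 < |centeredCount Φ T X t ω - centeredCount Φ T X a ω|} ≤
        ENNReal.ofReal (660 * v ^ 2 / lam ^ 4) := by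
  -- The chain stops at 2^K ≤ v < 2^(K+1): up to this level v/2^k ≥ 1, as the tail bound requires,
  -- and the compensator grows by at most v/2^K < 2 over the final mesh.
  obtain ⟨K, hK1, hK2⟩ := exists_nat_pow_near hv1 (one_lt_two (α := ℝ))
  set B : ℕ → ℕ → Set Ω := fun k i => {ω | lam * (9 / 10) ^ k ≤
    |centeredCount Φ T X (a + ((i : ℕ) + 1) * (δ / 2 ^ k)) ω -
      centeredCount Φ T X (a + i * (δ / 2 ^ k)) ω|} with hB
  have hBle : ∀ k ≤ K, ∀ i < 2 ^ k, Q.real (B k i) ≤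
      132 * (v / 2 ^ k) ^ 2 / (lam * (9 / 10) ^ k) ^ 4 := by
    intro k hk i hi
    have h2k : (0 : ℝ) < 2 ^ k := by positivity
    set η := δ / 2 ^ k with hη
    have hη0 : 0 ≤ η := by positivity
    have hNη : 2 ^ k * η = δ := by rw [hη]; field_simp
    have hi0 : 0 ≤ (i : ℝ) * η := by positivity
    have hi' : ((i : ℝ) + 1) * η ≤ δ := by
      rw [← hNη]
      refine mul_le_mul_of_nonneg_right ?_ hη0
      exact_mod_cast hi
    have hst : a + (i : ℝ) * η ≤ a + ((i : ℝ) + 1) * η := by linarith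
    have hBk : B k i = {ω | lam * (9 / 10) ^ k ≤ |∑ i_1 ∈ T,
        ((Set.Ioc (a + (i : ℝ) * η) (a + ((i : ℝ) + 1) * η)).indicator 1 (X i_1 ω) -
          (Φ (a + ((i : ℝ) + 1) * η) - Φ (a + (i : ℝ) * η)))|} := by
      simp only [hB, ← hη, centeredCount_sub Φ T X hst]
    rw [hBk]
    refine measureReal_abs_sum_centered_indicator_ge_le hindep hX T measurableSet_Ioc
      (fun j hj => hcdf j hj _ _ (by linarith) hst (by linarith)) ?_ ?_ (by positivity)
    · have h1 := hΦ _ _ (by linarith) hst (by linarith)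
      rw [show a + ((i : ℝ) + 1) * η - (a + (i : ℝ) * η) = η by ring] at h1
      calc _ ≤ T.card * (L * η) := mul_le_mul_of_nonneg_left h1 (Nat.cast_nonneg _)
        _ = T.card * L * δ / 2 ^ k := by rw [hη]; ring
        _ ≤ v / 2 ^ k := by gcongr
    · rw [le_div_iff₀ h2k, one_mul]
      exact (pow_le_pow_right₀ (by norm_num) hk).trans hK1
  have hsub : {ω | ∃ t, a ≤ t ∧ t ≤ a + δ ∧
      10 * lam + 2 < |centeredCount Φ T X t ω - centeredCount Φ T X a ω|} ⊆
      ⋃ k ∈ Finset.range (K + 1), ⋃ i ∈ Finset.range (2 ^ k), B k i := by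
    rintro ω ⟨t, h1, h2, h3⟩
    by_contra hω
    simp only [Set.mem_iUnion, Finset.mem_range, not_exists, hB, Set.mem_ofPred_eq, not_le] at hω
    have hch := abs_sub_le_sum_of_dyadic_increments (z := fun t => centeredCount Φ T X t ω)
      (a := a) (δ := δ) (b := fun k => lam * (9 / 10) ^ k) (K := K)
      fun k hk i hi => (hω k (by lia) i hi).le
    rw [← Finset.mul_sum] at hch
    have hsum := mul_le_mul_of_nonneg_left (sum_geom_nine_tenths_le (K + 1)) hlam.le
    have := abs_centeredCount_sub_le (Φ := Φ) (T := T) (X := X) (ω := ω) (a := a) (δ := δ)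
      (c := 10 * lam) (e := 2) (L := L) (N := 2 ^ K) (by positivity) hδ hΦ ?_ (by positivity)
      (fun j hj => by
        have := hch j hj
        push_cast
        linarith) h1 h2
    · linarith
    · push_cast
      rw [← mul_div_assoc, div_le_iff₀ (by positivity)]
      rw [pow_succ] at hK2
      linarith
  have hreal : Q.real (⋃ k ∈ Finset.range (K + 1), ⋃ i ∈ Finset.range (2 ^ k), B k i) ≤
      660 * v ^ 2 / lam ^ 4 := by
    calc _ ≤ ∑ k ∈ Finset.range (K + 1), Q.real (⋃ i ∈ Finset.range (2 ^ k), B k i) :=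
          measureReal_biUnion_finset_le _ _
      _ ≤ ∑ k ∈ Finset.range (K + 1), ∑ i ∈ Finset.range (2 ^ k), Q.real (B k i) :=
          Finset.sum_le_sum fun k _ => measureReal_biUnion_finset_le _ _
      _ ≤ ∑ k ∈ Finset.range (K + 1), ∑ i ∈ Finset.range (2 ^ k),
          132 * (v / 2 ^ k) ^ 2 / (lam * (9 / 10) ^ k) ^ 4 := by
          refine Finset.sum_le_sum fun k hk => Finset.sum_le_sum fun i hi => ?_
          exact hBle k (by simpa [Nat.lt_succ_iff] using hk) i (by simpa using hi)
      _ = ∑ k ∈ Finset.range (K + 1), 132 * v ^ 2 / lam ^ 4 * (5000 / 6561 : ℝ) ^ k := by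
          refine Finset.sum_congr rfl fun k _ => ?_
          rw [Finset.sum_const, Finset.card_range, nsmul_eq_mul]
          have h1 : (5000 / 6561 : ℝ) ^ k = (1 / 2) ^ k / ((9 / 10) ^ k) ^ 4 := by
            rw [← pow_mul, mul_comm k 4, pow_mul, ← div_pow]
            norm_num
          rw [h1, one_div, inv_pow]
          push_cast
          field_simp
      _ = 132 * v ^ 2 / lam ^ 4 * ∑ k ∈ Finset.range (K + 1), (5000 / 6561 : ℝ) ^ k := by
          rw [Finset.mul_sum]
      _ ≤ 132 * v ^ 2 / lam ^ 4 * 5 := by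
          gcongr
          exact sum_geom_chaining_le _
      _ = _ := by ring
  refine (measure_mono hsub).trans ?_
  rw [← ofReal_measureReal (measure_ne_top _ _)]
  exact ENNReal.ofReal_le_ofReal hreal

/-! ### Conditioning on the hypotheses in a finite window -/

section Config

variable {d : ℕ} {Ω : Type*} {H X : (Fin d → ℤ) → Ω → ℝ} {G : ℝ → ℝ}

/-- The event that, within `C`, the sites with `H = 1` are those of `T`. -/
def config (H : (Fin d → ℤ) → Ω → ℝ) (C T : Finset (Fin d → ℤ)) : Set Ω :=
  {ω | ∀ s ∈ C, H s ω = if s ∈ T then 1 else 0}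

theorem exists_mem_config (hb : ∀ s ω, H s ω = 0 ∨ H s ω = 1) (C : Finset (Fin d → ℤ)) (ω : Ω) :
    ∃ T ∈ C.powerset, ω ∈ config H C T := by
  classical
  refine ⟨C.filter fun s => H s ω = 1, by simp, fun s hs => ?_⟩
  rcases hb s ω with h | h <;> simp [hs, h]

theorem config_disjoint {C T T' : Finset (Fin d → ℤ)} (hT : T ∈ C.powerset) (hT' : T' ∈ C.powerset)
    (hne : T ≠ T') : Disjoint (config H C T) (config H C T') := by
  rw [Set.disjoint_left]
  intro ω h h'
  refine hne (Finset.ext fun s => ?_)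
  rw [Finset.mem_powerset] at hT hT'
  constructor
  · intro hs
    have h1 := h s (hT hs)
    have h2 := h' s (hT hs)
    by_contra hs'
    simp [hs, hs'] at h1 h2
    linarith
  · intro hs
    have h1 := h s (hT' hs)
    have h2 := h' s (hT' hs)
    by_contra hs'
    simp [hs, hs'] at h1 h2
    linarith

theorem iUnion_config (hb : ∀ s ω, H s ω = 0 ∨ H s ω = 1) (C : Finset (Fin d → ℤ)) :
    ⋃ T ∈ C.powerset, config H C T = Set.univ := by
  refine Set.eq_univ_of_forall fun ω => ?_
  obtain ⟨T, hT, hω⟩ := exists_mem_config hb C ω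
  exact Set.mem_biUnion hT hω

variable [MeasurableSpace Ω] {P : Measure Ω}

theorem measurableSet_config (hH : ∀ s, Measurable (H s)) (C T : Finset (Fin d → ℤ)) :
    MeasurableSet (config H C T) := by
  have : config H C T = ⋂ s ∈ C, H s ⁻¹' {if s ∈ T then (1 : ℝ) else 0} := by
    ext ω
    simp [config]
  rw [this]
  exact Finset.measurableSet_biInter _ fun s _ => hH s (measurableSet_singleton _)

theorem integral_eq_sum_config {E : Type*} [NormedAddCommGroup E] [NormedSpace ℝ E]
    (hH : ∀ s, Measurable (H s)) (hb : ∀ s ω, H s ω = 0 ∨ H s ω = 1)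
    (C : Finset (Fin d → ℤ)) {Y : Ω → E} (hY : Integrable Y P) :
    ∫ ω, Y ω ∂P = ∑ T ∈ C.powerset, ∫ ω in config H C T, Y ω ∂P := by
  rw [← integral_biUnion_finset _ (fun T _ => measurableSet_config hH C T)
    (fun T hT T' hT' hne => config_disjoint hT hT' hne) (fun T _ => hY.integrableOn),
    iUnion_config hb, setIntegral_univ]

theorem IsCondIndepModel.measure_eq_and_le (hX : IsCondIndepModel P H X G) (s : Fin d → ℤ)
    {h t : ℝ} (hh : h = 0 ∨ h = 1) (ht : t ∈ Set.Icc (0 : ℝ) 1) :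
    P.real {ω | H s ω = h ∧ X s ω ≤ t} =
      P.real {ω | H s ω = h} * if h = 0 then t else G t := by
  have := hX.law {s} (fun _ => h) (fun _ => t) (fun _ => hh) (fun _ => ht)
  simpa using this

variable [IsProbabilityMeasure P]

/-- Total probability over the finitely many configurations. Only subadditivity is applied to A, so
it covers events of the form "there is t with ...", whose measurability is not at hand. -/
theorem measure_le_of_cond_le (hH : ∀ s, Measurable (H s)) (hb : ∀ s ω, H s ω = 0 ∨ H s ω = 1)
    (C : Finset (Fin d → ℤ)) (A : Set Ω) (b : ℝ≥0∞)
    (h : ∀ T ∈ C.powerset, P (config H C T) ≠ 0 →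
      P[|config H C T] (A ∩ config H C T) ≤ b) : P A ≤ b := by
  have hm := fun T => measurableSet_config hH C T
  calc P A = P (⋃ T ∈ C.powerset, A ∩ config H C T) := by
        rw [← Set.inter_iUnion₂, iUnion_config hb, Set.inter_univ]
    _ ≤ ∑ T ∈ C.powerset, P (A ∩ config H C T) := measure_biUnion_finset_le _ _
    _ ≤ ∑ T ∈ C.powerset, P (config H C T) * b := by
        refine Finset.sum_le_sum fun T hT => ?_
        by_cases h0 : P (config H C T) = 0
        · rw [measure_mono_null Set.inter_subset_right h0]
          exact zero_le
        · have h1 := h T hT h0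
          rw [cond_apply (hm T), Set.inter_comm, Set.inter_assoc, Set.inter_self] at h1
          calc P (A ∩ config H C T)
              = P (config H C T) * ((P (config H C T))⁻¹ * P (A ∩ config H C T)) := by
                rw [← mul_assoc, ENNReal.mul_inv_cancel h0 (measure_ne_top _ _), one_mul]
            _ ≤ _ := by gcongr
    _ = b := by
        rw [← Finset.sum_mul, ← measure_biUnion_finset
          (fun T hT T' hT' hne => config_disjoint hT hT' hne) (fun T _ => hm T),
          iUnion_config hb, measure_univ, one_mul]

/-- The model prescribes probabilities only for thresholds in [0,1]. The thresholds 0 and 1 already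
confine the p-values, since both conditional distribution functions equal 0 at 0 and 1 at 1. -/
theorem IsCondIndepModel.ae_mem_Ioc (hX : IsCondIndepModel P H X G) (hG0 : G 0 = 0) (hG1 : G 1 = 1)
    (hb : ∀ s ω, H s ω = 0 ∨ H s ω = 1) (hH : ∀ s, Measurable (H s)) (s : Fin d → ℤ) :
    ∀ᵐ ω ∂P, X s ω ∈ Set.Ioc (0 : ℝ) 1 := by
  have hle : ∀ h : ℝ, h = 0 ∨ h = 1 → P {ω | H s ω = h ∧ X s ω ≤ 0} = 0 := by
    intro h hh
    have := hX.measure_eq_and_le s hh (t := 0) (by simp)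
    rw [← measureReal_eq_zero_iff, this]
    rcases hh with rfl | rfl <;> simp [hG0]
  have hgt : ∀ h : ℝ, h = 0 ∨ h = 1 → P {ω | H s ω = h ∧ 1 < X s ω} = 0 := by
    intro h hh
    have h1 := hX.measure_eq_and_le s hh (t := 1) (by simp)
    have hm1 : MeasurableSet {ω | H s ω = h} := hH s (measurableSet_singleton h)
    have hm2 : MeasurableSet {ω | X s ω ≤ 1} := hX.measurable s measurableSet_Iic
    have h2 : {ω | H s ω = h ∧ 1 < X s ω} = {ω | H s ω = h} \ {ω | H s ω = h ∧ X s ω ≤ 1} := by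
      ext ω
      simp only [Set.mem_ofPred_eq, Set.mem_sdiff, not_and, not_le]
      tauto
    rw [← measureReal_eq_zero_iff, h2, measureReal_sdiff (μ := P) (s₁ := {ω | H s ω = h})
      (s₂ := {ω | H s ω = h ∧ X s ω ≤ 1}) (fun ω hω => hω.1) (hm1.inter hm2), h1]
    rcases hh with rfl | rfl <;> simp [hG1]
  have e : ∀ {A : Set Ω}, P A = 0 → ∀ᵐ ω ∂P, ω ∉ A := fun h => measure_eq_zero_iff_ae_notMem.1 h
  filter_upwards [e (hle 0 (Or.inl rfl)), e (hle 1 (Or.inr rfl)), e (hgt 0 (Or.inl rfl)),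
    e (hgt 1 (Or.inr rfl))] with ω h1 h2 h3 h4
  simp only [not_and, not_le, not_lt] at h1 h2 h3 h4
  rcases hb s ω with h | h
  · exact ⟨h1 h, h3 h⟩
  · exact ⟨h2 h, h4 h⟩

/-- The joint law is applied on all of C, with threshold 1 at the sites outside S: this constrains
nothing almost surely and contributes a factor 1. -/
theorem IsCondIndepModel.cond_forall_le (hX : IsCondIndepModel P H X G) (hG0 : G 0 = 0)
    (hG1 : G 1 = 1) (hb : ∀ s ω, H s ω = 0 ∨ H s ω = 1) (hH : ∀ s, Measurable (H s))
    {C T S : Finset (Fin d → ℤ)} (h0 : P (config H C T) ≠ 0) (hS : S ⊆ C)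
    (t : (Fin d → ℤ) → ℝ) (ht : ∀ s, t s ∈ Set.Icc (0 : ℝ) 1) :
    P[|config H C T].real {ω | ∀ s ∈ S, X s ω ≤ t s} =
      ∏ s ∈ S, if s ∈ T then G (t s) else t s := by
  classical
  have hlaw := hX.law C (fun s => if s ∈ T then 1 else 0) (fun s => if s ∈ S then t s else 1)
    (fun s => by by_cases h : s ∈ T <;> simp [h])
    (fun s => by by_cases h : s ∈ S <;> simp [h, (ht s).1, (ht s).2])
  have hev : P.real (config H C T ∩ {ω | ∀ s ∈ S, X s ω ≤ t s}) =
      P.real {ω | ∀ s ∈ C, H s ω = (if s ∈ T then 1 else 0) ∧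
        X s ω ≤ if s ∈ S then t s else 1} := by
    refine measureReal_congr ?_
    have hae : ∀ᵐ ω ∂P, ∀ s ∈ C, X s ω ∈ Set.Ioc (0 : ℝ) 1 :=
      (ae_ball_iff C.countable_toSet).2 fun s _ => hX.ae_mem_Ioc hG0 hG1 hb hH s
    rw [Filter.eventuallyEq_set]
    filter_upwards [hae] with ω hω
    constructor
    · rintro ⟨h1, h2⟩ s hs
      refine ⟨h1 s hs, ?_⟩
      by_cases h : s ∈ S
      · simpa [h] using h2 s h
      · simpa [h] using (hω s hs).2
    · intro h
      refine ⟨fun s hs => (h s hs).1, fun s hs => ?_⟩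
      simpa [hs] using (h s (hS hs)).2
  have hprod : (∏ s ∈ C, if (if s ∈ T then (1 : ℝ) else 0) = 0 then (if s ∈ S then t s else 1)
      else G (if s ∈ S then t s else 1)) = ∏ s ∈ S, if s ∈ T then G (t s) else t s := by
    rw [← Finset.prod_subset hS]
    · refine Finset.prod_congr rfl fun s hs => ?_
      by_cases h : s ∈ T <;> simp [h, hs]
    · intro s _ hs
      by_cases h : s ∈ T <;> simp [h, hs, hG1]
  have h0' : P.real (config H C T) ≠ 0 := by rwa [ne_eq, measureReal_eq_zero_iff]
  rw [measureReal_def, cond_apply (measurableSet_config hH C T), ENNReal.toReal_mul,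
    ENNReal.toReal_inv, ← measureReal_def, ← measureReal_def, hev, hlaw, hprod, ← mul_assoc]
  change _⁻¹ * P.real (config H C T) * _ = _
  rw [inv_mul_cancel₀ h0', one_mul]

theorem IsCondIndepModel.cond_le (hX : IsCondIndepModel P H X G) (hG0 : G 0 = 0)
    (hG1 : G 1 = 1) (hb : ∀ s ω, H s ω = 0 ∨ H s ω = 1) (hH : ∀ s, Measurable (H s))
    {C T : Finset (Fin d → ℤ)} (h0 : P (config H C T) ≠ 0) {s : Fin d → ℤ} (hs : s ∈ C)
    {t : ℝ} (ht : t ∈ Set.Icc (0 : ℝ) 1) :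
    P[|config H C T].real {ω | X s ω ≤ t} = if s ∈ T then G t else t := by
  have := hX.cond_forall_le hG0 hG1 hb hH h0 (Finset.singleton_subset_iff.2 hs) (fun _ => t)
    (fun _ => ht)
  simpa using this

theorem IsCondIndepModel.cond_Ioc (hX : IsCondIndepModel P H X G) (hG0 : G 0 = 0)
    (hG1 : G 1 = 1) (hb : ∀ s ω, H s ω = 0 ∨ H s ω = 1) (hH : ∀ s, Measurable (H s))
    {C T : Finset (Fin d → ℤ)} (h0 : P (config H C T) ≠ 0) {s : Fin d → ℤ} (hs : s ∈ C)
    {u t : ℝ} (hu : 0 ≤ u) (hut : u ≤ t) (ht : t ≤ 1) :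
    P[|config H C T].real (X s ⁻¹' Set.Ioc u t) =
      (if s ∈ T then G t else t) - if s ∈ T then G u else u := by
  have := cond_isProbabilityMeasure h0
  rw [← hX.cond_le hG0 hG1 hb hH h0 hs ⟨hu.trans hut, ht⟩,
    ← hX.cond_le hG0 hG1 hb hH h0 hs ⟨hu, hut.trans ht⟩,
    ← measureReal_sdiff (s₁ := {ω | X s ω ≤ t}) (s₂ := {ω | X s ω ≤ u})
      (fun ω hω => le_trans hω hut) (hX.measurable s measurableSet_Iic)]
  congr 1
  ext ω
  simp only [Set.mem_preimage, Set.mem_Ioc, Set.mem_sdiff, Set.mem_ofPred_eq, not_le]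
  tauto

/-- The half-lines form a π-system generating the Borel sets, and on them the conditional law is a
product by `cond_forall_le`. -/
theorem IsCondIndepModel.cond_iIndepFun (hX : IsCondIndepModel P H X G) (hG0 : G 0 = 0)
    (hG1 : G 1 = 1) (hb : ∀ s ω, H s ω = 0 ∨ H s ω = 1) (hH : ∀ s, Measurable (H s))
    {C T : Finset (Fin d → ℤ)} (h0 : P (config H C T) ≠ 0) :
    iIndepFun (fun s : C => X s) P[|config H C T] := by
  classical
  have hQ := cond_isProbabilityMeasure h0
  set Q := P[|config H C T] with hQdef
  have hae : ∀ᵐ ω ∂Q, ∀ s ∈ C, X s ω ∈ Set.Ioc (0 : ℝ) 1 :=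
    (ae_ball_iff C.countable_toSet).2 fun s _ =>
      (cond_absolutelyContinuous (μ := P)).ae_le (hX.ae_mem_Ioc hG0 hG1 hb hH s)
  -- Clamping extends the product formula from thresholds in [0,1] to all real ones, because the
  -- p-values lie in (0,1] almost surely.
  set cl : ℝ → ℝ := fun t => max 0 (min t 1) with hcl
  have hcl01 : ∀ t, cl t ∈ Set.Icc (0 : ℝ) 1 := fun t =>
    ⟨le_max_left _ _, max_le zero_le_one (min_le_right _ _)⟩
  have hcl' : ∀ x t : ℝ, x ∈ Set.Ioc (0 : ℝ) 1 → (x ≤ t ↔ x ≤ cl t) := by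
    intro x t hx
    simp only [hcl, le_max_iff, le_min_iff, not_le.2 hx.1, false_or, hx.2, and_true]
  have key : ∀ S ⊆ C, ∀ t : (Fin d → ℤ) → ℝ, Q.real {ω | ∀ s ∈ S, X s ω ≤ t s} =
      ∏ s ∈ S, if s ∈ T then G (cl (t s)) else cl (t s) := by
    intro S hS t
    rw [← hX.cond_forall_le hG0 hG1 hb hH h0 hS (fun s => cl (t s)) (fun s => hcl01 _)]
    refine measureReal_congr ?_
    rw [Filter.eventuallyEq_set]
    filter_upwards [hae] with ω hω
    exact forall₂_congr fun s hs => hcl' _ _ (hω s (hS hs))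
  rw [iIndepFun]
  refine iIndepSets.iIndep (m := fun s : C => (borel ℝ).comap (X s))
    (π := fun s : C => Set.preimage (X s) '' Set.range (Set.Iic : ℝ → Set ℝ)) ?_ ?_ ?_ ?_
  · intro s
    rw [← BorelSpace.measurable_eq (α := ℝ)]
    exact (hX.measurable s).comap_le
  · intro s
    have : IsPiSystem (Set.range (Set.Iic : ℝ → Set ℝ)) := isPiSystem_Iic
    exact this.comap (X s)
  · intro s
    rw [borel_eq_generateFrom_Iic, MeasurableSpace.comap_generateFrom]
  · rw [iIndepSets_iff]
    intro S f hf
    have hf' : ∀ s : C, ∃ t : ℝ, s ∈ S → f s = X s ⁻¹' Set.Iic t := by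
      intro s
      by_cases hs : s ∈ S
      · obtain ⟨_, ⟨t, rfl⟩, ht⟩ := hf s hs
        exact ⟨t, fun _ => ht.symm⟩
      · exact ⟨0, fun h => absurd h hs⟩
    choose t ht using hf'
    set t' : (Fin d → ℤ) → ℝ := fun s => if h : s ∈ C then t ⟨s, h⟩ else 0 with ht'
    have h1 := key (S.map (Function.Embedding.subtype _))
      (fun s hs => by
        obtain ⟨x, _, rfl⟩ := Finset.mem_map.1 hs
        exact x.2) t'
    have h2 : ∀ s : C, Q.real {ω | X s ω ≤ t s} =
        if (s : Fin d → ℤ) ∈ T then G (cl (t s)) else cl (t s) := by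
      intro s
      have := key {(s : Fin d → ℤ)} (Finset.singleton_subset_iff.2 s.2) (fun _ => t s)
      simpa using this
    have h3 : ⋂ s ∈ S, f s =
        {ω | ∀ s ∈ S.map (Function.Embedding.subtype _), X s ω ≤ t' s} := by
      ext ω
      simp only [Set.mem_iInter, Finset.mem_map, Function.Embedding.subtype_apply, Set.mem_ofPred_eq]
      constructor
      · rintro h _ ⟨s, hs, rfl⟩
        have := h s hs
        rw [ht s hs] at this
        simpa [ht'] using this
      · intro h s hs
        rw [ht s hs]
        have := h s ⟨s, hs, rfl⟩
        simpa [ht'] using this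
    rw [h3, ← ofReal_measureReal (measure_ne_top _ _), h1, Finset.prod_map]
    have h4 : ∀ s ∈ S, Q (f s) = ENNReal.ofReal
        (if (s : Fin d → ℤ) ∈ T then G (cl (t s)) else cl (t s)) := by
      intro s hs
      rw [← h2 s, ofReal_measureReal (measure_ne_top _ _), ht s hs]
      rfl
    rw [Finset.prod_congr rfl h4, ← ENNReal.ofReal_prod_of_nonneg]
    · simp [ht']
    · intro s _
      rw [← h2 s]
      exact measureReal_nonneg

end Config

/-! ### Calculus of stochastic orders -/

section Orders

variable {Ω ι : Type*} [MeasurableSpace Ω] {P : Measure Ω} {l : Filter ι}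

/-- `sup_{t ∈ S} |Y t| = O_P(r)` along the filter `l`. -/
def IsUnifBigOP (P : Measure Ω) (l : Filter ι) (S : ι → Set ℝ) (Y : ι → ℝ → Ω → ℝ) (r : ι → ℝ) :
    Prop :=
  ∀ ε : ℝ, 0 < ε → ∃ K : ℝ, 0 < K ∧
    ∀ᶠ i in l, P {ω | ∃ t ∈ S i, K * r i < |Y i t ω|} ≤ ENNReal.ofReal ε

/-- `Y = o_P(r)` along the filter `l`. -/
def IsLittleOP (P : Measure Ω) (l : Filter ι) (Y : ι → Ω → ℝ) (r : ι → ℝ) : Prop :=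
  ∀ η : ℝ, 0 < η → ∀ ε : ℝ, 0 < ε → ∀ᶠ i in l, P {ω | η * r i < |Y i ω|} ≤ ENNReal.ofReal ε

theorem measure_le_ofReal_of_subset_union {A B C : Set Ω} {ε : ℝ} (hε : 0 < ε)
    (hB : P B ≤ ENNReal.ofReal (ε / 2)) (hC : P C ≤ ENNReal.ofReal (ε / 2)) (h : A ⊆ B ∪ C) :
    P A ≤ ENNReal.ofReal ε := by
  calc P A ≤ P (B ∪ C) := measure_mono h
    _ ≤ P B + P C := measure_union_le _ _
    _ ≤ ENNReal.ofReal (ε / 2) + ENNReal.ofReal (ε / 2) := add_le_add hB hC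
    _ = _ := by rw [← ENNReal.ofReal_add (by positivity) (by positivity), add_halves]

variable {S : ι → Set ℝ} {Y Z : ι → ℝ → Ω → ℝ} {y z w : ι → Ω → ℝ} {r r' : ι → ℝ}

theorem isBigOP_iff_isUnifBigOP : IsBigOP P l y r ↔
    IsUnifBigOP P l (fun _ => {0}) (fun i _ => y i) r := by
  simp [IsBigOP, IsUnifBigOP]

theorem IsUnifBigOP.add (hY : IsUnifBigOP P l S Y r) (hZ : IsUnifBigOP P l S Z r) :
    IsUnifBigOP P l S (fun i t ω => Y i t ω + Z i t ω) r := by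
  intro ε hε
  obtain ⟨K, hK, h1⟩ := hY (ε / 2) (by positivity)
  obtain ⟨K', hK', h2⟩ := hZ (ε / 2) (by positivity)
  refine ⟨K + K', by positivity, ?_⟩
  filter_upwards [h1, h2] with i h1 h2
  refine measure_le_ofReal_of_subset_union hε h1 h2 ?_
  rintro ω ⟨t, ht, h⟩
  by_contra hn
  simp only [Set.mem_union, Set.mem_ofPred_eq, not_or, not_exists, not_and, not_lt] at hn
  have := abs_add_le (Y i t ω) (Z i t ω)
  have h3 := hn.1 t ht
  have h4 := hn.2 t ht
  linarith

/-- Multiplication of a uniformly bounded process by a deterministic function. -/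
theorem IsUnifBigOP.mul_of_abs_mul_le (hY : IsUnifBigOP P l S Y r) (b : ι → ℝ → ℝ) {C : ℝ}
    (hb : ∀ᶠ i in l, ∀ t ∈ S i, |b i t| * r i ≤ C * r' i) (hr' : ∀ᶠ i in l, 0 ≤ r' i) :
    IsUnifBigOP P l S (fun i t ω => b i t * Y i t ω) r' := by
  intro ε hε
  obtain ⟨K, hK, h1⟩ := hY ε hε
  -- C may be zero or negative, while the constant has to be positive.
  refine ⟨K * (|C| + 1), by positivity, ?_⟩
  filter_upwards [h1, hb, hr'] with i h1 hb hr'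
  refine (measure_mono ?_).trans h1
  rintro ω ⟨t, ht, h⟩
  refine ⟨t, ht, ?_⟩
  by_contra hn
  rw [not_lt] at hn
  have hC : C * r' i ≤ |C| * r' i := mul_le_mul_of_nonneg_right (le_abs_self C) hr'
  have : |b i t * Y i t ω| ≤ K * (|C| + 1) * r' i := by
    rw [abs_mul]
    calc |b i t| * |Y i t ω| ≤ |b i t| * (K * r i) := mul_le_mul_of_nonneg_left hn (abs_nonneg _)
      _ = K * (|b i t| * r i) := by ring
      _ ≤ K * ((|C| + 1) * r' i) := by
        refine mul_le_mul_of_nonneg_left ?_ hK.le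
        linarith [hb t ht]
      _ = _ := by ring
  linarith

theorem IsUnifBigOP.congr (hY : IsUnifBigOP P l S Y r)
    (h : ∀ᶠ i in l, ∀ t ω, Z i t ω = Y i t ω) : IsUnifBigOP P l S Z r := by
  intro ε hε
  obtain ⟨K, hK, h1⟩ := hY ε hε
  refine ⟨K, hK, ?_⟩
  filter_upwards [h1, h] with i h1 h
  simpa only [h] using h1

theorem IsBigOP.isUnifBigOP (hy : IsBigOP P l y r) :
    IsUnifBigOP P l S (fun i _ => y i) r := by
  intro ε hε
  obtain ⟨K, hK, h1⟩ := hy ε hε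
  refine ⟨K, hK, ?_⟩
  filter_upwards [h1] with i h1
  refine (measure_mono ?_).trans h1
  rintro ω ⟨_, _, h⟩
  exact h

theorem IsUnifBigOP.isBigOP (hY : IsUnifBigOP P l S Y r) {t : ℝ} (ht : ∀ i, t ∈ S i) :
    IsBigOP P l (fun i => Y i t) r := by
  intro ε hε
  obtain ⟨K, hK, h1⟩ := hY ε hε
  refine ⟨K, hK, ?_⟩
  filter_upwards [h1] with i h1
  refine (measure_mono fun ω hω => ?_).trans h1
  exact ⟨t, ht i, hω⟩

theorem IsBigOP.add (hy : IsBigOP P l y r) (hz : IsBigOP P l z r) :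
    IsBigOP P l (fun i ω => y i ω + z i ω) r := by
  rw [isBigOP_iff_isUnifBigOP] at *
  exact hy.add hz

/-- The event |w| ≥ δ has asymptotically negligible probability, so a domination valid only near the
limit point is enough. It is applied with w = ν_BH - ν₀ to keep denominators away from 0. -/
theorem IsBigOP.of_abs_le_of_abs_lt {r₀ : ι → ℝ} {δ : ℝ} (hδ : 0 < δ) (hz : IsBigOP P l z r)
    (hw : IsBigOP P l w r₀) (hr₀ : Tendsto r₀ l (𝓝 0))
    (h : ∀ᶠ i in l, ∀ᵐ ω ∂P, |w i ω| < δ → |y i ω| ≤ |z i ω|) : IsBigOP P l y r := by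
  intro ε hε
  obtain ⟨K, hK, h1⟩ := hz (ε / 2) (by positivity)
  obtain ⟨K', hK', h2⟩ := hw (ε / 2) (by positivity)
  refine ⟨K, hK, ?_⟩
  have h3 : ∀ᶠ i in l, K' * r₀ i < δ := by
    have : Tendsto (fun i => K' * r₀ i) l (𝓝 (K' * 0)) := hr₀.const_mul K'
    rw [mul_zero] at this
    exact this.eventually_lt_const hδ
  filter_upwards [h1, h2, h3, h] with i h1 h2 h3 h
  have hnull : P {ω | ¬ (|w i ω| < δ → |y i ω| ≤ |z i ω|)} = 0 := h
  calc P {ω | K * r i < |y i ω|}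
      ≤ P (({ω | K * r i < |z i ω|} ∪ {ω | K' * r₀ i < |w i ω|}) ∪
          {ω | ¬ (|w i ω| < δ → |y i ω| ≤ |z i ω|)}) := by
        refine measure_mono fun ω hω => ?_
        simp only [Set.mem_union, Set.mem_ofPred_eq] at hω ⊢
        by_contra hn
        simp only [not_or, not_not, not_lt] at hn
        have := hn.2 (hn.1.2.trans_lt h3)
        linarith [hn.1.1]
    _ ≤ P ({ω | K * r i < |z i ω|} ∪ {ω | K' * r₀ i < |w i ω|}) + 0 := by
        rw [← hnull]
        exact measure_union_le _ _
    _ ≤ ENNReal.ofReal ε := by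
        rw [add_zero]
        exact measure_le_ofReal_of_subset_union hε h1 h2 subset_rfl

theorem isBigOP_zero (hr : ∀ᶠ i in l, 0 ≤ r i) : IsBigOP P l (fun _ _ => (0 : ℝ)) r := by
  intro ε hε
  refine ⟨1, one_pos, ?_⟩
  filter_upwards [hr] with i hi
  have : {ω : Ω | 1 * r i < |(0 : ℝ)|} = ∅ := by
    ext ω
    simp [hi]
  rw [this]
  simp

theorem isBigOP_of_ae_eq_zero (hr : ∀ᶠ i in l, 0 ≤ r i) (h : ∀ᶠ i in l, ∀ᵐ ω ∂P, y i ω = 0) :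
    IsBigOP P l y r := by
  refine IsBigOP.of_abs_le_of_abs_lt (z := fun _ _ => 0) (w := fun _ _ => 0) (r₀ := fun _ => 0)
    one_pos (isBigOP_zero hr) (isBigOP_zero (Eventually.of_forall fun _ => le_rfl))
    tendsto_const_nhds ?_
  filter_upwards [h] with i hi
  filter_upwards [hi] with ω hω _
  simp [hω]

theorem IsBigOP.of_abs_le (hz : IsBigOP P l z r) (h : ∀ i ω, |y i ω| ≤ |z i ω|) :
    IsBigOP P l y r := by
  intro ε hε
  obtain ⟨K, hK, h1⟩ := hz ε hε
  refine ⟨K, hK, ?_⟩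
  filter_upwards [h1] with i h1
  exact (measure_mono fun ω hω => lt_of_lt_of_le hω (h i ω)).trans h1

theorem IsBigOP.abs (hz : IsBigOP P l z r) : IsBigOP P l (fun i ω => |z i ω|) r :=
  hz.of_abs_le fun _ _ => (abs_abs _).le

theorem IsBigOP.congr (hz : IsBigOP P l z r) (h : ∀ᶠ i in l, ∀ ω, y i ω = z i ω) :
    IsBigOP P l y r := by
  intro ε hε
  obtain ⟨K, hK, h1⟩ := hz ε hε
  refine ⟨K, hK, ?_⟩
  filter_upwards [h1, h] with i h1 h
  simpa only [h] using h1

theorem IsBigOP.const_mul (hy : IsBigOP P l y r) (c : ℝ) (hr : ∀ᶠ i in l, 0 ≤ r i) :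
    IsBigOP P l (fun i ω => c * y i ω) r := by
  rw [isBigOP_iff_isUnifBigOP] at *
  exact hy.mul_of_abs_mul_le (fun _ _ => c) (C := |c|)
    (Eventually.of_forall fun _ _ _ => le_rfl) hr

theorem IsBigOP.mono (hy : IsBigOP P l y r) (h : ∀ᶠ i in l, r i ≤ r' i) : IsBigOP P l y r' := by
  intro ε hε
  obtain ⟨K, hK, h1⟩ := hy ε hε
  refine ⟨K, hK, ?_⟩
  filter_upwards [h1, h] with i h1 h
  refine (measure_mono fun ω hω => ?_).trans h1
  exact lt_of_le_of_lt (mul_le_mul_of_nonneg_left h hK.le) hω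

theorem IsBigOP.mul (hy : IsBigOP P l y r) (hz : IsBigOP P l z r') :
    IsBigOP P l (fun i ω => y i ω * z i ω) (fun i => r i * r' i) := by
  intro ε hε
  obtain ⟨K, hK, h1⟩ := hy (ε / 2) (by positivity)
  obtain ⟨K', hK', h2⟩ := hz (ε / 2) (by positivity)
  refine ⟨K * K', by positivity, ?_⟩
  filter_upwards [h1, h2] with i h1 h2
  refine measure_le_ofReal_of_subset_union hε h1 h2 ?_
  intro ω h
  by_contra hn
  simp only [Set.mem_union, Set.mem_ofPred_eq, not_or, not_lt] at hn h
  have := mul_le_mul hn.1 hn.2 (abs_nonneg _) ((abs_nonneg _).trans hn.1)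
  rw [abs_mul] at h
  linarith

/-- Substitution of a random argument which is localized at rate `r₀` around `a`. -/
theorem IsBigOP.comp_of_isUnifBigOP {r₀ : ι → ℝ} {ν : ι → Ω → ℝ} {a : ℝ} {S₀ : Set ℝ}
    (hν : IsBigOP P l (fun i ω => ν i ω - a) r₀) (hS₀ : ∀ i ω, ν i ω ∈ S₀)
    (hY : ∀ R : ℝ, 0 < R → IsUnifBigOP P l (fun i => {t | t ∈ S₀ ∧ |t - a| ≤ R * r₀ i}) Y r) :
    IsBigOP P l (fun i ω => Y i (ν i ω) ω) r := by
  intro ε hε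
  obtain ⟨R, hR, h1⟩ := hν (ε / 2) (by positivity)
  obtain ⟨K, hK, h2⟩ := hY R hR (ε / 2) (by positivity)
  refine ⟨K, hK, ?_⟩
  filter_upwards [h1, h2] with i h1 h2
  refine measure_le_ofReal_of_subset_union hε h1 h2 ?_
  intro ω h
  by_contra hn
  simp only [Set.mem_union, Set.mem_ofPred_eq, not_or, not_exists, not_and, not_lt] at hn h
  exact absurd h (not_lt.2 (hn.2 (ν i ω) ⟨hS₀ i ω, hn.1⟩))

theorem IsBigOP.isLittleOP (hy : IsBigOP P l y r)
    (h : ∀ K : ℝ, 0 < K → ∀ η : ℝ, 0 < η → ∀ᶠ i in l, K * r i ≤ η * r' i) :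
    IsLittleOP P l y r' := by
  intro η hη ε hε
  obtain ⟨K, hK, h1⟩ := hy ε hε
  filter_upwards [h1, h K hK η hη] with i h1 h
  exact (measure_mono fun ω hω => lt_of_le_of_lt h hω).trans h1

theorem IsLittleOP.add (hy : IsLittleOP P l y r) (hz : IsLittleOP P l z r) :
    IsLittleOP P l (fun i ω => y i ω + z i ω) r := by
  intro η hη ε hε
  filter_upwards [hy (η / 2) (by positivity) (ε / 2) (by positivity),
    hz (η / 2) (by positivity) (ε / 2) (by positivity)] with i h1 h2
  refine measure_le_ofReal_of_subset_union hε h1 h2 ?_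
  intro ω h
  by_contra hn
  simp only [Set.mem_union, Set.mem_ofPred_eq, not_or, not_lt] at hn h
  have := abs_add_le (y i ω) (z i ω)
  linarith [hn.1, hn.2]

theorem IsLittleOP.const_mul (hy : IsLittleOP P l y r) (c : ℝ) (hr : ∀ᶠ i in l, 0 ≤ r i) :
    IsLittleOP P l (fun i ω => c * y i ω) r := by
  intro η hη ε hε
  filter_upwards [hy (η / (|c| + 1)) (by positivity) ε hε, hr] with i h1 hr
  refine (measure_mono fun ω hω => ?_).trans h1
  simp only [Set.mem_ofPred_eq, abs_mul] at hω ⊢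
  by_contra hn
  rw [not_lt, div_mul_eq_mul_div, le_div_iff₀ (by positivity)] at hn
  nlinarith [abs_nonneg (y i ω), abs_nonneg c]

theorem IsLittleOP.tendstoInMeasure (hy : IsLittleOP P l y r) {s : ι → ℝ}
    (hs : ∀ᶠ i in l, 0 < s i) (hsr : ∀ᶠ i in l, s i * r i ≤ 1) :
    TendstoInMeasure P (fun i ω => s i * y i ω) l 0 := by
  rw [tendstoInMeasure_iff_norm]
  intro η hη
  rw [ENNReal.tendsto_nhds_zero]
  intro ε hε
  rcases eq_or_ne ε ∞ with rfl | hε'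
  · exact Eventually.of_forall fun _ => le_top
  have hε'' : 0 < ε.toReal := ENNReal.toReal_pos hε.ne' hε'
  filter_upwards [hy (η / 2) (by positivity) _ hε'', hs, hsr] with i h1 hs hsr
  rw [ENNReal.ofReal_toReal hε'] at h1
  refine (measure_mono fun ω hω => ?_).trans h1
  simp only [Set.mem_ofPred_eq, Pi.zero_apply, sub_zero, Real.norm_eq_abs, abs_mul,
    abs_of_pos hs] at hω ⊢
  by_contra hn
  rw [not_lt] at hn
  have := mul_le_mul_of_nonneg_left hn hs.le
  nlinarith

end Orders

/-! ### The size of the cubes -/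

section Size

variable {d : ℕ}

theorem card_cube (m : Fin d → ℕ) : (cube m).card = size m := by
  simp [cube, size, Fintype.card_piFinset]

/-- Positivity of d is essential: for d = 0 the empty product is constantly 1. -/
theorem tendsto_size (hd : 0 < d) : Tendsto (size : (Fin d → ℕ) → ℕ) atTop atTop := by
  rw [tendsto_atTop]
  intro b
  filter_upwards [eventually_ge_atTop (fun _ : Fin d => b + 1)] with m hm
  have : Nonempty (Fin d) := ⟨⟨0, hd⟩⟩
  calc b ≤ b + 1 := Nat.le_succ b
    _ ≤ (b + 1) ^ d := Nat.le_self_pow hd.ne' _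
    _ = ∏ _k : Fin d, (b + 1) := by simp
    _ ≤ size m := Finset.prod_le_prod' fun k _ => hm k

/-- `n^{1/4}` for the cube of `n` points. -/
noncomputable def rootSize (m : Fin d → ℕ) : ℝ := √√(size m : ℝ)

theorem rootSize_sq (m : Fin d → ℕ) : rootSize m ^ 2 = √(size m : ℝ) :=
  Real.sq_sqrt (Real.sqrt_nonneg _)

theorem rootSize_pow_four (m : Fin d → ℕ) : rootSize m ^ 4 = size m := by
  rw [show rootSize m ^ 4 = (rootSize m ^ 2) ^ 2 by ring, rootSize_sq,
    Real.sq_sqrt (Nat.cast_nonneg _)]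

theorem tendsto_rootSize (hd : 0 < d) : Tendsto (rootSize : (Fin d → ℕ) → ℝ) atTop atTop :=
  Real.tendsto_sqrt_atTop.comp (Real.tendsto_sqrt_atTop.comp
    (tendsto_natCast_atTop_atTop.comp (tendsto_size hd)))

theorem tendsto_inv_rootSize_pow (hd : 0 < d) {k : ℕ} (hk : k ≠ 0) :
    Tendsto (fun m : Fin d → ℕ => (rootSize m)⁻¹ ^ k) atTop (𝓝 0) := by
  have := (tendsto_inv_atTop_zero.comp (tendsto_rootSize hd)).pow k
  simpa [hk] using this

theorem rpow_size_eq {m : Fin d → ℕ} :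
    (size m : ℝ) ^ (-(3 / 4) : ℝ) = (rootSize m)⁻¹ ^ 3 := by
  have h0 : 0 ≤ rootSize m := Real.sqrt_nonneg _
  rw [← rootSize_pow_four, inv_pow, ← Real.rpow_natCast, ← Real.rpow_mul h0,
    ← Real.rpow_natCast, ← Real.rpow_neg h0]
  norm_num

end Size

/-! ### Uniform bounds for the conditionally centred processes -/

section ConditionalSums

variable {d : ℕ} {Ω : Type*} [MeasurableSpace Ω] {P : Measure Ω} [IsProbabilityMeasure P]
  {H X : (Fin d → ℤ) → Ω → ℝ} {G : ℝ → ℝ}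

/-- The distribution function of a p-value given the value `h` of the hypothesis. -/
noncomputable def condCDF (G : ℝ → ℝ) (h t : ℝ) : ℝ := if h = 0 then t else G t

/-- The counting process of the sites of `C` with `H = j`, centred given `H`. -/
noncomputable def condProc (G : ℝ → ℝ) (H X : (Fin d → ℤ) → Ω → ℝ) (j : ℝ)
    (C : Finset (Fin d → ℤ)) (t : ℝ) (ω : Ω) : ℝ :=
  ∑ s ∈ C, if H s ω = j then (if X s ω ≤ t then 1 else 0) - condCDF G j t else 0

/-- On a configuration, `condProc` is the centred counting process of those sites of C with H = j,
which are conditionally i.i.d. Their number is at most that of C, so one v serves all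
configurations. -/
theorem measure_exists_abs_condProc_sub_gt_le (hX : IsCondIndepModel P H X G) (hG0 : G 0 = 0)
    (hG1 : G 1 = 1) (hb : ∀ s ω, H s ω = 0 ∨ H s ω = 1) (hH : ∀ s, Measurable (H s))
    (C : Finset (Fin d → ℤ)) {j a δ L v lam : ℝ} (ha : 0 ≤ a) (hδ : 0 ≤ δ)
    (haδ : a + δ ≤ 1) (hL : 0 ≤ L)
    (hLip : ∀ s t, 0 ≤ s → s ≤ t → t ≤ 1 → condCDF G j t - condCDF G j s ≤ L * (t - s))
    (hv1 : 1 ≤ v) (hv : C.card * L * δ ≤ v) (hlam : 0 < lam) :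
    P {ω | ∃ t, a ≤ t ∧ t ≤ a + δ ∧
      10 * lam + 2 < |condProc G H X j C t ω - condProc G H X j C a ω|} ≤
        ENNReal.ofReal (660 * v ^ 2 / lam ^ 4) := by
  classical
  refine measure_le_of_cond_le hH hb C _ _ fun T hT h0 => ?_
  have hQ := cond_isProbabilityMeasure h0
  have hind := hX.cond_iIndepFun hG0 hG1 hb hH h0
  set T' : Finset C := Finset.univ.filter fun s =>
    (if (s : Fin d → ℤ) ∈ T then (1 : ℝ) else 0) = j with hT'
  have hproc : ∀ ω ∈ config H C T, ∀ t, condProc G H X j C t ω =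
      centeredCount (condCDF G j) T' (fun s : C => X s) t ω := by
    intro ω hω t
    have h1 : condProc G H X j C t ω = ∑ s ∈ C,
        if (if s ∈ T then (1 : ℝ) else 0) = j
          then (if X s ω ≤ t then 1 else 0) - condCDF G j t else 0 :=
      Finset.sum_congr rfl fun s hs => by rw [hω s hs]
    rw [h1, ← Finset.sum_coe_sort C, ← Finset.sum_filter, Finset.sum_sub_distrib,
      Finset.sum_const, nsmul_eq_mul, centeredCount]
  have hcard : (T'.card : ℝ) ≤ C.card := by
    have := Finset.card_le_univ T'
    rw [Fintype.card_coe] at this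
    exact_mod_cast this
  refine le_trans (measure_mono ?_) (measure_exists_abs_centeredCount_sub_gt_le (a := a) (δ := δ)
    (L := L) (v := v) hind (fun s => hX.measurable s) T' (Φ := condCDF G j) hδ hL ?_
    (fun s t h1 h2 h3 => hLip s t (ha.trans h1) h2 (h3.trans haδ)) hv1 ?_ hlam)
  · rintro ω ⟨⟨t, h1, h2, h3⟩, hω⟩
    rw [hproc ω hω, hproc ω hω] at h3
    exact ⟨t, h1, h2, h3⟩
  · intro s hs u t h1 h2 h3
    rw [hX.cond_Ioc hG0 hG1 hb hH h0 s.2 (ha.trans h1) h2 (h3.trans haδ)]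
    have hs' : (if (s : Fin d → ℤ) ∈ T then (1 : ℝ) else 0) = j := by simpa [hT'] using hs
    by_cases h : (s : Fin d → ℤ) ∈ T
    · have : j ≠ 0 := by rw [← hs']; simp [h]
      simp [h, condCDF, this]
    · have : j = 0 := by rw [← hs']; simp [h]
      simp [h, condCDF, this]
  · refine le_trans ?_ hv
    gcongr

theorem condProc_zero_ae (hX : IsCondIndepModel P H X G) (hG0 : G 0 = 0)
    (hG1 : G 1 = 1) (hb : ∀ s ω, H s ω = 0 ∨ H s ω = 1) (hH : ∀ s, Measurable (H s))
    (C : Finset (Fin d → ℤ)) (j : ℝ) : ∀ᵐ ω ∂P, condProc G H X j C 0 ω = 0 := by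
  have hae : ∀ᵐ ω ∂P, ∀ s ∈ C, X s ω ∈ Set.Ioc (0 : ℝ) 1 :=
    (ae_ball_iff C.countable_toSet).2 fun s _ => hX.ae_mem_Ioc hG0 hG1 hb hH s
  filter_upwards [hae] with ω hω
  refine Finset.sum_eq_zero fun s hs => ?_
  simp [condCDF, hG0, not_le.2 (hω s hs).1]

theorem exists_pow_four_gt (C ε : ℝ) (hε : 0 < ε) : ∃ κ : ℝ, 1 ≤ κ ∧ C / κ ^ 4 ≤ ε := by
  refine ⟨max 1 (C / ε), le_max_left _ _, ?_⟩
  have h1 : 1 ≤ max 1 (C / ε) := le_max_left _ _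
  rw [div_le_iff₀ (by positivity)]
  have h2 : C / ε ≤ max 1 (C / ε) := le_max_right _ _
  rw [div_le_iff₀ hε] at h2
  have h3 : max 1 (C / ε) ≤ max 1 (C / ε) ^ 4 := le_self_pow₀ h1 (by norm_num)
  nlinarith

/-- The maximal inequality on [0,1] with v = nL and lam = κ n^{1/2}, for which v²/lam⁴ = L²/κ⁴. The
process starts from 0 almost surely. -/
theorem isUnifBigOP_condProc (hd : 0 < d) (hX : IsCondIndepModel P H X G) (hG0 : G 0 = 0)
    (hG1 : G 1 = 1) (hb : ∀ s ω, H s ω = 0 ∨ H s ω = 1) (hH : ∀ s, Measurable (H s))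
    {j L : ℝ} (hL : 1 ≤ L)
    (hLip : ∀ s t, 0 ≤ s → s ≤ t → t ≤ 1 → condCDF G j t - condCDF G j s ≤ L * (t - s)) :
    IsUnifBigOP P atTop (fun _ => Set.Icc 0 1) (fun m => condProc G H X j (cube m))
      (fun m => rootSize m ^ 2) := by
  intro ε hε
  obtain ⟨κ, hκ, hκε⟩ := exists_pow_four_gt (660 * L ^ 2) ε hε
  refine ⟨10 * κ + 2, by positivity, ?_⟩
  filter_upwards [(tendsto_rootSize hd).eventually_ge_atTop 1] with m hm
  set x := rootSize m with hx
  have hx2 : 1 ≤ x ^ 2 := one_le_pow₀ hm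
  have hx4 : x ^ 4 = size m := rootSize_pow_four m
  have h1 := measure_exists_abs_condProc_sub_gt_le hX hG0 hG1 hb hH (cube m) (a := 0) (δ := 1)
    (v := x ^ 4 * L) (lam := κ * x ^ 2) le_rfl zero_le_one (by norm_num) (by linarith) hLip
    (one_le_mul_of_one_le_of_one_le (one_le_pow₀ hm) hL) (by rw [card_cube, hx4, mul_one])
    (by positivity)
  have hnull : P {ω | ¬ condProc G H X j (cube m) 0 ω = 0} = 0 :=
    condProc_zero_ae hX hG0 hG1 hb hH (cube m) j
  rw [zero_add] at h1
  calc _ ≤ P ({ω | ∃ t, 0 ≤ t ∧ t ≤ 1 ∧ 10 * (κ * x ^ 2) + 2 <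
          |condProc G H X j (cube m) t ω - condProc G H X j (cube m) 0 ω|} ∪
          {ω | ¬ condProc G H X j (cube m) 0 ω = 0}) := measure_mono ?_
    _ ≤ _ := measure_union_le _ _
    _ ≤ ENNReal.ofReal (660 * (x ^ 4 * L) ^ 2 / (κ * x ^ 2) ^ 4) := by
        rw [hnull, add_zero]
        exact h1
    _ ≤ _ := ?_
  · rintro ω ⟨t, ⟨h0t, ht1⟩, ht⟩
    by_cases h0 : condProc G H X j (cube m) 0 ω = 0
    · refine Or.inl ⟨t, h0t, ht1, ?_⟩
      rw [h0, sub_zero]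
      nlinarith
    · exact Or.inr h0
  · refine ENNReal.ofReal_le_ofReal (le_trans (le_of_eq ?_) hκε)
    have : x ≠ 0 := by positivity
    field_simp

/-- A window of length 2R n^{-1/2} has v = 2RL n^{1/2}, so lam = κ n^{1/4} keeps v²/lam⁴ bounded.
After division by n this is the rate n^{-3/4}. -/
theorem isUnifBigOP_condProc_sub (hd : 0 < d) (hX : IsCondIndepModel P H X G) (hG0 : G 0 = 0)
    (hG1 : G 1 = 1) (hb : ∀ s ω, H s ω = 0 ∨ H s ω = 1) (hH : ∀ s, Measurable (H s))
    {j L ν R : ℝ} (hL : 1 ≤ L) (hν0 : 0 < ν) (hν1 : ν < 1) (hR : 0 < R)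
    (hLip : ∀ s t, 0 ≤ s → s ≤ t → t ≤ 1 → condCDF G j t - condCDF G j s ≤ L * (t - s)) :
    IsUnifBigOP P atTop
      (fun m => {t | t ∈ Set.Icc (0 : ℝ) 1 ∧ |t - ν| ≤ R * (rootSize m)⁻¹ ^ 2})
      (fun m t ω => condProc G H X j (cube m) t ω - condProc G H X j (cube m) ν ω)
      (fun m => rootSize m) := by
  intro ε hε
  obtain ⟨κ, hκ, hκε⟩ := exists_pow_four_gt (660 * (2 * R * L) ^ 2) ε hε
  -- Twice the constant 10κ + 2: the maximal inequality compares with the left end of the window,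
  -- while the increment is taken from ν.
  refine ⟨20 * κ + 4, by positivity, ?_⟩
  have hsmall : ∀ᶠ m : Fin d → ℕ in atTop, R * (rootSize m)⁻¹ ^ 2 < min ν (1 - ν) := by
    have := (tendsto_inv_rootSize_pow hd two_ne_zero).const_mul R
    rw [mul_zero] at this
    exact this.eventually_lt_const (lt_min hν0 (by linarith))
  filter_upwards [(tendsto_rootSize hd).eventually_ge_atTop 1,
    (tendsto_rootSize hd).eventually_ge_atTop (2 * R * L)⁻¹, hsmall] with m hm hm' hsm
  set x := rootSize m with hx
  have hx0 : 0 < x := by linarith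
  have hx4 : x ^ 4 = size m := rootSize_pow_four m
  have hδ0 : 0 < R * x⁻¹ ^ 2 := by positivity
  have h1 := measure_exists_abs_condProc_sub_gt_le hX hG0 hG1 hb hH (cube m)
    (a := ν - R * x⁻¹ ^ 2) (δ := 2 * (R * x⁻¹ ^ 2))
    (v := 2 * R * L * x ^ 2) (lam := κ * x)
    (by linarith [lt_min_iff.1 hsm |>.1]) (by positivity)
    (by linarith [lt_min_iff.1 hsm |>.2]) (by linarith) hLip ?_ ?_ (by positivity)
  · refine (measure_mono ?_).trans (h1.trans ?_)
    · rintro ω ⟨t, ⟨_, ht⟩, h⟩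
      rw [abs_le] at ht
      by_contra hn
      simp only [Set.mem_ofPred_eq, not_exists, not_and, not_lt] at hn
      have e1 := hn t (by linarith) (by linarith)
      have e2 := hn ν (by linarith) (by linarith)
      have e3 := abs_sub_le (condProc G H X j (cube m) t ω)
        (condProc G H X j (cube m) (ν - R * x⁻¹ ^ 2) ω) (condProc G H X j (cube m) ν ω)
      rw [abs_sub_comm (condProc G H X j (cube m) (ν - R * x⁻¹ ^ 2) ω)] at e3
      nlinarith
    · refine ENNReal.ofReal_le_ofReal (le_trans (le_of_eq ?_) hκε)
      field_simp
  · rw [inv_le_iff_one_le_mul₀ (by positivity)] at hm'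
    have : x ≤ x ^ 2 := le_self_pow₀ hm (by norm_num)
    have : 0 < 2 * R * L := by positivity
    nlinarith
  · rw [card_cube, ← hx4]
    refine le_of_eq ?_
    field_simp

end ConditionalSums

/-! ### The last crossing of a monotone function with a line -/

section Crossing

variable {φ : ℝ → ℝ} {α : ℝ}

theorem crossing_mem_Icc (α : ℝ) (φ : ℝ → ℝ) :
    sSup {t ∈ Set.Icc (0 : ℝ) 1 | t / α ≤ φ t} ∈ Set.Icc (0 : ℝ) 1 :=
  ⟨Real.sSup_nonneg fun _ ht => ht.1.1, Real.sSup_le (fun _ ht => ht.1.2) zero_le_one⟩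

theorem le_crossing {t : ℝ} (ht : t ∈ Set.Icc (0 : ℝ) 1) (h : t / α ≤ φ t) :
    t ≤ sSup {t ∈ Set.Icc (0 : ℝ) 1 | t / α ≤ φ t} :=
  le_csSup ⟨1, fun _ hs => hs.1.2⟩ ⟨ht, h⟩

theorem lt_of_crossing_lt {t : ℝ} (h : sSup {t ∈ Set.Icc (0 : ℝ) 1 | t / α ≤ φ t} < t)
    (ht : t ≤ 1) : φ t < t / α := by
  by_contra hn
  have h0 := (crossing_mem_Icc α φ).1
  exact absurd (le_crossing ⟨by linarith, ht⟩ (not_lt.1 hn)) (not_le.2 h)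

/-- Monotonicity replaces continuity. Every t of the set satisfies t ≤ αφ(t) ≤ αφ(ν), so ν ≤ αφ(ν);
then αφ(ν) itself belongs to the set, since φ(αφ(ν)) ≥ φ(ν), so αφ(ν) ≤ ν. -/
theorem apply_crossing (hα0 : 0 < α) (hα1 : α ≤ 1) (hφ : MonotoneOn φ (Set.Icc 0 1))
    (h01 : ∀ t ∈ Set.Icc (0 : ℝ) 1, φ t ∈ Set.Icc (0 : ℝ) 1) :
    φ (sSup {t ∈ Set.Icc (0 : ℝ) 1 | t / α ≤ φ t}) =
      sSup {t ∈ Set.Icc (0 : ℝ) 1 | t / α ≤ φ t} / α := by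
  set ν := sSup {t ∈ Set.Icc (0 : ℝ) 1 | t / α ≤ φ t} with hν
  have hνI : ν ∈ Set.Icc (0 : ℝ) 1 := crossing_mem_Icc α φ
  have hge : ν / α ≤ φ ν := by
    rw [div_le_iff₀ hα0, hν]
    refine csSup_le ⟨0, ⟨le_rfl, zero_le_one⟩, ?_⟩ fun t ht => ?_
    · rw [zero_div]
      exact (h01 0 ⟨le_rfl, zero_le_one⟩).1
    · have h1 := ht.2
      rw [div_le_iff₀ hα0] at h1
      exact h1.trans (mul_le_mul_of_nonneg_right (hφ ht.1 hνI (le_crossing ht.1 ht.2)) hα0.le)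
  refine le_antisymm ?_ hge
  have hφν := h01 ν hνI
  have ht : φ ν * α ∈ Set.Icc (0 : ℝ) 1 :=
    ⟨mul_nonneg hφν.1 hα0.le, mul_le_one₀ hφν.2 hα0.le hα1⟩
  have hle : ν ≤ φ ν * α := (div_le_iff₀ hα0).1 hge
  rw [le_div_iff₀ hα0]
  refine le_crossing ht ?_
  rw [mul_div_cancel_right₀ _ hα0.ne']
  exact hφ hνI ht hle

end Crossing

/-! ### The Benjamini-Hochberg threshold -/

section Threshold

variable {d : ℕ} {Ω : Type*} {X : (Fin d → ℤ) → Ω → ℝ} {α : ℝ}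

theorem F_n_mono (X : (Fin d → ℤ) → Ω → ℝ) (m : Fin d → ℕ) (ω : Ω) :
    Monotone fun t => F_n X m t ω := by
  intro s t hst
  refine mul_le_mul_of_nonneg_left (Finset.sum_le_sum fun i _ => ?_) (by positivity)
  by_cases h1 : X i ω ≤ s
  · simp [h1, h1.trans hst]
  · simp only [h1, if_false]
    split_ifs <;> norm_num

theorem exists_F_n_eq (X : (Fin d → ℤ) → Ω → ℝ) (m : Fin d → ℕ) (t : ℝ) (ω : Ω) :
    ∃ k ≤ size m, F_n X m t ω = k / size m := by
  refine ⟨((cube m).filter fun s => X s ω ≤ t).card, ?_, ?_⟩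
  · rw [← card_cube]
    exact Finset.card_filter_le _ _
  · rw [F_n, Finset.sum_boole, one_div, div_eq_inv_mul]

theorem natCast_div_mem_Icc {k n : ℕ} (h : k ≤ n) : (k / n : ℝ) ∈ Set.Icc (0 : ℝ) 1 :=
  ⟨by positivity, div_le_one_of_le₀ (by exact_mod_cast h) (Nat.cast_nonneg _)⟩

theorem F_n_mem_Icc (X : (Fin d → ℤ) → Ω → ℝ) (m : Fin d → ℕ) (t : ℝ) (ω : Ω) :
    F_n X m t ω ∈ Set.Icc (0 : ℝ) 1 := by
  obtain ⟨k, hk, h⟩ := exists_F_n_eq X m t ω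
  rw [h]
  exact natCast_div_mem_Icc hk

theorem F_n_nuBH (hα : α ∈ Set.Ioo (0 : ℝ) 1) (m : Fin d → ℕ) (ω : Ω) :
    F_n X m (nuBH X α m ω) ω = nuBH X α m ω / α :=
  apply_crossing (φ := fun t => F_n X m t ω) hα.1 hα.2.le ((F_n_mono X m ω).monotoneOn _)
    fun t _ => F_n_mem_Icc X m t ω

theorem nuBH_mem_Icc (m : Fin d → ℕ) (ω : Ω) : nuBH X α m ω ∈ Set.Icc (0 : ℝ) 1 :=
  crossing_mem_Icc α _

variable [MeasurableSpace Ω]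

theorem measurable_F_n (hX : ∀ s, Measurable (X s)) (m : Fin d → ℕ) {τ : Ω → ℝ}
    (hτ : Measurable τ) : Measurable fun ω => F_n X m (τ ω) ω :=
  (Finset.measurable_sum _ fun s _ => Measurable.ite (measurableSet_le (hX s) hτ)
    measurable_const measurable_const).const_mul _

/-- By the crossing identity the threshold is one of the finitely many values αk/n, so the supremum
over a continuum reduces to a finite union of events. -/
theorem measurable_nuBH (hX : ∀ s, Measurable (X s)) (hα : α ∈ Set.Ioo (0 : ℝ) 1)
    (m : Fin d → ℕ) : Measurable (nuBH X α m) := by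
  refine measurable_of_Ici fun c => ?_
  have h : nuBH X α m ⁻¹' Set.Ici c = ⋃ k ∈ Finset.range (size m + 1),
      {ω | c ≤ α * (k / size m) ∧ (k / size m : ℝ) ≤ F_n X m (α * (k / size m)) ω} := by
    ext ω
    simp only [Set.mem_preimage, Set.mem_Ici, Set.mem_iUnion, Finset.mem_range, Nat.lt_succ_iff,
      Set.mem_ofPred_eq, exists_prop]
    have hF := F_n_nuBH (X := X) hα m ω
    constructor
    · intro hc
      obtain ⟨k, hk, hk'⟩ := exists_F_n_eq X m (nuBH X α m ω) ω
      have hν : α * (k / size m) = nuBH X α m ω := by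
        rw [← hk', hF, mul_div_cancel₀ _ hα.1.ne']
      exact ⟨k, hk, by rwa [hν], by rw [hν, hk']⟩
    · rintro ⟨k, hk, h1, h2⟩
      have hk' := natCast_div_mem_Icc hk
      refine h1.trans (le_crossing
        ⟨mul_nonneg hα.1.le hk'.1, mul_le_one₀ hα.2.le hk'.1 hk'.2⟩ ?_)
      rwa [mul_div_cancel_left₀ _ hα.1.ne']
  rw [h]
  refine Finset.measurableSet_biUnion _ fun k _ => ?_
  exact (MeasurableSet.const _).inter
    (measurableSet_le measurable_const (measurable_F_n hX m measurable_const))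

end Threshold

/-! ### The deterministic mixture distribution function -/

section Mixture

variable {G g : ℝ → ℝ} {p α : ℝ}

theorem IsAlternativeCDF.mem_Icc (hG : IsAlternativeCDF G g) {t : ℝ} (ht : t ∈ Set.Icc (0 : ℝ) 1) :
    G t ∈ Set.Icc (0 : ℝ) 1 := by
  constructor
  · rw [← hG.map_zero]
    exact hG.mono ⟨le_rfl, zero_le_one⟩ ht ht.1
  · rw [← hG.map_one]
    exact hG.mono ht ⟨zero_le_one, le_rfl⟩ ht.2

theorem IsAlternativeCDF.exists_lipschitz (hG : IsAlternativeCDF G g) :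
    ∃ L : ℝ, 1 ≤ L ∧ ∀ s t, 0 ≤ s → s ≤ t → t ≤ 1 → G t - G s ≤ L * (t - s) := by
  obtain ⟨M, hM⟩ := hG.bounded
  refine ⟨max 1 M, le_max_left _ _, fun s t hs hst ht => ?_⟩
  have hcont : ContinuousOn G (Set.Icc 0 1) := fun x hx => (hG.deriv x hx).continuousWithinAt
  have hd : ∀ x ∈ Set.Ioo (0 : ℝ) 1, HasDerivAt G (g x) x := fun x hx =>
    (hG.deriv x ⟨hx.1.le, hx.2.le⟩).hasDerivAt (Icc_mem_nhds hx.1 hx.2)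
  refine Convex.image_sub_le_mul_sub_of_deriv_le (convex_Icc 0 1) hcont ?_ ?_ s
    ⟨hs, hst.trans ht⟩ t ⟨hs.trans hst, ht⟩ hst
  · rw [interior_Icc]
    exact fun x hx => (hd x hx).differentiableAt.differentiableWithinAt
  · rw [interior_Icc]
    intro x hx
    rw [(hd x hx).deriv]
    exact (hM x ⟨hx.1.le, hx.2.le⟩).trans (le_max_right _ _)

theorem F_mono (hG : IsAlternativeCDF G g) (hp : p ∈ Set.Icc (0 : ℝ) 1) :
    MonotoneOn (F p G) (Set.Icc 0 1) := by
  intro s hs t ht hst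
  have h1 := hG.mono hs ht hst
  have h2 := hp.1
  have h3 : 0 ≤ 1 - p := by linarith [hp.2]
  unfold F
  gcongr

theorem F_mem_Icc (hG : IsAlternativeCDF G g) (hp : p ∈ Set.Icc (0 : ℝ) 1) {t : ℝ}
    (ht : t ∈ Set.Icc (0 : ℝ) 1) : F p G t ∈ Set.Icc (0 : ℝ) 1 := by
  have h1 := hG.mem_Icc ht
  have h2 := hp.1
  have h3 : 0 ≤ 1 - p := by linarith [hp.2]
  unfold F
  constructor
  · exact add_nonneg (mul_nonneg h2 ht.1) (mul_nonneg h3 h1.1)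
  · nlinarith [mul_le_mul_of_nonneg_left ht.2 h2, mul_le_mul_of_nonneg_left h1.2 h3]

theorem F_nu0 (hG : IsAlternativeCDF G g) (hp : p ∈ Set.Icc (0 : ℝ) 1)
    (hα : α ∈ Set.Ioo (0 : ℝ) 1) : F p G (nu0 p G α) = nu0 p G α / α :=
  apply_crossing hα.1 hα.2.le (F_mono hG hp) fun _ ht => F_mem_Icc hG hp ht

theorem nu0_le (hG : IsAlternativeCDF G g) (hp : p ∈ Set.Icc (0 : ℝ) 1)
    (hα : α ∈ Set.Ioo (0 : ℝ) 1) : nu0 p G α ≤ α := by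
  have h1 := (F_mem_Icc hG hp (crossing_mem_Icc α (F p G))).2
  change F p G (nu0 p G α) ≤ 1 at h1
  rw [F_nu0 hG hp hα, div_le_one hα.1] at h1
  exact h1

theorem hasDerivWithinAt_F (hG : IsAlternativeCDF G g) {t : ℝ} (ht : t ∈ Set.Icc (0 : ℝ) 1) :
    HasDerivWithinAt (F p G) (f p g t) (Set.Icc 0 1) t := by
  have h1 := ((hasDerivWithinAt_id t (Set.Icc 0 1)).const_mul p).add
    ((hG.deriv t ht).const_mul (1 - p))
  rw [mul_one] at h1
  exact h1

/-- F starts at 0 with slope f(0) > 1/α, hence lies above the line just to the right of 0. -/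
theorem nu0_pos (hG : IsAlternativeCDF G g)
    (h : α⁻¹ < f p g 0) : 0 < nu0 p G α := by
  have h1 := hasDerivWithinAt_F (p := p) hG (t := 0) ⟨le_rfl, zero_le_one⟩
  have h2 := (hasDerivWithinAt_iff_tendsto_slope.1 h1).eventually_const_lt h
  have hne : (𝓝[Set.Icc (0 : ℝ) 1 \ {0}] 0).NeBot := by
    have : Set.Icc (0 : ℝ) 1 \ {0} = Set.Ioc 0 1 := by
      ext x
      simp only [Set.mem_sdiff, Set.mem_Icc, Set.mem_singleton_iff, Set.mem_Ioc]
      constructor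
      · rintro ⟨⟨h1, h2⟩, h3⟩
        exact ⟨lt_of_le_of_ne h1 (Ne.symm h3), h2⟩
      · rintro ⟨h1, h2⟩
        exact ⟨⟨h1.le, h2⟩, h1.ne'⟩
    rw [this, nhdsWithin_Ioc_eq_nhdsGT zero_lt_one]
    infer_instance
  obtain ⟨t, ht1, ht2⟩ := (h2.and self_mem_nhdsWithin).exists
  have ht0 : 0 < t := lt_of_le_of_ne ht2.1.1 (Ne.symm ht2.2)
  have hF0 : F p G 0 = 0 := by simp [F, hG.map_zero]
  rw [slope_def_field, hF0, sub_zero, sub_zero, lt_div_iff₀ ht0] at ht1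
  refine ht0.trans_le (le_crossing ht2.1 ?_)
  rw [div_eq_inv_mul]
  exact ht1.le

/-- Transversality of the crossing, quantified on both sides. -/
theorem exists_transversality (hG : IsAlternativeCDF G g) (hp : p ∈ Set.Icc (0 : ℝ) 1)
    (hα : α ∈ Set.Ioo (0 : ℝ) 1) (h0 : 0 < nu0 p G α) (h : f p g (nu0 p G α) < α⁻¹) :
    ∃ κ : ℝ, 0 < κ ∧ ∃ ε : ℝ, 0 < ε ∧ ε < nu0 p G α ∧
      (∀ t, nu0 p G α ≤ t → t ≤ 1 → F p G t - t / α ≤ -(κ * (t - nu0 p G α))) ∧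
      (∀ t, nu0 p G α - ε ≤ t → t ≤ nu0 p G α → κ * (nu0 p G α - t) ≤ F p G t - t / α) := by
  set ν := nu0 p G α with hν
  have hνα : ν ≤ α := nu0_le hG hp hα
  have hν1 : ν < 1 := hνα.trans_lt hα.2
  have hFν : F p G ν = ν / α := F_nu0 hG hp hα
  have hd : HasDerivAt (F p G) (f p g ν) ν :=
    (hasDerivWithinAt_F hG ⟨h0.le, hν1.le⟩).hasDerivAt (Icc_mem_nhds h0 hν1)
  -- Half of the slope gap; the other half pays for the error of the derivative approximation near
  -- ν.
  set κ := (α⁻¹ - f p g ν) / 2 with hκ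
  have hκ0 : 0 < κ := by rw [hκ]; linarith
  have hlo := (hasDerivAt_iff_isLittleO.1 hd).def hκ0
  obtain ⟨ε, hε0, hε⟩ := Metric.eventually_nhds_iff.1 hlo
  have hloc : ∀ t, |t - ν| < ε → |F p G t - F p G ν - (t - ν) * f p g ν| ≤ κ * |t - ν| := by
    intro t ht
    simpa [Real.norm_eq_abs] using hε (by rwa [Real.dist_eq])
  have hdiv : ∀ t, t / α = ν / α + (t - ν) * α⁻¹ := fun t => by rw [div_eq_mul_inv]; ring
  have hα2 : α⁻¹ = f p g ν + 2 * κ := by rw [hκ]; ring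
  have hright : ∀ t, ν ≤ t → t < ν + ε → F p G t - t / α ≤ -(κ * (t - ν)) := by
    intro t h1 h2
    have h3 := (abs_le.1 (hloc t (by rw [abs_of_nonneg] <;> linarith))).2
    rw [abs_of_nonneg (by linarith), hFν] at h3
    rw [hdiv t, hα2]
    nlinarith
  have hleft : ∀ t, ν - ε < t → t ≤ ν → κ * (ν - t) ≤ F p G t - t / α := by
    intro t h1 h2
    have h3 := (abs_le.1 (hloc t (by rw [abs_of_nonpos] <;> linarith))).1
    rw [abs_of_nonpos (by linarith), hFν] at h3
    rw [hdiv t, hα2]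
    nlinarith
  -- Away from ν on the right, F is strictly below the line because ν is the last crossing, and
  -- compactness makes the gap uniform. On the left only a local bound is available, as F may meet
  -- the line again there.
  have hcont : ContinuousOn (fun t => t / α - F p G t) (Set.Icc (ν + ε / 2) 1) := by
    refine ContinuousOn.sub (by fun_prop) fun x hx => ?_
    have hx' : Set.Icc (ν + ε / 2) 1 ⊆ Set.Icc 0 1 :=
      Set.Icc_subset_Icc_left (by linarith)
    exact ((hasDerivWithinAt_F hG (hx' hx)).continuousWithinAt).mono hx'
  obtain ⟨μ, hμ0, hμ⟩ : ∃ μ : ℝ, 0 < μ ∧ ∀ t ∈ Set.Icc (ν + ε / 2) 1, μ ≤ t / α - F p G t := by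
    rcases (Set.Icc (ν + ε / 2) (1 : ℝ)).eq_empty_or_nonempty with he | hne
    · exact ⟨1, one_pos, by simp [he]⟩
    · obtain ⟨t₀, ht₀, hmin⟩ := isCompact_Icc.exists_isMinOn hne hcont
      refine ⟨_, ?_, fun t ht => hmin ht⟩
      have : F p G t₀ < t₀ / α := lt_of_crossing_lt (by
        change ν < t₀
        linarith [ht₀.1]) ht₀.2
      linarith
  refine ⟨min κ μ, lt_min hκ0 hμ0, min (ε / 2) (ν / 2), lt_min (by linarith) (by linarith),
    (min_le_right _ _).trans_lt (by linarith), ?_, ?_⟩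
  · intro t h1 h2
    rcases lt_or_ge t (ν + ε / 2) with h3 | h3
    · have := hright t h1 (by linarith)
      nlinarith [min_le_left κ μ]
    · have := hμ t ⟨h3, h2⟩
      -- Since t - ν ≤ 1, the constant gap μ dominates a linear one.
      have h4 : min κ μ * (t - ν) ≤ μ * 1 :=
        mul_le_mul (min_le_right _ _) (by linarith) (by linarith) hμ0.le
      linarith
  · intro t h1 h2
    have := hleft t (by linarith [min_le_left (ε / 2) (ν / 2)]) h2
    nlinarith [min_le_left κ μ]

end Mixture

/-! ### Centred empirical processes -/

section Empirical

variable {d : ℕ} {Ω : Type*} {H X : (Fin d → ℤ) → Ω → ℝ}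

theorem numFalse_mem_Icc (hb : ∀ s ω, H s ω = 0 ∨ H s ω = 1) (m : Fin d → ℕ) (ω : Ω) :
    numFalse H m ω ∈ Set.Icc (0 : ℝ) (size m) := by
  have h : ∀ s, H s ω ∈ Set.Icc (0 : ℝ) 1 := fun s => by
    rcases hb s ω with h | h <;> simp [h]
  refine ⟨Finset.sum_nonneg fun s _ => (h s).1, ?_⟩
  rw [← card_cube, ← nsmul_one]
  exact Finset.sum_le_card_nsmul _ _ _ fun s _ => (h s).2

theorem condProc_zero_eq (hb : ∀ s ω, H s ω = 0 ∨ H s ω = 1) (G : ℝ → ℝ) (m : Fin d → ℕ) (t : ℝ)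
    (ω : Ω) : condProc G H X 0 (cube m) t ω =
      ∑ s ∈ cube m, ((1 - H s ω) * if X s ω ≤ t then 1 else 0) -
        t * (size m - numFalse H m ω) := by
  have h1 : t * (size m - numFalse H m ω) = ∑ s ∈ cube m, t * (1 - H s ω) := by
    rw [← Finset.mul_sum, Finset.sum_sub_distrib, numFalse]
    simp [card_cube]
  rw [h1, condProc, ← Finset.sum_sub_distrib]
  refine Finset.sum_congr rfl fun s _ => ?_
  rcases hb s ω with h | h <;> simp [h, condCDF]

theorem condProc_one_eq (hb : ∀ s ω, H s ω = 0 ∨ H s ω = 1) (G : ℝ → ℝ) (m : Fin d → ℕ) (t : ℝ)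
    (ω : Ω) : condProc G H X 1 (cube m) t ω =
      ∑ s ∈ cube m, (H s ω * if X s ω ≤ t then 1 else 0) - G t * numFalse H m ω := by
  rw [numFalse, Finset.mul_sum, condProc, ← Finset.sum_sub_distrib]
  refine Finset.sum_congr rfl fun s _ => ?_
  rcases hb s ω with h | h <;> simp [h, condCDF]

variable [MeasurableSpace Ω] {P : Measure Ω} {G g : ℝ → ℝ}

/-- Linear combinations of the two conditionally centred counting processes and of the centred
number of false hypotheses, normalized by the number of sites. -/
noncomputable def linProc (P : Measure Ω) (G : ℝ → ℝ) (H X : (Fin d → ℤ) → Ω → ℝ) (a b : ℝ)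
    (ℓ : ℝ → ℝ) (m : Fin d → ℕ) (t : ℝ) (ω : Ω) : ℝ :=
  (rootSize m)⁻¹ ^ 4 * (a * condProc G H X 0 (cube m) t ω + b * condProc G H X 1 (cube m) t ω +
    ℓ t * (numFalse H m ω - size m * pi1 P H))

theorem Lam_n_sub_eq (hb : ∀ s ω, H s ω = 0 ∨ H s ω = 1) {m : Fin d → ℕ} (hm : size m ≠ 0)
    (t : ℝ) (ω : Ω) :
    Lam_n H X m t ω - Lam (pi0 P H) t = linProc P G H X 1 0 (fun t => -t) m t ω := by
  have hm' : (size m : ℝ) ≠ 0 := by exact_mod_cast hm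
  rw [linProc, inv_pow, rootSize_pow_four, condProc_zero_eq hb, Lam_n, Lam, pi1]
  field_simp
  ring

theorem F_n_sub_eq (hb : ∀ s ω, H s ω = 0 ∨ H s ω = 1) {m : Fin d → ℕ} (hm : size m ≠ 0)
    (t : ℝ) (ω : Ω) :
    F_n X m t ω - F (pi0 P H) G t = linProc P G H X 1 1 (fun t => G t - t) m t ω := by
  have hm' : (size m : ℝ) ≠ 0 := by exact_mod_cast hm
  have h1 : (∑ s ∈ cube m, if X s ω ≤ t then (1 : ℝ) else 0) =
      ∑ s ∈ cube m, ((1 - H s ω) * if X s ω ≤ t then 1 else 0) +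
        ∑ s ∈ cube m, (H s ω * if X s ω ≤ t then 1 else 0) := by
    rw [← Finset.sum_add_distrib]
    exact Finset.sum_congr rfl fun s _ => by ring
  rw [linProc, inv_pow, rootSize_pow_four, condProc_zero_eq hb, condProc_one_eq hb, F_n, F, pi1, h1]
  field_simp
  ring

theorem tildeDelta_n_sub_eq (hb : ∀ s ω, H s ω = 0 ∨ H s ω = 1) {m : Fin d → ℕ} (hm : size m ≠ 0)
    (t : ℝ) (ω : Ω) :
    tildeDelta_n H X m t ω - (1 - pi0 P H) * (1 - G t) =
      linProc P G H X 0 (-1) (fun t => 1 - G t) m t ω := by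
  have hm' : (size m : ℝ) ≠ 0 := by exact_mod_cast hm
  have h1 : (∑ s ∈ cube m, H s ω * if t < X s ω then (1 : ℝ) else 0) =
      numFalse H m ω - ∑ s ∈ cube m, (H s ω * if X s ω ≤ t then 1 else 0) := by
    rw [numFalse, ← Finset.sum_sub_distrib]
    refine Finset.sum_congr rfl fun s _ => ?_
    by_cases h : X s ω ≤ t
    · simp [h, not_lt.2 h]
    · simp [h, not_le.1 h]
  rw [linProc, inv_pow, rootSize_pow_four, condProc_one_eq hb, tildeDelta_n, pi1, h1]
  field_simp
  ring

variable [IsProbabilityMeasure P]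

theorem measurable_numFalse (hH : IsStationaryBinaryField P H) (m : Fin d → ℕ) :
    Measurable (numFalse H m) :=
  Finset.measurable_sum _ fun s _ => hH.measurable s

theorem integrable_numFalse_sub_sq (hH : IsStationaryBinaryField P H) (m : Fin d → ℕ) (c : ℝ) :
    Integrable (fun ω => (numFalse H m ω - c) ^ 2) P := by
  have hm := measurable_numFalse hH m
  refine Integrable.of_bound (by fun_prop) ((size m + |c|) ^ 2) ?_
  filter_upwards with ω
  rw [Real.norm_eq_abs, abs_pow]
  gcongr
  refine (abs_sub _ _).trans (add_le_add_left ?_ _)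
  have := numFalse_mem_Icc hH.binary m ω
  rw [abs_of_nonneg this.1]
  exact this.2

theorem exists_integral_sq_le (hH : IsStationaryBinaryField P H) : ∃ c : ℝ, 0 < c ∧
    ∀ᶠ m : Fin d → ℕ in atTop, ∫ ω, (numFalse H m ω - size m * pi1 P H) ^ 2 ∂P ≤
      c * size m := by
  obtain ⟨c, hc, h⟩ := hH.l2_bound.exists_pos
  refine ⟨c ^ 2, by positivity, ?_⟩
  filter_upwards [h.bound] with m hm
  rw [Real.norm_of_nonneg (Real.sqrt_nonneg _), Real.norm_of_nonneg (Real.sqrt_nonneg _)] at hm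
  have h0 : 0 ≤ ∫ ω, (numFalse H m ω - size m * pi1 P H) ^ 2 ∂P :=
    integral_nonneg fun ω => sq_nonneg _
  have := pow_le_pow_left₀ (Real.sqrt_nonneg _) hm 2
  rwa [Real.sq_sqrt h0, mul_pow, Real.sq_sqrt (Nat.cast_nonneg _)] at this

/-- Chebyshev's inequality with the assumed second moment bound. -/
theorem isBigOP_numFalse (hd : 0 < d) (hH : IsStationaryBinaryField P H) :
    IsBigOP P atTop (fun m ω => numFalse H m ω - size m * pi1 P H)
      (fun m => rootSize m ^ 2) := by
  obtain ⟨c, hc, h⟩ := exists_integral_sq_le hH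
  intro ε hε
  refine ⟨√(c / ε), Real.sqrt_pos.2 (by positivity), ?_⟩
  filter_upwards [h, (tendsto_rootSize hd).eventually_gt_atTop 0] with m hm hx
  have h1 := mul_meas_ge_le_integral_of_nonneg (μ := P)
    (f := fun ω => (numFalse H m ω - size m * pi1 P H) ^ 2)
    (ae_of_all _ fun ω => sq_nonneg _) (integrable_numFalse_sub_sq hH m _)
    (c / ε * rootSize m ^ 4)
  rw [← rootSize_pow_four m] at hm h1
  have h2 : P.real {ω | c / ε * rootSize m ^ 4 ≤
      (numFalse H m ω - rootSize m ^ 4 * pi1 P H) ^ 2} ≤ ε := by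
    have h3 := h1.trans hm
    have h4 : 0 < c * rootSize m ^ 4 := by positivity
    rw [show c / ε * rootSize m ^ 4 = c * rootSize m ^ 4 / ε by ring, div_mul_eq_mul_div,
      div_le_iff₀ hε] at h3
    rw [show c / ε * rootSize m ^ 4 = c * rootSize m ^ 4 / ε by ring]
    exact le_of_mul_le_mul_left h3 h4
  rw [← rootSize_pow_four m]
  calc _ ≤ P {ω | c / ε * rootSize m ^ 4 ≤ (numFalse H m ω - rootSize m ^ 4 * pi1 P H) ^ 2} := by
        refine measure_mono fun ω hω => ?_
        simp only [Set.mem_ofPred_eq] at hω ⊢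
        have := pow_le_pow_left₀ (by positivity) hω.le 2
        rw [sq_abs, mul_pow, Real.sq_sqrt (by positivity)] at this
        rwa [show rootSize m ^ 4 = (rootSize m ^ 2) ^ 2 by ring] at this ⊢
    _ ≤ _ := by
        rw [← ofReal_measureReal (measure_ne_top _ _)]
        exact ENNReal.ofReal_le_ofReal h2

theorem exists_condCDF_lipschitz (hG : IsAlternativeCDF G g) : ∃ L : ℝ, 1 ≤ L ∧
    ∀ j s t, 0 ≤ s → s ≤ t → t ≤ 1 → condCDF G j t - condCDF G j s ≤ L * (t - s) := by
  obtain ⟨L, hL, h⟩ := hG.exists_lipschitz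
  refine ⟨L, hL, fun j s t h1 h2 h3 => ?_⟩
  by_cases hj : j = 0
  · simp only [condCDF, hj, if_true]
    nlinarith
  · simpa only [condCDF, hj, if_false] using h s t h1 h2 h3

theorem IsAlternativeCDF.exists_abs_sub_le (hG : IsAlternativeCDF G g) : ∃ L : ℝ, 1 ≤ L ∧
    ∀ s ∈ Set.Icc (0 : ℝ) 1, ∀ t ∈ Set.Icc (0 : ℝ) 1, |G t - G s| ≤ L * |t - s| := by
  obtain ⟨L, hL, h⟩ := hG.exists_lipschitz
  refine ⟨L, hL, fun s hs t ht => ?_⟩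
  rcases le_total s t with hst | hst
  · rw [abs_of_nonneg (sub_nonneg.2 (hG.mono hs ht hst)), abs_of_nonneg (sub_nonneg.2 hst)]
    exact h s t hs.1 hst ht.2
  · rw [abs_sub_comm, abs_sub_comm t, abs_of_nonneg (sub_nonneg.2 (hG.mono ht hs hst)),
      abs_of_nonneg (sub_nonneg.2 hst)]
    exact h t s ht.1 hst hs.2

variable (hd : 0 < d) (hH : IsStationaryBinaryField P H) (hG : IsAlternativeCDF G g)
  (hX : IsCondIndepModel P H X G)

include hd hH hG hX

theorem isUnifBigOP_linProc (a b : ℝ) {ℓ : ℝ → ℝ} {C : ℝ}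
    (hℓ : ∀ t ∈ Set.Icc (0 : ℝ) 1, |ℓ t| ≤ C) :
    IsUnifBigOP P atTop (fun _ => Set.Icc 0 1) (linProc P G H X a b ℓ)
      (fun m => (rootSize m)⁻¹ ^ 2) := by
  obtain ⟨L, hL, hLip⟩ := exists_condCDF_lipschitz hG
  have h (j : ℝ) := isUnifBigOP_condProc hd hX hG.map_zero hG.map_one hH.binary hH.measurable
    hL (hLip j)
  have hM := (isBigOP_numFalse hd hH).isUnifBigOP (S := fun _ => Set.Icc (0 : ℝ) 1)
  have hr : ∀ᶠ m : Fin d → ℕ in atTop, 0 ≤ (rootSize m)⁻¹ ^ 2 :=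
    Eventually.of_forall fun m => sq_nonneg _
  have key : ∀ c D : ℝ, |c| ≤ D → ∀ m : Fin d → ℕ, 0 < rootSize m →
      |(rootSize m)⁻¹ ^ 4 * c| * rootSize m ^ 2 ≤ D * (rootSize m)⁻¹ ^ 2 := by
    intro c D hc m hm
    rw [abs_mul, abs_of_pos (by positivity), show (rootSize m)⁻¹ ^ 4 * |c| * rootSize m ^ 2 =
      |c| * (rootSize m)⁻¹ ^ 2 by field_simp]
    gcongr
  have hpos := (tendsto_rootSize hd).eventually_gt_atTop 0
  have h0 := (h 0).mul_of_abs_mul_le (fun m _ => (rootSize m)⁻¹ ^ 4 * a) (C := |a|)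
    (r' := fun m => (rootSize m)⁻¹ ^ 2) (hpos.mono fun m hm t _ => key a _ le_rfl m hm) hr
  have h1 := (h 1).mul_of_abs_mul_le (fun m _ => (rootSize m)⁻¹ ^ 4 * b) (C := |b|)
    (r' := fun m => (rootSize m)⁻¹ ^ 2) (hpos.mono fun m hm t _ => key b _ le_rfl m hm) hr
  have h2 := hM.mul_of_abs_mul_le (fun m t => (rootSize m)⁻¹ ^ 4 * ℓ t) (C := C)
    (r' := fun m => (rootSize m)⁻¹ ^ 2) (hpos.mono fun m hm t ht => key _ _ (hℓ t ht) m hm) hr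
  refine ((h0.add h1).add h2).congr (Eventually.of_forall fun m t ω => ?_)
  rw [linProc]
  ring

/-- The counting parts oscillate by n^{-3/4}. The part carried by N_C - nπ₁ is smaller: an n^{-1/2}
fluctuation times the n^{-1/2} increment of ℓ. -/
theorem isUnifBigOP_linProc_sub (a b : ℝ) {ℓ : ℝ → ℝ} {C ν R : ℝ} (hν0 : 0 < ν) (hν1 : ν < 1)
    (hR : 0 < R) (hℓ : ∀ t ∈ Set.Icc (0 : ℝ) 1, |ℓ t - ℓ ν| ≤ C * |t - ν|) :
    IsUnifBigOP P atTop
      (fun m => {t | t ∈ Set.Icc (0 : ℝ) 1 ∧ |t - ν| ≤ R * (rootSize m)⁻¹ ^ 2})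
      (fun m t ω => linProc P G H X a b ℓ m t ω - linProc P G H X a b ℓ m ν ω)
      (fun m => (rootSize m)⁻¹ ^ 3) := by
  obtain ⟨L, hL, hLip⟩ := exists_condCDF_lipschitz hG
  have h (j : ℝ) := isUnifBigOP_condProc_sub hd hX hG.map_zero hG.map_one hH.binary hH.measurable
    hL hν0 hν1 hR (hLip j)
  have hM := (isBigOP_numFalse hd hH).isUnifBigOP
    (S := fun m => {t | t ∈ Set.Icc (0 : ℝ) 1 ∧ |t - ν| ≤ R * (rootSize m)⁻¹ ^ 2})
  have hr : ∀ᶠ m : Fin d → ℕ in atTop, 0 ≤ (rootSize m)⁻¹ ^ 3 :=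
    Eventually.of_forall fun m => pow_nonneg (inv_nonneg.2 (Real.sqrt_nonneg _)) _
  have key : ∀ c : ℝ, ∀ m : Fin d → ℕ, 0 < rootSize m →
      |(rootSize m)⁻¹ ^ 4 * c| * rootSize m ≤ |c| * (rootSize m)⁻¹ ^ 3 := by
    intro c m hm
    rw [abs_mul, abs_of_pos (by positivity)]
    refine le_of_eq ?_
    field_simp
  have hpos := (tendsto_rootSize hd).eventually_ge_atTop 1
  have h0 := (h 0).mul_of_abs_mul_le (fun m _ => (rootSize m)⁻¹ ^ 4 * a) (C := |a|)
    (r' := fun m => (rootSize m)⁻¹ ^ 3)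
    (hpos.mono fun m hm t _ => key a m (by linarith)) hr
  have h1 := (h 1).mul_of_abs_mul_le (fun m _ => (rootSize m)⁻¹ ^ 4 * b) (C := |b|)
    (r' := fun m => (rootSize m)⁻¹ ^ 3)
    (hpos.mono fun m hm t _ => key b m (by linarith)) hr
  have h2 := hM.mul_of_abs_mul_le (fun m t => (rootSize m)⁻¹ ^ 4 * (ℓ t - ℓ ν)) (C := |C| * R)
    (r' := fun m => (rootSize m)⁻¹ ^ 3) (hpos.mono fun m hm t ht => ?_) hr
  · refine ((h0.add h1).add h2).congr (Eventually.of_forall fun m t ω => ?_)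
    simp only [linProc]
    ring
  · have hx : 0 < rootSize m := by linarith
    have h3 : |ℓ t - ℓ ν| ≤ |C| * (R * (rootSize m)⁻¹ ^ 2) :=
      (hℓ t ht.1).trans (mul_le_mul (le_abs_self C) ht.2 (abs_nonneg _) (abs_nonneg _))
    have h4 : (rootSize m)⁻¹ ^ 4 ≤ (rootSize m)⁻¹ ^ 3 :=
      pow_le_pow_of_le_one (by positivity) (inv_le_one_of_one_le₀ hm) (by norm_num)
    rw [abs_mul, abs_of_pos (by positivity)]
    calc _ ≤ (rootSize m)⁻¹ ^ 4 * (|C| * (R * (rootSize m)⁻¹ ^ 2)) * rootSize m ^ 2 := by gcongr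
      _ = |C| * R * (rootSize m)⁻¹ ^ 4 := by field_simp
      _ ≤ _ := by gcongr

end Empirical

/-! ### Localization of the threshold and the expansions -/

section Pointwise

variable {d : ℕ} {Ω : Type*} {H X : (Fin d → ℤ) → Ω → ℝ} {α : ℝ}

theorem prod_eq_zero_of_F_n_pos {m : Fin d → ℕ} {t : ℝ} {ω : Ω} (h : 0 < F_n X m t ω) :
    (∏ s ∈ cube m, if t < X s ω then (1 : ℝ) else 0) = 0 := by
  by_contra hn
  rw [← ne_eq, Finset.prod_ne_zero_iff] at hn
  have : F_n X m t ω = 0 := by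
    rw [F_n, Finset.sum_eq_zero, mul_zero]
    intro s hs
    have h1 := hn s hs
    simp only [ne_eq, ite_eq_right_iff, one_ne_zero, imp_false, not_not] at h1
    simp [not_le.2 h1]
  linarith

theorem F_n_eq_one {m : Fin d → ℕ} (hm : size m ≠ 0) {t : ℝ} {ω : Ω}
    (h : ∀ s ∈ cube m, X s ω ≤ t) : F_n X m t ω = 1 := by
  have hm' : (size m : ℝ) ≠ 0 := by exact_mod_cast hm
  rw [F_n, Finset.sum_congr rfl fun s hs => if_pos (h s hs)]
  simp [card_cube, hm']

/-- A positive threshold means F_n(ν_BH) = ν_BH/α > 0, so the product guarding against 0/0 vanishes.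
-/
theorem Gam_n_nuBH (hα : α ∈ Set.Ioo (0 : ℝ) 1) {m : Fin d → ℕ} (hm : size m ≠ 0) {ω : Ω}
    (hν : 0 < nuBH X α m ω) :
    Gam_n H X m (nuBH X α m ω) ω = α / nuBH X α m ω * Lam_n H X m (nuBH X α m ω) ω := by
  have hm' : (size m : ℝ) ≠ 0 := by exact_mod_cast hm
  have hα0 := hα.1
  have hF := F_n_nuBH (X := X) hα m ω
  rw [Gam_n, prod_eq_zero_of_F_n_pos (by rw [hF]; positivity), hF]
  field_simp
  ring

/-- Here F_n(ν_BH) = ν_BH/α < 1, so some p-value exceeds the threshold and the correcting indicator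
is 0. -/
theorem Xi_n_nuBH (hα : α ∈ Set.Ioo (0 : ℝ) 1) {m : Fin d → ℕ} (hm : size m ≠ 0) {ω : Ω}
    (hν : nuBH X α m ω < α) :
    Xi_n H X m (nuBH X α m ω) ω =
      tildeDelta_n H X m (nuBH X α m ω) ω / (1 - nuBH X α m ω / α) := by
  have hF := F_n_nuBH (X := X) hα m ω
  have hlt : nuBH X α m ω / α < 1 := (div_lt_one hα.1).2 hν
  rw [Xi_n, if_neg, hF, zero_div, add_zero]
  intro h
  have := F_n_eq_one hm h
  linarith

end Pointwise

section Expansion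

variable {d : ℕ} {Ω : Type*} [MeasurableSpace Ω] {P : Measure Ω} [IsProbabilityMeasure P]
  {H X : (Fin d → ℤ) → Ω → ℝ} {G g : ℝ → ℝ} {α : ℝ}

theorem pi0_mem_Icc : pi0 P H ∈ Set.Icc (0 : ℝ) 1 := ⟨measureReal_nonneg, measureReal_le_one⟩

theorem eventually_size_ne_zero (hd : 0 < d) : ∀ᶠ m : Fin d → ℕ in atTop, size m ≠ 0 :=
  ((tendsto_size hd).eventually_gt_atTop 0).mono fun _ h => h.ne'

theorem eventually_inv_rootSize_pow_le (hd : 0 < d) {j k : ℕ} (hjk : j ≤ k) :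
    ∀ᶠ m : Fin d → ℕ in atTop, (rootSize m)⁻¹ ^ k ≤ (rootSize m)⁻¹ ^ j := by
  filter_upwards [(tendsto_rootSize hd).eventually_ge_atTop 1] with m hm
  exact pow_le_pow_of_le_one (inv_nonneg.2 (by linarith)) (inv_le_one_of_one_le₀ hm) hjk

theorem inv_rootSize_pow_nonneg (m : Fin d → ℕ) (k : ℕ) : 0 ≤ (rootSize m)⁻¹ ^ k :=
  pow_nonneg (inv_nonneg.2 (Real.sqrt_nonneg _)) k

variable (hd : 0 < d) (hH : IsStationaryBinaryField P H) (hG : IsAlternativeCDF G g)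
  (hX : IsCondIndepModel P H X G) (hα : α ∈ Set.Ioo (0 : ℝ) 1)
  (h0 : 0 < nu0 (pi0 P H) G α) (hf : f (pi0 P H) g (nu0 (pi0 P H) G α) < α⁻¹)

include hd hH hG hX hα h0 hf

/-- On the event sup |F_n - F| ≤ K n^{-1/2}, transversality with slope κ confines the crossing of
F_n to within (K/κ) n^{-1/2} of ν₀. -/
theorem isBigOP_nuBH_sub : IsBigOP P atTop
    (fun m ω => nuBH X α m ω - nu0 (pi0 P H) G α) (fun m => (rootSize m)⁻¹ ^ 2) := by
  obtain ⟨κ, hκ, η, hη, hην, hright, hleft⟩ := exists_transversality hG pi0_mem_Icc hα h0 hf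
  set ν := nu0 (pi0 P H) G α with hν
  have hν1 : ν < 1 := (nu0_le hG pi0_mem_Icc hα).trans_lt hα.2
  have hD := (isUnifBigOP_linProc hd hH hG hX 1 1 (ℓ := fun t => G t - t) (C := 1)
    fun t ht => by
      have := hG.mem_Icc ht
      rw [abs_le]
      constructor <;> linarith [ht.1, ht.2, this.1, this.2])
  intro ε hε
  obtain ⟨K, hK, h1⟩ := hD ε hε
  refine ⟨K / κ, by positivity, ?_⟩
  have hsmall : ∀ᶠ m : Fin d → ℕ in atTop, K / κ * (rootSize m)⁻¹ ^ 2 < η := by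
    have := (tendsto_inv_rootSize_pow hd two_ne_zero).const_mul (K / κ)
    rw [mul_zero] at this
    exact this.eventually_lt_const hη
  filter_upwards [h1, hsmall, eventually_size_ne_zero hd] with m h1 hsmall hm
  refine (measure_mono fun ω hω => ?_).trans h1
  by_contra hn
  simp only [Set.mem_ofPred_eq, not_exists, not_and, not_lt] at hn hω
  simp only [← F_n_sub_eq hH.binary hm] at hn
  set r := (rootSize m)⁻¹ ^ 2 with hr
  have hr0 : 0 ≤ r := inv_rootSize_pow_nonneg m 2
  have hKr : κ * (K / κ * r) = K * r := by field_simp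
  have hI := nuBH_mem_Icc (X := X) (α := α) m ω
  have hF := F_n_nuBH (X := X) hα m ω
  refine absurd hω (not_lt.2 (abs_le.2 ⟨?_, ?_⟩))
  -- At ν - (K/κ)r the function F exceeds the line by at least Kr, so F_n is still above the line
  -- and its last crossing lies further right.
  · by_contra hlt
    have ht1 : ν - K / κ * r ∈ Set.Icc (0 : ℝ) 1 := by
      constructor
      · linarith
      · have : 0 ≤ K / κ * r := by positivity
        linarith
    have h2 := hleft (ν - K / κ * r) (by linarith) (by
      have : 0 ≤ K / κ * r := by positivity
      linarith)
    rw [sub_sub_cancel, hKr] at h2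
    have h3 := (abs_le.1 (hn _ ht1)).1
    have h4 : ν - K / κ * r ≤ nuBH X α m ω := le_crossing ht1 (by linarith)
    linarith
  · rcases le_or_gt (nuBH X α m ω) ν with hle | hgt
    · have : 0 ≤ K / κ * r := by positivity
      linarith
    -- At ν_BH itself F_n is on the line while F is below it by at least κ(ν_BH - ν); the difference
    -- is at most Kr.
    · have h2 := hright _ hgt.le hI.2
      have h3 := (abs_le.1 (hn _ hI)).2
      rw [hF] at h3
      have h4 : κ * (nuBH X α m ω - ν) ≤ κ * (K / κ * r) := by rw [hKr]; linarith
      exact le_of_mul_le_mul_left h4 hκ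

theorem isBigOP_comp_nuBH_sub {Y : (Fin d → ℕ) → ℝ → Ω → ℝ} {a b C : ℝ} {ℓ : ℝ → ℝ}
    (hY : ∀ m, size m ≠ 0 → ∀ t ω, Y m t ω = linProc P G H X a b ℓ m t ω)
    (hℓ : ∀ s ∈ Set.Icc (0 : ℝ) 1, ∀ t ∈ Set.Icc (0 : ℝ) 1, |ℓ t - ℓ s| ≤ C * |t - s|) :
    IsBigOP P atTop (fun m ω => Y m (nuBH X α m ω) ω - Y m (nu0 (pi0 P H) G α) ω)
      (fun m => (rootSize m)⁻¹ ^ 3) := by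
  set ν := nu0 (pi0 P H) G α with hν
  have hν1 : ν < 1 := (nu0_le hG pi0_mem_Icc hα).trans_lt hα.2
  refine IsBigOP.congr (IsBigOP.comp_of_isUnifBigOP (S₀ := Set.Icc 0 1)
    (Y := fun m t ω => linProc P G H X a b ℓ m t ω - linProc P G H X a b ℓ m ν ω)
    (isBigOP_nuBH_sub hd hH hG hX hα h0 hf) (fun m ω => nuBH_mem_Icc m ω) fun R hR =>
      isUnifBigOP_linProc_sub hd hH hG hX a b h0 hν1 hR fun t ht => hℓ ν ⟨h0.le, hν1.le⟩ t ht) ?_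
  filter_upwards [eventually_size_ne_zero hd] with m hm ω
  rw [hY m hm, hY m hm]

theorem isBigOP_Lam_n_nuBH_sub : IsBigOP P atTop
    (fun m ω => (Lam_n H X m (nuBH X α m ω) ω - Lam (pi0 P H) (nuBH X α m ω)) -
      (Lam_n H X m (nu0 (pi0 P H) G α) ω - Lam (pi0 P H) (nu0 (pi0 P H) G α)))
      (fun m => (rootSize m)⁻¹ ^ 3) :=
  isBigOP_comp_nuBH_sub hd hH hG hX hα h0 hf
    (Y := fun m t ω => Lam_n H X m t ω - Lam (pi0 P H) t) (C := 1)
    (fun _ hm t ω => Lam_n_sub_eq hH.binary hm t ω) fun s _ t _ => by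
      rw [one_mul, neg_sub_neg, abs_sub_comm]

theorem isBigOP_F_n_nuBH_sub : IsBigOP P atTop
    (fun m ω => (F_n X m (nuBH X α m ω) ω - F (pi0 P H) G (nuBH X α m ω)) -
      (F_n X m (nu0 (pi0 P H) G α) ω - F (pi0 P H) G (nu0 (pi0 P H) G α)))
      (fun m => (rootSize m)⁻¹ ^ 3) := by
  obtain ⟨L, hL, h⟩ := hG.exists_abs_sub_le
  refine isBigOP_comp_nuBH_sub hd hH hG hX hα h0 hf
    (Y := fun m t ω => F_n X m t ω - F (pi0 P H) G t) (C := L + 1)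
    (fun _ hm t ω => F_n_sub_eq hH.binary hm t ω) fun s hs t ht => ?_
  rw [show G t - t - (G s - s) = (G t - G s) - (t - s) by ring, add_mul, one_mul]
  exact (abs_sub _ _).trans (add_le_add_left (h s hs t ht) _)

theorem isBigOP_tildeDelta_n_nuBH_sub : IsBigOP P atTop
    (fun m ω => (tildeDelta_n H X m (nuBH X α m ω) ω -
        (1 - pi0 P H) * (1 - G (nuBH X α m ω))) -
      (tildeDelta_n H X m (nu0 (pi0 P H) G α) ω -
        (1 - pi0 P H) * (1 - G (nu0 (pi0 P H) G α))))
      (fun m => (rootSize m)⁻¹ ^ 3) := by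
  obtain ⟨L, hL, h⟩ := hG.exists_abs_sub_le
  refine isBigOP_comp_nuBH_sub hd hH hG hX hα h0 hf
    (Y := fun m t ω => tildeDelta_n H X m t ω - (1 - pi0 P H) * (1 - G t)) (C := L)
    (fun _ hm t ω => tildeDelta_n_sub_eq hH.binary hm t ω) fun s hs t ht => ?_
  rw [sub_sub_sub_cancel_left, abs_sub_comm]
  exact h s hs t ht

/-- Since Λ(t) = π₀t, the centred proportion is exactly (α/ν_BH)(Λ_n - Λ)(ν_BH). Moving the argument
to ν₀ costs n^{-3/4}; moving the factor costs a product of two n^{-1/2} terms. -/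
theorem isBigOP_Gam_n_sub : IsBigOP P atTop
    (fun m ω => (Gam_n H X m (nuBH X α m ω) ω - α * pi0 P H) -
      α / nu0 (pi0 P H) G α * (Lam_n H X m (nu0 (pi0 P H) G α) ω -
        Lam (pi0 P H) (nu0 (pi0 P H) G α)))
      (fun m => (rootSize m)⁻¹ ^ 3) := by
  have hE := isBigOP_Lam_n_nuBH_sub hd hH hG hX hα h0 hf
  have hν := isBigOP_nuBH_sub hd hH hG hX hα h0 hf
  set ν := nu0 (pi0 P H) G α with hνdef
  have hν1 : ν < 1 := (nu0_le hG pi0_mem_Icc hα).trans_lt hα.2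
  have hE0 : IsBigOP P atTop (fun m ω => Lam_n H X m ν ω - Lam (pi0 P H) ν)
      (fun m => (rootSize m)⁻¹ ^ 2) := by
    refine ((isUnifBigOP_linProc hd hH hG hX 1 0 (ℓ := fun t => -t) (C := 1)
      fun t ht => ?_).isBigOP (t := ν) fun _ => ⟨h0.le, hν1.le⟩).congr ?_
    · rw [abs_neg, abs_of_nonneg ht.1]
      exact ht.2
    · filter_upwards [eventually_size_ne_zero hd] with m hm ω
      exact Lam_n_sub_eq hH.binary hm ν ω
  have hr : ∀ᶠ m : Fin d → ℕ in atTop, 0 ≤ (rootSize m)⁻¹ ^ 3 :=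
    Eventually.of_forall fun m => inv_rootSize_pow_nonneg m 3
  have hprod := (hE0.mul hν).mono (r' := fun m => (rootSize m)⁻¹ ^ 3)
    ((eventually_inv_rootSize_pow_le hd (show 3 ≤ 4 by norm_num)).mono fun m h => by
      rwa [← pow_add])
  -- Localization to ν_BH > ν/2, where 1/ν_BH ≤ 2/ν.
  refine IsBigOP.of_abs_le_of_abs_lt (δ := ν / 2) (by positivity)
    ((hE.abs.const_mul (2 * α / ν) hr).add (hprod.abs.const_mul (2 * α / ν ^ 2) hr)) hν
    (tendsto_inv_rootSize_pow hd two_ne_zero) ?_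
  filter_upwards [eventually_size_ne_zero hd] with m hm
  refine ae_of_all _ fun ω hω => ?_
  rw [abs_lt] at hω
  set τ := nuBH X α m ω with hτ
  have hτ0 : ν / 2 < τ := by linarith
  have hτ1 : 0 < τ := by linarith
  have hα0 := hα.1
  set E := Lam_n H X m τ ω - Lam (pi0 P H) τ with hEdef
  set E₀ := Lam_n H X m ν ω - Lam (pi0 P H) ν with hE₀def
  have hid : Gam_n H X m τ ω - α * pi0 P H - α / ν * E₀ =
      α / τ * (E - E₀) - α / (τ * ν) * (E₀ * (τ - ν)) := by
    have hΓ := Gam_n_nuBH (H := H) hα hm hτ1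
    rw [← hτ] at hΓ
    rw [hΓ, hEdef, Lam]
    field_simp
    ring
  have hinv : 1 / τ ≤ 2 / ν := by
    rw [div_le_div_iff₀ hτ1 h0]
    linarith
  rw [hid]
  refine (abs_sub _ _).trans (le_trans ?_ (le_abs_self _))
  rw [abs_mul, abs_mul, abs_of_pos (show 0 < α / τ by positivity),
    abs_of_pos (show 0 < α / (τ * ν) by positivity)]
  refine add_le_add (mul_le_mul_of_nonneg_right ?_ (abs_nonneg _))
    (mul_le_mul_of_nonneg_right ?_ (abs_nonneg _))
  · calc α / τ = α * (1 / τ) := by ring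
      _ ≤ α * (2 / ν) := by gcongr
      _ = _ := by ring
  · calc α / (τ * ν) = α / ν * (1 / τ) := by field_simp
      _ ≤ α / ν * (2 / ν) := by gcongr
      _ = _ := by field_simp

end Expansion

/-! ### The expansion of the false nondiscovery proportion -/

/-- First-order expansion of a quotient with its exact quadratic remainder, for numerator
perturbation W and denominator perturbation -δ. -/
theorem div_sub_div_eq_linearization {W Δ q δ : ℝ} (hq : q ≠ 0) (hqδ : q - δ ≠ 0) :
    (Δ + W) / (q - δ) - Δ / q = W / q + Δ * δ / q ^ 2 +
      (W * δ / (q * (q - δ)) + Δ * δ ^ 2 / (q ^ 2 * (q - δ))) := by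
  field_simp
  ring

/-- Origin of c: the right side is, up to the factor (1 - ν/α)^{-2}, the coefficient of ν_BH - ν₀ in
the linearized nondiscovery proportion, and (1/α - f(ν₀))(ν_BH - ν₀) is F_n(ν₀) - F(ν₀) to first
order. -/
theorem cConst_mul {p α ν : ℝ} {G g : ℝ → ℝ} (hα : 0 < α) (hf : f p g ν < α⁻¹)
    (hF : F p G ν = ν / α) :
    cConst p g α ν * (1 / α - f p g ν) =
      (1 - p) * (1 - G ν) / α - (1 - p) * g ν * (1 - ν / α) := by
  have h1 : 1 - α * f p g ν ≠ 0 := by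
    have := mul_lt_mul_of_pos_left hf hα
    rw [mul_inv_cancel₀ hα.ne'] at this
    linarith
  have h2 : (1 - p) * G ν = ν / α - p * ν := by rw [← hF, F]; ring
  have h3 : (1 - p) * g ν = f p g ν - p := by rw [f]; ring
  have h4 : (1 - p) * (1 - G ν) = 1 - p - (ν / α - p * ν) := by rw [← h2]; ring
  rw [h4, h3, cConst]
  field_simp
  ring

/-- The linear part differs from the claimed expansion by three small terms: the increments from ν
to τ of the centred Δ̃_n and F_n, the latter rewritten by F_n(τ) = τ/α, and the Taylor remainder of
G. -/
theorem nondiscovery_linear_part_eq {p α ν τ c q W V₀ D₀ Gτ Gν gν : ℝ} (hq : q ≠ 0)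
    (hc : c * (1 / α - (p + (1 - p) * gν)) =
      (1 - p) * (1 - Gν) / α - (1 - p) * gν * q) :
    W / q + (1 - p) * (1 - Gν) * ((τ - ν) / α) / q ^ 2 - (c * D₀ / q ^ 2 + V₀ / q) =
      (W + (1 - p) * (Gτ - Gν) - V₀) / q +
        c / q ^ 2 * ((τ - ν) / α - p * (τ - ν) - (1 - p) * (Gτ - Gν) - D₀) +
        (1 - p) * (c / q ^ 2 - 1 / q) * (Gτ - Gν - gν * (τ - ν)) := by
  have hu : q * q⁻¹ = 1 := mul_inv_cancel₀ hq
  simp only [div_eq_mul_inv, one_mul] at *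
  linear_combination (-(τ - ν) * q⁻¹ ^ 2) * hc + ((τ - ν) * (1 - p) * gν * q⁻¹) * hu

section Expansion

variable {d : ℕ} {Ω : Type*} [MeasurableSpace Ω] {P : Measure Ω} [IsProbabilityMeasure P]
  {H X : (Fin d → ℤ) → Ω → ℝ} {G g : ℝ → ℝ} {α : ℝ}

variable (hd : 0 < d) (hH : IsStationaryBinaryField P H) (hG : IsAlternativeCDF G g)
  (hX : IsCondIndepModel P H X G) (hα : α ∈ Set.Ioo (0 : ℝ) 1)
  (h0 : 0 < nu0 (pi0 P H) G α) (hf : f (pi0 P H) g (nu0 (pi0 P H) G α) < α⁻¹)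

include hd hH hG hX hα h0 hf

theorem isBigOP_tildeDelta_n_nuBH : IsBigOP P atTop
    (fun m ω => tildeDelta_n H X m (nuBH X α m ω) ω -
      (1 - pi0 P H) * (1 - G (nu0 (pi0 P H) G α))) (fun m => (rootSize m)⁻¹ ^ 2) := by
  have hV := isBigOP_tildeDelta_n_nuBH_sub hd hH hG hX hα h0 hf
  have hν := isBigOP_nuBH_sub hd hH hG hX hα h0 hf
  obtain ⟨L, hL, hLip⟩ := hG.exists_abs_sub_le
  set ν := nu0 (pi0 P H) G α with hνdef
  have hν1 : ν < 1 := (nu0_le hG pi0_mem_Icc hα).trans_lt hα.2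
  have hp := pi0_mem_Icc (P := P) (H := H)
  have hr : ∀ᶠ m : Fin d → ℕ in atTop, 0 ≤ (rootSize m)⁻¹ ^ 2 :=
    Eventually.of_forall fun m => inv_rootSize_pow_nonneg m 2
  have hV0 : IsBigOP P atTop
      (fun m ω => tildeDelta_n H X m ν ω - (1 - pi0 P H) * (1 - G ν))
      (fun m => (rootSize m)⁻¹ ^ 2) := by
    refine ((isUnifBigOP_linProc hd hH hG hX 0 (-1) (ℓ := fun t => 1 - G t) (C := 1)
      fun t ht => ?_).isBigOP (t := ν) fun _ => ⟨h0.le, hν1.le⟩).congr ?_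
    · have := hG.mem_Icc ht
      rw [abs_of_nonneg (by linarith [this.2])]
      linarith [this.1]
    · filter_upwards [eventually_size_ne_zero hd] with m hm ω
      exact tildeDelta_n_sub_eq hH.binary hm ν ω
  have hGτ : IsBigOP P atTop (fun m ω => -(1 - pi0 P H) * (G (nuBH X α m ω) - G ν))
      (fun m => (rootSize m)⁻¹ ^ 2) := by
    refine (hν.const_mul L hr).of_abs_le fun m ω => ?_
    have h1 := hLip ν ⟨h0.le, hν1.le⟩ _ (nuBH_mem_Icc (X := X) (α := α) m ω)
    rw [abs_mul, abs_mul, abs_neg, abs_of_nonneg (show 0 ≤ L by linarith),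
      abs_of_nonneg (show 0 ≤ 1 - pi0 P H by linarith [hp.2])]
    have h2 : (1 - pi0 P H) * |G (nuBH X α m ω) - G ν| ≤ 1 * |G (nuBH X α m ω) - G ν| :=
      mul_le_mul_of_nonneg_right (by linarith [hp.1]) (abs_nonneg _)
    linarith
  refine (((hV.mono (eventually_inv_rootSize_pow_le hd (show 2 ≤ 3 by norm_num))).add hV0).add
    hGτ).congr (Eventually.of_forall fun m ω => ?_)
  ring

/-- The expansion of the false nondiscovery proportion, up to the second-order term of `G`. -/
theorem isBigOP_Xi_n_sub (hνα : nu0 (pi0 P H) G α < α) : IsBigOP P atTop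
    (fun m ω => (Xi_n H X m (nuBH X α m ω) ω - Xi (pi0 P H) G (nu0 (pi0 P H) G α)) -
      (cConst (pi0 P H) g α (nu0 (pi0 P H) G α) *
          (F_n X m (nu0 (pi0 P H) G α) ω - F (pi0 P H) G (nu0 (pi0 P H) G α)) /
            (1 - nu0 (pi0 P H) G α / α) ^ 2 +
        (tildeDelta_n H X m (nu0 (pi0 P H) G α) ω -
          (1 - pi0 P H) * (1 - G (nu0 (pi0 P H) G α))) / (1 - nu0 (pi0 P H) G α / α)) -
      (1 - pi0 P H) * (cConst (pi0 P H) g α (nu0 (pi0 P H) G α) /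
          (1 - nu0 (pi0 P H) G α / α) ^ 2 - 1 / (1 - nu0 (pi0 P H) G α / α)) *
        (G (nuBH X α m ω) - G (nu0 (pi0 P H) G α) -
          g (nu0 (pi0 P H) G α) * (nuBH X α m ω - nu0 (pi0 P H) G α)))
      (fun m => (rootSize m)⁻¹ ^ 3) := by
  have hV := isBigOP_tildeDelta_n_nuBH_sub hd hH hG hX hα h0 hf
  have hD := isBigOP_F_n_nuBH_sub hd hH hG hX hα h0 hf
  have hν := isBigOP_nuBH_sub hd hH hG hX hα h0 hf
  have hW := isBigOP_tildeDelta_n_nuBH hd hH hG hX hα h0 hf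
  have hF := F_nu0 hG (pi0_mem_Icc (P := P) (H := H)) hα
  set ν := nu0 (pi0 P H) G α with hνdef
  set p := pi0 P H with hpdef
  set c := cConst p g α ν with hc
  have hkey : c * (1 / α - f p g ν) = _ := cConst_mul hα.1 hf hF
  rw [f] at hkey
  have hα0 := hα.1
  have hq0 : 0 < 1 - ν / α := by
    rw [sub_pos, div_lt_one hα0]
    exact hνα
  set q := 1 - ν / α with hq
  have hr : ∀ᶠ m : Fin d → ℕ in atTop, 0 ≤ (rootSize m)⁻¹ ^ 3 :=
    Eventually.of_forall fun m => inv_rootSize_pow_nonneg m 3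
  have hmono : ∀ᶠ m : Fin d → ℕ in atTop,
      (rootSize m)⁻¹ ^ 2 * (rootSize m)⁻¹ ^ 2 ≤ (rootSize m)⁻¹ ^ 3 :=
    (eventually_inv_rootSize_pow_le hd (show 3 ≤ 4 by norm_num)).mono fun m h => by
      rwa [← pow_add]
  have hWν := (hW.mul hν).mono (r' := fun m => (rootSize m)⁻¹ ^ 3) hmono
  have hνν := (hν.mul hν).mono (r' := fun m => (rootSize m)⁻¹ ^ 3) hmono
  -- Localization to δ = (τ - ν)/α < q/2, so that the random denominator q - δ stays above q/2.
  refine IsBigOP.of_abs_le_of_abs_lt (δ := α * q / 2) (by positivity)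
    ((((hV.const_mul (1 / q) hr).add (hD.const_mul (c / q ^ 2) hr)).abs.add
      (hWν.abs.const_mul (2 / (q ^ 2 * α)) hr)).add
      (hνν.abs.const_mul (2 * |(1 - p) * (1 - G ν)| / (q ^ 3 * α ^ 2)) hr)) hν
    (tendsto_inv_rootSize_pow hd two_ne_zero) ?_
  filter_upwards [eventually_size_ne_zero hd] with m hm
  refine ae_of_all _ fun ω hω => ?_
  rw [abs_lt] at hω
  set τ := nuBH X α m ω with hτ
  set δ := (τ - ν) / α with hδ
  have hδq : δ < q / 2 := by
    rw [hδ, div_lt_iff₀ hα0]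
    linarith [hω.2]
  have hqδ : q / 2 < q - δ := by linarith
  have hqn : 1 - τ / α = q - δ := by rw [hq, hδ]; ring
  have hτα : τ < α := by
    have : 0 < 1 - τ / α := by linarith
    rwa [sub_pos, div_lt_one hα0] at this
  have hΞ := Xi_n_nuBH (H := H) hα hm hτα
  have hFτ := F_n_nuBH (X := X) hα m ω
  rw [← hτ] at hΞ hFτ
  set W := tildeDelta_n H X m τ ω - (1 - p) * (1 - G ν) with hWdef
  set V₀ := tildeDelta_n H X m ν ω - (1 - p) * (1 - G ν) with hV₀
  set D₀ := F_n X m ν ω - F p G ν with hD₀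
  have hlin := nondiscovery_linear_part_eq (p := p) (α := α) (ν := ν) (τ := τ) (c := c) (W := W)
    (V₀ := V₀) (D₀ := D₀) (Gτ := G τ) (Gν := G ν) (gν := g ν) hq0.ne' hkey
  have hΞdiff := div_sub_div_eq_linearization (W := W) (Δ := (1 - p) * (1 - G ν)) (q := q)
    (δ := δ) hq0.ne' (by linarith)
  have e1 : Xi_n H X m τ ω = ((1 - p) * (1 - G ν) + W) / (q - δ) := by
    rw [hΞ, hqn, hWdef, add_sub_cancel]
  have e2 : Xi p G ν = (1 - p) * (1 - G ν) / q := by rw [Xi, hF]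
  have e3 : tildeDelta_n H X m τ ω - (1 - p) * (1 - G τ) - V₀ =
      W + (1 - p) * (G τ - G ν) - V₀ := by rw [hWdef]; ring
  have e4 : F_n X m τ ω - F p G τ - D₀ =
      (τ - ν) / α - p * (τ - ν) - (1 - p) * (G τ - G ν) - D₀ := by
    have : ν / α = p * ν + (1 - p) * G ν := by rw [← hF, F]
    rw [hFτ, F]
    linear_combination this
  rw [e1, e2, hΞdiff, e3, e4]
  have hid : W / q + (1 - p) * (1 - G ν) * δ / q ^ 2 +
      (W * δ / (q * (q - δ)) + (1 - p) * (1 - G ν) * δ ^ 2 / (q ^ 2 * (q - δ))) -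
      (c * D₀ / q ^ 2 + V₀ / q) -
      (1 - p) * (c / q ^ 2 - 1 / q) * (G τ - G ν - g ν * (τ - ν)) =
      (1 / q * (W + (1 - p) * (G τ - G ν) - V₀) +
        c / q ^ 2 * ((τ - ν) / α - p * (τ - ν) - (1 - p) * (G τ - G ν) - D₀)) +
      W * δ / (q * (q - δ)) + (1 - p) * (1 - G ν) * δ ^ 2 / (q ^ 2 * (q - δ)) := by
    linear_combination hlin
  rw [hid]
  refine le_trans ?_ (le_abs_self _)
  have hinv : 1 / (q - δ) ≤ 2 / q := by
    rw [div_le_div_iff₀ (by linarith) hq0]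
    linarith
  have hqδ0 : 0 < q - δ := by linarith
  refine (abs_add_le _ _).trans (add_le_add ((abs_add_le _ _).trans (add_le_add le_rfl ?_)) ?_)
  · have : W * δ / (q * (q - δ)) = 1 / (q * α) * (1 / (q - δ)) * (W * (τ - ν)) := by
      rw [hδ]
      field_simp
    rw [this, abs_mul, abs_of_pos (by positivity)]
    refine mul_le_mul_of_nonneg_right ?_ (abs_nonneg _)
    calc 1 / (q * α) * (1 / (q - δ)) ≤ 1 / (q * α) * (2 / q) := by gcongr
      _ = _ := by field_simp
  · have : (1 - p) * (1 - G ν) * δ ^ 2 / (q ^ 2 * (q - δ)) =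
        1 / (q ^ 2 * α ^ 2) * (1 / (q - δ)) * ((1 - p) * (1 - G ν)) * ((τ - ν) * (τ - ν)) := by
      rw [hδ]
      field_simp
    rw [this, abs_mul, abs_mul (1 / (q ^ 2 * α ^ 2) * (1 / (q - δ))), abs_of_pos (by positivity)]
    refine mul_le_mul_of_nonneg_right ?_ (abs_nonneg _)
    calc 1 / (q ^ 2 * α ^ 2) * (1 / (q - δ)) * |(1 - p) * (1 - G ν)|
        ≤ 1 / (q ^ 2 * α ^ 2) * (2 / q) * |(1 - p) * (1 - G ν)| := by gcongr
      _ = _ := by field_simp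

/-- With a Lipschitz condition on `g` at the crossing, the second-order term is `O_P(1/n)`. -/
theorem isBigOP_second_order
    (hg : (fun t => g t - g (nu0 (pi0 P H) G α)) =O[𝓝 (nu0 (pi0 P H) G α)]
      (fun t => t - nu0 (pi0 P H) G α)) :
    IsBigOP P atTop (fun m ω => G (nuBH X α m ω) - G (nu0 (pi0 P H) G α) -
          g (nu0 (pi0 P H) G α) * (nuBH X α m ω - nu0 (pi0 P H) G α))
      (fun m => (rootSize m)⁻¹ ^ 3) := by
  have hν := isBigOP_nuBH_sub hd hH hG hX hα h0 hf
  set ν := nu0 (pi0 P H) G α with hνdef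
  have hν1 : ν < 1 := (nu0_le hG pi0_mem_Icc hα).trans_lt hα.2
  obtain ⟨K, hK, hKb⟩ := hg.exists_pos
  obtain ⟨η, hη, hb⟩ := Metric.eventually_nhds_iff.1 hKb.bound
  have hmono : ∀ᶠ m : Fin d → ℕ in atTop,
      (rootSize m)⁻¹ ^ 2 * (rootSize m)⁻¹ ^ 2 ≤ (rootSize m)⁻¹ ^ 3 :=
    (eventually_inv_rootSize_pow_le hd (show 3 ≤ 4 by norm_num)).mono fun m h => by
      rwa [← pow_add]
  have hνν := (hν.mul hν).mono (r' := fun m => (rootSize m)⁻¹ ^ 3) hmono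
  have hr : ∀ᶠ m : Fin d → ℕ in atTop, 0 ≤ (rootSize m)⁻¹ ^ 3 :=
    Eventually.of_forall fun m => inv_rootSize_pow_nonneg m 3
  -- Within this distance the segment from ν to τ stays in [0,1] and in the range of the bound on g;
  -- the mean value inequality for G(t) - g(ν)t then gives K(τ - ν)².
  refine IsBigOP.of_abs_le_of_abs_lt (δ := min η (min ν (1 - ν)))
    (lt_min hη (lt_min h0 (by linarith))) (hνν.const_mul K hr) hν
    (tendsto_inv_rootSize_pow hd two_ne_zero) (Eventually.of_forall fun m => ae_of_all _ ?_)
  intro ω hω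
  set τ := nuBH X α m ω
  obtain ⟨h1, h2, h3⟩ : |τ - ν| < η ∧ |τ - ν| < ν ∧ |τ - ν| < 1 - ν := by
    simpa only [lt_min_iff] using hω
  have hsub : ∀ t ∈ Set.uIcc ν τ, t ∈ Set.Icc (0 : ℝ) 1 ∧ |t - ν| ≤ |τ - ν| := by
    intro t ht
    have h4 := Set.abs_sub_left_of_mem_uIcc ht
    have h5 := abs_le.1 (h4.trans h2.le)
    have h6 := abs_le.1 (h4.trans h3.le)
    exact ⟨⟨by linarith [h5.1], by linarith [h6.2]⟩, h4⟩
  have hder : ∀ t ∈ Set.uIcc ν τ, HasDerivWithinAt (fun t => G t - g ν * t) (g t - g ν)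
      (Set.uIcc ν τ) t := by
    intro t ht
    have h4 := ((hG.deriv t (hsub t ht).1).mono fun s hs => (hsub s hs).1).sub
      ((hasDerivWithinAt_id t (Set.uIcc ν τ)).const_mul (g ν))
    rw [mul_one] at h4
    exact h4
  have hbd : ∀ t ∈ Set.uIcc ν τ, ‖g t - g ν‖ ≤ K * |τ - ν| := by
    intro t ht
    have h4 := (hsub t ht).2
    refine (hb (by rw [Real.dist_eq]; linarith)).trans ?_
    rw [Real.norm_eq_abs]
    gcongr
  have := Convex.norm_image_sub_le_of_norm_hasDerivWithin_le hder hbd (convex_uIcc ν τ)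
    Set.left_mem_uIcc Set.right_mem_uIcc
  rw [Real.norm_eq_abs, Real.norm_eq_abs] at this
  calc _ = |G τ - g ν * τ - (G ν - g ν * ν)| := by ring_nf
    _ ≤ _ := this
    _ = _ := by rw [abs_mul, abs_mul, abs_of_pos hK, mul_assoc]

/-- By differentiability of `G` alone, the second-order term is `o_P(n^{-1/2})`. -/
theorem isLittleOP_second_order :
    IsLittleOP P atTop (fun m ω => G (nuBH X α m ω) - G (nu0 (pi0 P H) G α) -
          g (nu0 (pi0 P H) G α) * (nuBH X α m ω - nu0 (pi0 P H) G α))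
      (fun m => (rootSize m)⁻¹ ^ 2) := by
  have hν := isBigOP_nuBH_sub hd hH hG hX hα h0 hf
  set ν := nu0 (pi0 P H) G α with hνdef
  have hν1 : ν < 1 := (nu0_le hG pi0_mem_Icc hα).trans_lt hα.2
  have hder : HasDerivAt G (g ν) ν :=
    (hG.deriv ν ⟨h0.le, hν1.le⟩).hasDerivAt (Icc_mem_nhds h0 hν1)
  intro η hη ε hε
  obtain ⟨K, hK, h1⟩ := hν ε hε
  obtain ⟨ζ, hζ, hb⟩ := Metric.eventually_nhds_iff.1
    ((hasDerivAt_iff_isLittleO.1 hder).def (show 0 < η / K by positivity))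
  have hsmall : ∀ᶠ m : Fin d → ℕ in atTop, K * (rootSize m)⁻¹ ^ 2 < ζ := by
    have := (tendsto_inv_rootSize_pow hd two_ne_zero).const_mul K
    rw [mul_zero] at this
    exact this.eventually_lt_const hζ
  filter_upwards [h1, hsmall] with m h1 hsmall
  refine (measure_mono fun ω hω => ?_).trans h1
  by_contra hn
  simp only [Set.mem_ofPred_eq, not_lt] at hn hω
  have h2 := hb (y := nuBH X α m ω) (by rw [Real.dist_eq]; linarith)
  rw [Real.norm_eq_abs, Real.norm_eq_abs, smul_eq_mul, mul_comm (nuBH X α m ω - ν)] at h2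
  have h3 : η / K * |nuBH X α m ω - ν| ≤ η / K * (K * (rootSize m)⁻¹ ^ 2) := by gcongr
  rw [← mul_assoc, div_mul_cancel₀ _ hK.ne'] at h3
  linarith

end Expansion

/-! ### Characteristic functions of centred Bernoulli variables -/

theorem norm_exp_mul_I_sub_taylor_le {x : ℝ} (hx : |x| ≤ 1) :
    ‖Complex.exp (x * Complex.I) - (1 + x * Complex.I - (x : ℂ) ^ 2 / 2)‖ ≤ |x| ^ 3 := by
  have hn : ‖(x : ℂ) * Complex.I‖ = |x| := by simp
  have h := Complex.exp_bound (x := (x : ℂ) * Complex.I) (by rwa [hn]) (n := 3) (by norm_num)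
  rw [hn] at h
  have hs : ∑ k ∈ Finset.range 3, ((x : ℂ) * Complex.I) ^ k / (k.factorial : ℂ) =
      1 + x * Complex.I - (x : ℂ) ^ 2 / 2 := by
    simp only [Finset.sum_range_succ, Finset.sum_range_zero, Nat.factorial]
    rw [mul_pow, mul_pow, mul_pow, Complex.I_sq]
    push_cast
    ring
  rw [hs] at h
  refine h.trans ?_
  have : 0 ≤ |x| ^ 3 := by positivity
  norm_num [Nat.factorial]
  nlinarith

theorem abs_exp_neg_sub_le {w : ℝ} (hw : |w| ≤ 1) : |Real.exp (-w) - (1 - w)| ≤ w ^ 2 := by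
  have := Real.abs_exp_sub_one_sub_id_le (x := -w) (by rwa [abs_neg])
  rwa [neg_sq, show Real.exp (-w) - 1 - -w = Real.exp (-w) - (1 - w) by ring] at this

/-- A centred Bernoulli variable and a Gaussian of the same variance share the moments of order at
most 2, so their characteristic functions agree up to third order. -/
theorem norm_bernoulli_charFun_sub_le {z q : ℝ} (hz : |z| ≤ 1) (hq : q ∈ Set.Icc (0 : ℝ) 1) :
    ‖((1 - q : ℝ) : ℂ) * Complex.exp ((-(z * q) : ℝ) * Complex.I) +
        (q : ℂ) * Complex.exp ((z * (1 - q) : ℝ) * Complex.I) -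
      (Real.exp (-(z ^ 2 * (q * (1 - q)) / 2)) : ℂ)‖ ≤ 3 * |z| ^ 3 := by
  have hq0 := hq.1
  have hq1 : 0 ≤ 1 - q := by linarith [hq.2]
  have hz0 := abs_nonneg z
  have a1 : |-(z * q)| ≤ |z| := by
    rw [abs_neg, abs_mul, abs_of_nonneg hq0]
    nlinarith [hq.2]
  have a2 : |z * (1 - q)| ≤ |z| := by
    rw [abs_mul, abs_of_nonneg hq1]
    nlinarith
  have b1 := norm_exp_mul_I_sub_taylor_le (a1.trans hz)
  have b2 := norm_exp_mul_I_sub_taylor_le (a2.trans hz)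
  have c1 : |-(z * q)| ^ 3 ≤ |z| ^ 3 := by gcongr
  have c2 : |z * (1 - q)| ^ 3 ≤ |z| ^ 3 := by gcongr
  set w := z ^ 2 * (q * (1 - q)) / 2 with hw
  have hw0 : 0 ≤ w := by positivity
  have hwz : w ≤ |z| ^ 2 := by
    rw [hw, sq_abs]
    have : q * (1 - q) ≤ 1 := by nlinarith
    nlinarith [sq_nonneg z]
  have hw1 : |w| ≤ 1 := by
    rw [abs_of_nonneg hw0]
    exact hwz.trans (pow_le_one₀ hz0 hz)
  have b3 := abs_exp_neg_sub_le hw1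
  have c3 : w ^ 2 ≤ |z| ^ 3 := by
    calc w ^ 2 ≤ (|z| ^ 2) ^ 2 := by gcongr
      _ = |z| ^ 3 * |z| := by ring
      _ ≤ |z| ^ 3 * 1 := by gcongr
      _ = _ := mul_one _
  set E1 := Complex.exp ((-(z * q) : ℝ) * Complex.I)
  set E2 := Complex.exp ((z * (1 - q) : ℝ) * Complex.I)
  have hid : ((1 - q : ℝ) : ℂ) * E1 + (q : ℂ) * E2 - (Real.exp (-w) : ℂ) =
      ((1 - q : ℝ) : ℂ) * (E1 - (1 + ((-(z * q) : ℝ) : ℂ) * Complex.I -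
        ((-(z * q) : ℝ) : ℂ) ^ 2 / 2)) +
      (q : ℂ) * (E2 - (1 + ((z * (1 - q) : ℝ) : ℂ) * Complex.I -
        ((z * (1 - q) : ℝ) : ℂ) ^ 2 / 2)) -
      ((Real.exp (-w) - (1 - w) : ℝ) : ℂ) := by
    rw [hw]
    push_cast
    ring
  rw [hid]
  refine (norm_sub_le _ _).trans ?_
  have d1 := norm_add_le (((1 - q : ℝ) : ℂ) * (E1 - (1 + ((-(z * q) : ℝ) : ℂ) * Complex.I -
        ((-(z * q) : ℝ) : ℂ) ^ 2 / 2)))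
      ((q : ℂ) * (E2 - (1 + ((z * (1 - q) : ℝ) : ℂ) * Complex.I -
        ((z * (1 - q) : ℝ) : ℂ) ^ 2 / 2)))
  rw [norm_mul, norm_mul, Complex.norm_of_nonneg hq1, Complex.norm_of_nonneg hq0] at d1
  rw [Complex.norm_real, Real.norm_eq_abs]
  have d2 := mul_le_mul_of_nonneg_left (b1.trans c1) hq1
  have d3 := mul_le_mul_of_nonneg_left (b2.trans c2) hq0
  have : 0 ≤ |z| ^ 3 := by positivity
  nlinarith

/-- Telescoping: the factors are exchanged one at a time, the others having modulus at most 1. -/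
theorem norm_prod_sub_prod_le {ι : Type*} (S : Finset ι) {a b : ι → ℂ} (ha : ∀ i ∈ S, ‖a i‖ ≤ 1)
    (hb : ∀ i ∈ S, ‖b i‖ ≤ 1) :
    ‖∏ i ∈ S, a i - ∏ i ∈ S, b i‖ ≤ ∑ i ∈ S, ‖a i - b i‖ := by
  classical
  induction S using Finset.induction_on with
  | empty => simp
  | insert i S hi ih =>
    have ih' := ih (fun j hj => ha j (Finset.mem_insert_of_mem hj))
      (fun j hj => hb j (Finset.mem_insert_of_mem hj))
    rw [Finset.prod_insert hi, Finset.prod_insert hi, Finset.sum_insert hi]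
    have h1 : ‖∏ j ∈ S, a j‖ ≤ 1 := by
      rw [norm_prod]
      exact Finset.prod_le_one (fun _ _ => norm_nonneg _)
        fun j hj => ha j (Finset.mem_insert_of_mem hj)
    calc _ = ‖(a i - b i) * ∏ j ∈ S, a j + b i * (∏ j ∈ S, a j - ∏ j ∈ S, b j)‖ := by ring_nf
      _ ≤ ‖a i - b i‖ * ‖∏ j ∈ S, a j‖ + ‖b i‖ * ‖∏ j ∈ S, a j - ∏ j ∈ S, b j‖ := by
        refine (norm_add_le _ _).trans ?_
        rw [norm_mul, norm_mul]
      _ ≤ ‖a i - b i‖ * 1 + 1 * ‖∏ j ∈ S, a j - ∏ j ∈ S, b j‖ := by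
        gcongr
        exact hb i (Finset.mem_insert_self i S)
      _ ≤ _ := by linarith

theorem integral_exp_bernoulli {Ω : Type*} [MeasurableSpace Ω] {Q : Measure Ω}
    [IsProbabilityMeasure Q] {X : Ω → ℝ} (hX : Measurable X) {t q : ℝ}
    (hq : Q.real {ω | X ω ≤ t} = q) (z : ℝ) :
    ∫ ω, Complex.exp ((z * ((if X ω ≤ t then 1 else 0) - q) : ℝ) * Complex.I) ∂Q =
      ((1 - q : ℝ) : ℂ) * Complex.exp ((-(z * q) : ℝ) * Complex.I) +
        (q : ℂ) * Complex.exp ((z * (1 - q) : ℝ) * Complex.I) := by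
  have hA : MeasurableSet {ω | X ω ≤ t} := hX measurableSet_Iic
  set E1 := Complex.exp ((-(z * q) : ℝ) * Complex.I) with hE1
  set E2 := Complex.exp ((z * (1 - q) : ℝ) * Complex.I) with hE2
  have hpt : ∀ ω, Complex.exp ((z * ((if X ω ≤ t then 1 else 0) - q) : ℝ) * Complex.I) =
      E1 + {ω | X ω ≤ t}.indicator (fun _ => E2 - E1) ω := by
    intro ω
    by_cases h : X ω ≤ t
    · have h' : ω ∈ {ω | X ω ≤ t} := h
      rw [if_pos h, Set.indicator_of_mem h', add_sub_cancel, hE2]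
    · have h' : ω ∉ {ω | X ω ≤ t} := h
      rw [if_neg h, Set.indicator_of_notMem h', add_zero, zero_sub, mul_neg, hE1]
  simp_rw [hpt]
  rw [integral_add (integrable_const _) ((integrable_const _).indicator hA), integral_const,
    integral_indicator hA, setIntegral_const, hq, probReal_univ]
  simp only [Complex.real_smul]
  push_cast
  ring

theorem abs_exp_neg_sub_exp_neg_le {x y : ℝ} (hx : 0 ≤ x) (hy : 0 ≤ y) :
    |Real.exp (-x) - Real.exp (-y)| ≤ |x - y| := by
  wlog hxy : x ≤ y generalizing x y
  · rw [abs_sub_comm, abs_sub_comm x]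
    exact this hy hx (le_of_not_ge hxy)
  rw [abs_of_nonneg (sub_nonneg.2 (Real.exp_le_exp.2 (by linarith))), abs_sub_comm,
    abs_of_nonneg (by linarith)]
  have h1 := Real.add_one_le_exp (x - y)
  have h2 : Real.exp (-y) = Real.exp (-x) * Real.exp (x - y) := by rw [← Real.exp_add]; ring_nf
  have h3 : Real.exp (-x) ≤ 1 := Real.exp_le_one_iff.2 (by linarith)
  rw [h2]
  nlinarith [Real.exp_pos (-x)]

/-! ### The conditional central limit theorem -/

section Conditional

variable {d : ℕ} {Ω : Type*} [MeasurableSpace Ω] {P : Measure Ω} [IsProbabilityMeasure P]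
  {H X : (Fin d → ℤ) → Ω → ℝ} {G g : ℝ → ℝ}

theorem setIntegral_eq_measureReal_smul_cond {E : Type*} [NormedAddCommGroup E] [NormedSpace ℝ E]
    {A : Set Ω} (hA : P A ≠ 0) (Y : Ω → E) :
    ∫ ω in A, Y ω ∂P = P.real A • ∫ ω, Y ω ∂P[|A] := by
  have h : P.real A ≠ 0 := by rwa [ne_eq, measureReal_eq_zero_iff]
  rw [ProbabilityTheory.cond, integral_smul_measure, ENNReal.toReal_inv, ← measureReal_def, smul_smul,
    mul_inv_cancel₀ h, one_smul]

/-- Given the hypotheses, the characteristic function of a weighted sum of centred indicators is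
close to a Gaussian one. -/
theorem norm_cond_charFun_sub_le (hH : IsStationaryBinaryField P H)
    (hG : IsAlternativeCDF G g) (hX : IsCondIndepModel P H X G) {C T : Finset (Fin d → ℤ)}
    (h0 : P (config H C T) ≠ 0) {t a b y D : ℝ} (ht : t ∈ Set.Icc (0 : ℝ) 1) (ha : |a| ≤ D)
    (hb : |b| ≤ D) (hy : |y| * D ≤ 1) :
    ‖∫ ω, Complex.exp ((y * (a * condProc G H X 0 C t ω + b * condProc G H X 1 C t ω) : ℝ) *
        Complex.I) ∂P[|config H C T] -
      (Real.exp (-(y ^ 2 / 2 * ∑ s ∈ C, if s ∈ T then b ^ 2 * (G t * (1 - G t))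
        else a ^ 2 * (t * (1 - t)))) : ℂ)‖ ≤ C.card * (3 * (|y| * D) ^ 3) := by
  have hQ := cond_isProbabilityMeasure h0
  have hind := hX.cond_iIndepFun hG.map_zero hG.map_one hH.binary hH.measurable h0
  set Q := P[|config H C T] with hQdef
  set w : (Fin d → ℤ) → ℝ := fun s => if s ∈ T then b else a with hw
  set q : (Fin d → ℤ) → ℝ := fun s => if s ∈ T then G t else t with hqdef
  have hwD : ∀ s, |w s| ≤ D := fun s => by
    by_cases h : s ∈ T <;> simpa [hw, h]
  have hq01 : ∀ s, q s ∈ Set.Icc (0 : ℝ) 1 := fun s => by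
    by_cases h : s ∈ T
    · simpa [hqdef, h] using hG.mem_Icc ht
    · simpa [hqdef, h] using ht
  have hae : ∀ᵐ ω ∂Q, ω ∈ config H C T :=
    ae_cond_mem (measurableSet_config hH.measurable C T)
  have hpt : ∀ ω ∈ config H C T,
      Complex.exp ((y * (a * condProc G H X 0 C t ω + b * condProc G H X 1 C t ω) : ℝ) *
        Complex.I) = ∏ s : C, Complex.exp
          ((y * w s * ((if X s ω ≤ t then 1 else 0) - q s) : ℝ) * Complex.I) := by
    intro ω hω
    rw [← Complex.exp_sum, ← Finset.sum_mul, ← Complex.ofReal_sum]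
    congr 3
    rw [Finset.sum_coe_sort C fun s => y * w s * ((if X s ω ≤ t then 1 else 0) - q s)]
    simp only [condProc, Finset.mul_sum, ← Finset.sum_add_distrib]
    refine Finset.sum_congr rfl fun s hs => ?_
    have h1 := hω s hs
    by_cases h : s ∈ T
    · simp [h1, h, hw, hqdef, condCDF]
      ring
    · simp [h1, h, hw, hqdef, condCDF]
      ring
  have hint : ∫ ω, Complex.exp ((y * (a * condProc G H X 0 C t ω + b * condProc G H X 1 C t ω) : ℝ)
      * Complex.I) ∂Q = ∏ s : C, (((1 - q s : ℝ) : ℂ) *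
        Complex.exp ((-(y * w s * q s) : ℝ) * Complex.I) +
        (q s : ℂ) * Complex.exp ((y * w s * (1 - q s) : ℝ) * Complex.I)) := by
    rw [integral_congr_ae (hae.mono hpt)]
    have h1 := iIndepFun.integral_fun_prod_comp (X := fun s : C => X s) hind
      (fun s => (hX.measurable s).aemeasurable) (f := fun (s : C) (x : ℝ) => Complex.exp
        ((y * w s * ((if x ≤ t then 1 else 0) - q s) : ℝ) * Complex.I)) (fun s => by
        refine Measurable.aestronglyMeasurable ?_
        have : Measurable fun x : ℝ => if x ≤ t then (1 : ℝ) else 0 :=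
          Measurable.ite measurableSet_Iic measurable_const measurable_const
        fun_prop)
    rw [h1]
    refine Finset.prod_congr rfl fun s _ => ?_
    exact integral_exp_bernoulli (hX.measurable s) (hX.cond_le hG.map_zero hG.map_one hH.binary
      hH.measurable h0 s.2 ht) _
  have hgauss : (Real.exp (-(y ^ 2 / 2 * ∑ s ∈ C, if s ∈ T then b ^ 2 * (G t * (1 - G t))
        else a ^ 2 * (t * (1 - t)))) : ℂ) =
      ∏ s : C, (Real.exp (-((y * w s) ^ 2 * (q s * (1 - q s)) / 2)) : ℂ) := by
    rw [← Complex.ofReal_prod, ← Real.exp_sum]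
    congr 2
    rw [Finset.sum_coe_sort C fun s => -((y * w s) ^ 2 * (q s * (1 - q s)) / 2), Finset.mul_sum,
      ← Finset.sum_neg_distrib]
    refine Finset.sum_congr rfl fun s _ => ?_
    by_cases h : s ∈ T
    · simp only [h, if_true, hw, hqdef]
      ring
    · simp only [h, if_false, hw, hqdef]
      ring
  rw [hint, hgauss]
  refine (norm_prod_sub_prod_le _ (fun s _ => ?_) fun s _ => ?_).trans ?_
  · refine (norm_add_le _ _).trans ?_
    rw [norm_mul, norm_mul, Complex.norm_exp_ofReal_mul_I, Complex.norm_exp_ofReal_mul_I,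
      Complex.norm_of_nonneg (by linarith [(hq01 s).2]), Complex.norm_of_nonneg (hq01 s).1]
    linarith
  · rw [Complex.norm_of_nonneg (Real.exp_pos _).le]
    refine Real.exp_le_one_iff.2 (neg_nonpos.2 ?_)
    have h1 := (hq01 s).1
    have h2 : 0 ≤ 1 - q s := by linarith [(hq01 s).2]
    positivity
  · have hterm : ∀ s : C, |y * w s| ≤ |y| * D := fun s => by
      rw [abs_mul]
      exact mul_le_mul_of_nonneg_left (hwD s) (abs_nonneg _)
    calc _ ≤ ∑ _s : C, 3 * (|y| * D) ^ 3 := by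
          refine Finset.sum_le_sum fun s _ => ?_
          refine (norm_bernoulli_charFun_sub_le ((hterm s).trans hy) (hq01 s)).trans ?_
          have := hterm s
          gcongr
      _ = _ := by
          rw [Finset.sum_const, Finset.card_univ, Fintype.card_coe, nsmul_eq_mul]

end Conditional

/-! ### The central limit theorem for the linear processes -/

section CLT

variable {d : ℕ} {Ω : Type*} [MeasurableSpace Ω] {P : Measure Ω}
  {H X : (Fin d → ℤ) → Ω → ℝ} {G g : ℝ → ℝ}

theorem charFun_map_eq_integral {Y : Ω → ℝ} (hY : AEMeasurable Y P) (u : ℝ) :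
    charFun (P.map Y) u = ∫ ω, Complex.exp ((u * Y ω : ℝ) * Complex.I) ∂P := by
  rw [charFun_apply_real, integral_map hY (by fun_prop)]
  push_cast
  rfl

variable [IsProbabilityMeasure P]

theorem measurable_condProc (hH : ∀ s, Measurable (H s)) (hX : ∀ s, Measurable (X s)) (j : ℝ)
    (C : Finset (Fin d → ℤ)) (t : ℝ) : Measurable (condProc G H X j C t) :=
  Finset.measurable_sum _ fun s _ => Measurable.ite (hH s (measurableSet_singleton j))
    ((Measurable.ite (hX s measurableSet_Iic) measurable_const measurable_const).sub_const _)
    measurable_const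

theorem measurable_linProc (hH : IsStationaryBinaryField P H) (hX : ∀ s, Measurable (X s))
    (a b : ℝ) (ℓ : ℝ → ℝ) (m : Fin d → ℕ) (t : ℝ) : Measurable (linProc P G H X a b ℓ m t) := by
  have h0 := measurable_condProc (G := G) hH.measurable hX 0 (cube m) t
  have h1 := measurable_condProc (G := G) hH.measurable hX 1 (cube m) t
  have h2 := measurable_numFalse hH m
  unfold linProc
  fun_prop

theorem integrable_exp_mul_I {Y : Ω → ℝ} (hY : Measurable Y) :
    Integrable (fun ω => Complex.exp ((Y ω : ℂ) * Complex.I)) P := by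
  refine Integrable.of_bound (by fun_prop) 1 (ae_of_all _ fun ω => ?_)
  rw [Complex.norm_exp_ofReal_mul_I]

theorem integrable_abs_numFalse_sub (hH : IsStationaryBinaryField P H) (m : Fin d → ℕ) (c : ℝ) :
    Integrable (fun ω => |numFalse H m ω - c|) P := by
  have h2 := measurable_numFalse hH m
  refine ((integrable_numFalse_sub_sq hH m c).add (integrable_const 1)).mono'
    (by fun_prop) (ae_of_all _ fun ω => ?_)
  rw [Real.norm_eq_abs, abs_abs, Pi.add_apply]
  nlinarith [sq_abs (numFalse H m ω - c), sq_nonneg (|numFalse H m ω - c| - 1),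
    abs_nonneg (numFalse H m ω - c)]

/-- Given the configuration, N_C is constant and its phase factors out, while the counting part is
nearly Gaussian with variance n s₀ + (s₁ - s₀)N_C. Replacing this variance by its mean costs the
term in E|N_C - nπ₁|, and makes the Gaussian factor deterministic. -/
theorem norm_charFun_sub_mul_le (hH : IsStationaryBinaryField P H)
    (hG : IsAlternativeCDF G g) (hX : IsCondIndepModel P H X G) (m : Fin d → ℕ)
    {t a b y D s₀ s₁ : ℝ} (k : ℝ) (ht : t ∈ Set.Icc (0 : ℝ) 1) (ha : |a| ≤ D)
    (hb : |b| ≤ D) (hy : |y| * D ≤ 1) (hs₀ : s₀ = a ^ 2 * (t * (1 - t)))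
    (hs₁ : s₁ = b ^ 2 * (G t * (1 - G t))) :
    ‖∫ ω, Complex.exp ((y * (a * condProc G H X 0 (cube m) t ω +
          b * condProc G H X 1 (cube m) t ω + k * (numFalse H m ω - size m * pi1 P H)) : ℝ) *
        Complex.I) ∂P -
      (Real.exp (-(y ^ 2 / 2 * (size m * (s₀ * pi0 P H + s₁ * pi1 P H)))) : ℂ) *
        ∫ ω, Complex.exp ((y * (k * (numFalse H m ω - size m * pi1 P H)) : ℝ) * Complex.I) ∂P‖ ≤
      size m * (3 * (|y| * D) ^ 3) + y ^ 2 / 2 * |s₁ - s₀| *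
        ∫ ω, |numFalse H m ω - size m * pi1 P H| ∂P := by
  have hm0 := measurable_condProc (G := G) hH.measurable hX.measurable 0 (cube m) t
  have hm1 := measurable_condProc (G := G) hH.measurable hX.measurable 1 (cube m) t
  have hmN := measurable_numFalse hH m
  set n : ℝ := (size m : ℝ) with hn
  set κ : ℝ := Real.exp (-(y ^ 2 / 2 * (n * (s₀ * pi0 P H + s₁ * pi1 P H)))) with hκ
  set M : Ω → ℝ := fun ω => numFalse H m ω - n * pi1 P H with hM
  set A : Ω → ℝ := fun ω => a * condProc G H X 0 (cube m) t ω +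
    b * condProc G H X 1 (cube m) t ω with hA
  have hMm : Measurable M := by fun_prop
  have hAm : Measurable A := by fun_prop
  have hpi := pi0_mem_Icc (P := P) (H := H)
  have hpi1 : pi1 P H = 1 - pi0 P H := rfl
  have hs₀0 : 0 ≤ s₀ := by
    rw [hs₀]
    have := ht.1
    have : 0 ≤ 1 - t := by linarith [ht.2]
    positivity
  have hs₁0 : 0 ≤ s₁ := by
    rw [hs₁]
    have h1 := hG.mem_Icc ht
    have := h1.1
    have : 0 ≤ 1 - G t := by linarith [h1.2]
    positivity
  set Y : Ω → ℂ := fun ω => (Complex.exp ((y * A ω : ℝ) * Complex.I) - κ) *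
    Complex.exp ((y * (k * M ω) : ℝ) * Complex.I) with hY
  have hi1 : Integrable (fun ω => Complex.exp ((y * (A ω + k * M ω) : ℝ) * Complex.I)) P :=
    integrable_exp_mul_I (by fun_prop)
  have hi2 : Integrable (fun ω => Complex.exp ((y * (k * M ω) : ℝ) * Complex.I)) P :=
    integrable_exp_mul_I (by fun_prop)
  have hYeq : ∀ ω, Y ω = Complex.exp ((y * (A ω + k * M ω) : ℝ) * Complex.I) -
      κ * Complex.exp ((y * (k * M ω) : ℝ) * Complex.I) := by
    intro ω
    rw [hY]
    simp only
    rw [sub_mul, ← Complex.exp_add]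
    push_cast
    ring_nf
  have hYi : Integrable Y P := by
    rw [funext hYeq]
    exact hi1.sub (hi2.const_mul _)
  have hdiff : (∫ ω, Complex.exp ((y * (A ω + k * M ω) : ℝ) * Complex.I) ∂P) -
      κ * ∫ ω, Complex.exp ((y * (k * M ω) : ℝ) * Complex.I) ∂P = ∫ ω, Y ω ∂P := by
    simp_rw [hYeq]
    rw [integral_sub hi1 (hi2.const_mul _), integral_const_mul]
  change ‖(∫ ω, Complex.exp ((y * (A ω + k * M ω) : ℝ) * Complex.I) ∂P) -
      κ * ∫ ω, Complex.exp ((y * (k * M ω) : ℝ) * Complex.I) ∂P‖ ≤ n * (3 * (|y| * D) ^ 3) +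
        y ^ 2 / 2 * |s₁ - s₀| * ∫ ω, |M ω| ∂P
  rw [hdiff]
  set c₁ := n * (3 * (|y| * D) ^ 3)
  set c₂ := y ^ 2 / 2 * |s₁ - s₀|
  have hMi : Integrable (fun ω => |M ω|) P := integrable_abs_numFalse_sub hH m _
  have hBi : Integrable (fun ω => c₁ + c₂ * |M ω|) P := (integrable_const _).add (hMi.const_mul _)
  have hBint : c₁ + c₂ * ∫ ω, |M ω| ∂P = ∫ ω, (c₁ + c₂ * |M ω|) ∂P := by
    rw [integral_add (integrable_const _) (hMi.const_mul _), integral_const_mul c₂,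
      integral_const, probReal_univ, one_smul]
  rw [hBint, integral_eq_sum_config hH.measurable hH.binary (cube m) hYi,
    integral_eq_sum_config hH.measurable hH.binary (cube m) hBi]
  refine (norm_sum_le _ _).trans (Finset.sum_le_sum fun T _ => ?_)
  by_cases h0 : P (config H (cube m) T) = 0
  · rw [setIntegral_measure_zero _ h0, setIntegral_measure_zero _ h0, norm_zero]
  have hQ := cond_isProbabilityMeasure h0
  rw [setIntegral_eq_measureReal_smul_cond h0, setIntegral_eq_measureReal_smul_cond h0, norm_smul,
    Real.norm_of_nonneg measureReal_nonneg, smul_eq_mul]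
  refine mul_le_mul_of_nonneg_left ?_ measureReal_nonneg
  set N : ℝ := ∑ s ∈ cube m, if s ∈ T then (1 : ℝ) else 0 with hN
  have hMT : ∀ᵐ ω ∂P[|config H (cube m) T], M ω = N - n * pi1 P H := by
    filter_upwards [ae_cond_mem (measurableSet_config hH.measurable (cube m) T)] with ω hω
    simp only [hM, numFalse, hN]
    rw [Finset.sum_congr rfl hω]
  have hB : ∫ ω, (c₁ + c₂ * |M ω|) ∂P[|config H (cube m) T] = c₁ + c₂ * |N - n * pi1 P H| := by
    rw [integral_congr_ae (g := fun _ => c₁ + c₂ * |N - n * pi1 P H|)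
      (hMT.mono fun ω h => by simp only [h])]
    simp
  have hYQ : ∫ ω, Y ω ∂P[|config H (cube m) T] =
      ((∫ ω, Complex.exp ((y * A ω : ℝ) * Complex.I) ∂P[|config H (cube m) T]) - κ) *
        Complex.exp ((y * (k * (N - n * pi1 P H)) : ℝ) * Complex.I) := by
    rw [integral_congr_ae (g := fun ω => (Complex.exp ((y * A ω : ℝ) * Complex.I) - κ) *
      Complex.exp ((y * (k * (N - n * pi1 P H)) : ℝ) * Complex.I))
      (hMT.mono fun ω h => by simp only [hY, h]), integral_mul_const,
      integral_sub (integrable_exp_mul_I (by fun_prop)) (integrable_const _), integral_const,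
      probReal_univ, one_smul]
  rw [hB, hYQ, norm_mul, Complex.norm_exp_ofReal_mul_I, mul_one]
  have hcond := norm_cond_charFun_sub_le hH hG hX h0 ht ha hb hy
  have hsum : (∑ s ∈ cube m, if s ∈ T then b ^ 2 * (G t * (1 - G t))
      else a ^ 2 * (t * (1 - t))) = n * s₀ + (s₁ - s₀) * N := by
    rw [← hs₀, ← hs₁, hN, Finset.mul_sum, hn, ← card_cube, ← nsmul_eq_mul, ← Finset.sum_const,
      ← Finset.sum_add_distrib]
    refine Finset.sum_congr rfl fun s _ => ?_
    by_cases h : s ∈ T <;> simp [h]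
  rw [hsum, card_cube, ← hn] at hcond
  set κT : ℝ := Real.exp (-(y ^ 2 / 2 * (n * s₀ + (s₁ - s₀) * N)))
  have hκκ : |κT - κ| ≤ c₂ * |N - n * pi1 P H| := by
    refine (abs_exp_neg_sub_exp_neg_le ?_ ?_).trans (le_of_eq ?_)
    · rw [← hsum]
      refine mul_nonneg (by positivity) (Finset.sum_nonneg fun s _ => ?_)
      rw [← hs₀, ← hs₁]
      split_ifs <;> assumption
    · have h1 := hpi.1
      have h2 : 0 ≤ pi1 P H := by rw [hpi1]; linarith [hpi.2]
      positivity
    · rw [show y ^ 2 / 2 * (n * s₀ + (s₁ - s₀) * N) -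
        y ^ 2 / 2 * (n * (s₀ * pi0 P H + s₁ * pi1 P H)) =
        y ^ 2 / 2 * (s₁ - s₀) * (N - n * pi1 P H) by rw [hpi1]; ring, abs_mul, abs_mul,
        abs_of_nonneg (show 0 ≤ y ^ 2 / 2 by positivity)]
  calc _ = ‖((∫ ω, Complex.exp ((y * A ω : ℝ) * Complex.I) ∂P[|config H (cube m) T]) - κT) +
        ((κT - κ : ℝ) : ℂ)‖ := by
        congr 1
        push_cast
        ring
    _ ≤ _ + _ := norm_add_le _ _
    _ ≤ c₁ + c₂ * |N - n * pi1 P H| := by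
        rw [Complex.norm_real, Real.norm_eq_abs]
        exact add_le_add hcond hκκ

/-- From the second moment bound and |M| ≤ M²/√n + √n. -/
theorem exists_integral_abs_le (hH : IsStationaryBinaryField P H) : ∃ c : ℝ, 0 < c ∧
    ∀ᶠ m : Fin d → ℕ in atTop, size m ≠ 0 →
      ∫ ω, |numFalse H m ω - size m * pi1 P H| ∂P ≤ c * √(size m : ℝ) := by
  obtain ⟨c, hc, h⟩ := exists_integral_sq_le hH
  refine ⟨c + 1, by positivity, ?_⟩
  filter_upwards [h] with m hm hm0
  have hn : (0 : ℝ) < size m := by exact_mod_cast Nat.pos_of_ne_zero hm0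
  set x := √(size m : ℝ) with hx
  have hx0 : 0 < x := Real.sqrt_pos.2 hn
  have hxx : x ^ 2 = size m := Real.sq_sqrt hn.le
  have hi := integrable_numFalse_sub_sq hH m (size m * pi1 P H)
  calc ∫ ω, |numFalse H m ω - size m * pi1 P H| ∂P
      ≤ ∫ ω, (x⁻¹ * (numFalse H m ω - size m * pi1 P H) ^ 2 + x) ∂P := by
        refine integral_mono (integrable_abs_numFalse_sub hH m _)
          ((hi.const_mul _).add (integrable_const _)) fun ω => ?_
        simp only
        set v := |numFalse H m ω - size m * pi1 P H| with hv
        rw [← sq_abs, ← hv]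
        have h1 : x⁻¹ * v ^ 2 + x - v = x⁻¹ * (v ^ 2 - v * x + x ^ 2) := by
          field_simp
          ring
        have h2 : 0 ≤ x⁻¹ * (v ^ 2 - v * x + x ^ 2) :=
          mul_nonneg (by positivity) (by nlinarith [sq_nonneg (v - x), abs_nonneg v, sq_nonneg (v + x)])
        linarith
    _ = x⁻¹ * ∫ ω, (numFalse H m ω - size m * pi1 P H) ^ 2 ∂P + x := by
        rw [integral_add (hi.const_mul _) (integrable_const _), integral_const_mul, integral_const,
          probReal_univ, one_smul]
    _ ≤ x⁻¹ * (c * size m) + x := by gcongr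
    _ = _ := by
        rw [← hxx]
        field_simp

/-- Lévy's continuity theorem holds along sequences; countable generation of the filter transfers it
to nets indexed by the side lengths. -/
theorem tendstoNormal_iff {ι : Type*} {l : Filter ι} [l.IsCountablyGenerated] {Y : ι → Ω → ℝ}
    (hY : ∀ i, AEMeasurable (Y i) P) {v : ℝ≥0} :
    TendstoNormal P l Y v ↔ ∀ u : ℝ,
      Tendsto (fun i => ∫ ω, Complex.exp ((u * Y i ω : ℝ) * Complex.I) ∂P) l
        (𝓝 (Real.exp (-(v * u ^ 2 / 2)) : ℂ)) := by
  have hlim : ∀ u : ℝ, charFun ((gaussianReal 0 v).map (id : ℝ → ℝ)) u =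
      (Real.exp (-(v * u ^ 2 / 2)) : ℂ) := by
    intro u
    rw [Measure.map_id, charFun_gaussianReal]
    push_cast
    congr 1
    ring
  have key : ∀ ns : ℕ → ι, (Tendsto (β := ProbabilityMeasure ℝ)
      (fun k => ⟨P.map (Y (ns k)), Measure.isProbabilityMeasure_map (hY (ns k))⟩) atTop
      (𝓝 ⟨(gaussianReal 0 v).map (id : ℝ → ℝ),
        Measure.isProbabilityMeasure_map aemeasurable_id⟩)) ↔
      ∀ u : ℝ, Tendsto (fun k => ∫ ω, Complex.exp ((u * Y (ns k) ω : ℝ) * Complex.I) ∂P) atTop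
        (𝓝 (Real.exp (-(v * u ^ 2 / 2)) : ℂ)) := by
    intro ns
    refine ProbabilityMeasure.tendsto_iff_tendsto_charFun.trans (forall_congr' fun u => ?_)
    simp only [ProbabilityMeasure.coe_mk, hlim u, charFun_map_eq_integral (hY _) u]
  constructor
  · intro h u
    refine Filter.tendsto_of_seq_tendsto fun ns hns => ?_
    exact (key ns).1 (h.tendsto.comp hns) u
  · intro h
    refine ⟨hY, aemeasurable_id, Filter.tendsto_of_seq_tendsto fun ns hns => ?_⟩
    exact (key ns).2 fun u => (h u).comp hns

/-- The limit variance is the mean conditional variance σ per site plus ℓ(t)² times the variance in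
the limit theorem for N_C. -/
theorem exists_tendstoNormal_linProc (hd : 0 < d) (hH : IsStationaryBinaryField P H)
    (hG : IsAlternativeCDF G g) (hX : IsCondIndepModel P H X G) (a b : ℝ) (ℓ : ℝ → ℝ) {t : ℝ}
    (ht : t ∈ Set.Icc (0 : ℝ) 1) : ∃ v : ℝ≥0, TendstoNormal P atTop
      (fun (m : Fin d → ℕ) ω => √(size m : ℝ) * linProc P G H X a b ℓ m t ω) v := by
  obtain ⟨v, hv⟩ := hH.clt
  set s₀ := a ^ 2 * (t * (1 - t)) with hs₀
  set s₁ := b ^ 2 * (G t * (1 - G t)) with hs₁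
  set σ := s₀ * pi0 P H + s₁ * pi1 P H with hσ
  have hpi := pi0_mem_Icc (P := P) (H := H)
  have hσ0 : 0 ≤ σ := by
    have h1 := hG.mem_Icc ht
    have h2 : 0 ≤ pi1 P H := by
      rw [pi1]
      linarith [hpi.2]
    exact add_nonneg
      (mul_nonneg (mul_nonneg (sq_nonneg a) (mul_nonneg ht.1 (by linarith [ht.2]))) hpi.1)
      (mul_nonneg (mul_nonneg (sq_nonneg b) (mul_nonneg h1.1 (by linarith [h1.2]))) h2)
  set k := ℓ t with hk
  refine ⟨(σ + k ^ 2 * v).toNNReal, ?_⟩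
  rw [tendstoNormal_iff fun m =>
    ((measurable_linProc hH hX.measurable a b ℓ m t).const_mul _).aemeasurable]
  intro u
  have hUm : ∀ m : Fin d → ℕ, AEMeasurable
      (fun ω => (√(size m : ℝ))⁻¹ * (numFalse H m ω - size m * pi1 P H)) P := fun m => by
    have := measurable_numFalse hH m
    fun_prop
  have hU := (tendstoNormal_iff hUm).1 hv (u * k)
  have hlim : (Real.exp (-((σ + k ^ 2 * v).toNNReal * u ^ 2 / 2)) : ℂ) =
      (Real.exp (-(σ * u ^ 2 / 2)) : ℂ) * (Real.exp (-(v * (u * k) ^ 2 / 2)) : ℂ) := by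
    rw [← Complex.ofReal_mul, ← Real.exp_add, Real.coe_toNNReal _ (by positivity)]
    congr 2
    ring
  rw [hlim]
  obtain ⟨c, hc, habs⟩ := exists_integral_abs_le hH
  set D := |a| + |b| with hD
  have hD0 : 0 ≤ D := by positivity
  have hmain := hU.const_mul (Real.exp (-(σ * u ^ 2 / 2)) : ℂ)
  refine (tendsto_iff_of_dist ?_).1 hmain
  -- With y = u n^{-1/2}, both errors, n|y|³ and y² E|N_C - nπ₁|, are of order n^{-1/2}.
  set B : ℝ := 3 * (|u| * D) ^ 3 + u ^ 2 / 2 * |s₁ - s₀| * c with hB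
  have hB0 : Tendsto (fun m : Fin d → ℕ => B * (rootSize m)⁻¹ ^ 2) atTop (𝓝 0) := by
    have := (tendsto_inv_rootSize_pow hd two_ne_zero).const_mul B
    rwa [mul_zero] at this
  refine squeeze_zero' (Eventually.of_forall fun _ => dist_nonneg) ?_ hB0
  have hsmall : ∀ᶠ m : Fin d → ℕ in atTop, |u| * D * (rootSize m)⁻¹ ^ 2 < 1 := by
    have := (tendsto_inv_rootSize_pow hd two_ne_zero).const_mul (|u| * D)
    rw [mul_zero] at this
    exact this.eventually_lt_const one_pos
  filter_upwards [habs, hsmall, eventually_size_ne_zero hd,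
    (tendsto_rootSize hd).eventually_gt_atTop 0] with m habs hsmall hm hx
  have habs := habs hm
  set x := rootSize m with hxdef
  have hx2 : √(size m : ℝ) = x ^ 2 := (rootSize_sq m).symm
  have hx4 : (size m : ℝ) = x ^ 4 := (rootSize_pow_four m).symm
  set y := u * x⁻¹ ^ 2 with hy
  have hyabs : |y| = |u| * x⁻¹ ^ 2 := by rw [hy, abs_mul, abs_of_pos (show 0 < x⁻¹ ^ 2 by positivity)]
  have hyD : |y| * D ≤ 1 := by
    rw [hyabs]
    linarith
  have hest := norm_charFun_sub_mul_le hH hG hX m k ht (D := D) (a := a) (b := b) (y := y)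
    (by rw [hD]; linarith [abs_nonneg b]) (by rw [hD]; linarith [abs_nonneg a]) hyD hs₀ hs₁
  rw [dist_comm, dist_eq_norm]
  have e1 : ∀ ω, u * (√(size m : ℝ) * linProc P G H X a b ℓ m t ω) =
      y * (a * condProc G H X 0 (cube m) t ω + b * condProc G H X 1 (cube m) t ω +
        k * (numFalse H m ω - size m * pi1 P H)) := by
    intro ω
    rw [linProc, ← hxdef, hx2, hy, hk]
    field_simp
  have e2 : ∀ ω, u * k * ((√(size m : ℝ))⁻¹ * (numFalse H m ω - size m * pi1 P H)) =
      y * (k * (numFalse H m ω - size m * pi1 P H)) := by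
    intro ω
    rw [hx2, hy]
    field_simp
  have e3 : y ^ 2 / 2 * (size m * (s₀ * pi0 P H + s₁ * pi1 P H)) = σ * u ^ 2 / 2 := by
    rw [← hσ, hx4, hy]
    field_simp
  rw [e3] at hest
  simp only [e1, e2]
  refine hest.trans ?_
  have h1 : y ^ 2 / 2 * |s₁ - s₀| * ∫ ω, |numFalse H m ω - size m * pi1 P H| ∂P ≤
      y ^ 2 / 2 * |s₁ - s₀| * (c * x ^ 2) := by
    rw [← hx2]
    gcongr
  refine (add_le_add le_rfl h1).trans (le_of_eq ?_)
  rw [hB, hyabs, hx4, hy]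
  field_simp

end CLT

/-! ### Measurability of the false discovery and nondiscovery proportions -/

section Measurability

variable {d : ℕ} {Ω : Type*} [MeasurableSpace Ω] {H X : (Fin d → ℤ) → Ω → ℝ} {τ : Ω → ℝ}

theorem measurable_Gam_n (hH : ∀ s, Measurable (H s)) (hX : ∀ s, Measurable (X s))
    (m : Fin d → ℕ) (hτ : Measurable τ) : Measurable fun ω => Gam_n H X m (τ ω) ω := by
  refine Measurable.div ?_ (((measurable_F_n hX m hτ).const_mul _).add ?_)
  · refine ((Finset.measurable_sum _ fun s _ => ?_).const_mul _).const_mul _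
    exact (measurable_const.sub (hH s)).mul
      (Measurable.ite (measurableSet_le (hX s) hτ) measurable_const measurable_const)
  · exact Finset.measurable_prod _ fun s _ =>
      Measurable.ite (measurableSet_lt hτ (hX s)) measurable_const measurable_const

theorem measurable_tildeDelta_n (hH : ∀ s, Measurable (H s)) (hX : ∀ s, Measurable (X s))
    (m : Fin d → ℕ) (hτ : Measurable τ) : Measurable fun ω => tildeDelta_n H X m (τ ω) ω :=
  (Finset.measurable_sum _ fun s _ => (hH s).mul
    (Measurable.ite (measurableSet_lt hτ (hX s)) measurable_const measurable_const)).const_mul _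

theorem measurable_Xi_n (hH : ∀ s, Measurable (H s)) (hX : ∀ s, Measurable (X s))
    (m : Fin d → ℕ) (hτ : Measurable τ) : Measurable fun ω => Xi_n H X m (τ ω) ω := by
  have hset : MeasurableSet {ω | ∀ s ∈ cube m, X s ω ≤ τ ω} := by
    have : {ω | ∀ s ∈ cube m, X s ω ≤ τ ω} = ⋂ s ∈ cube m, {ω | X s ω ≤ τ ω} := by
      ext ω
      simp
    rw [this]
    exact Finset.measurableSet_biInter _ fun s _ => measurableSet_le (hX s) hτ
  exact (measurable_tildeDelta_n hH hX m hτ).div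
    ((measurable_const.sub (measurable_F_n hX m hτ)).add
      ((Measurable.ite hset measurable_const measurable_const).div_const _))

end Measurability

/-! ### Expectations, and the delta method -/

section Mean

variable {d : ℕ} {Ω : Type*} [MeasurableSpace Ω] {P : Measure Ω} [IsProbabilityMeasure P]
  {H X : (Fin d → ℤ) → Ω → ℝ} {G g : ℝ → ℝ}

theorem IsStationaryBinaryField.measureReal_eq_zero (hH : IsStationaryBinaryField P H)
    (s : Fin d → ℤ) : P.real {ω | H s ω = 0} = pi0 P H := by
  have hm : MeasurableSet {h : (Fin d → ℤ) → ℝ | h 0 = 0} :=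
    measurableSet_eq_fun (measurable_pi_apply 0) measurable_const
  have h := (hH.stationary s).measure_mem_eq hm
  simp only [Set.preimage_ofPred_eq, zero_add] at h
  rw [measureReal_def, pi0, measureReal_def, h]

theorem IsStationaryBinaryField.measureReal_eq_one (hH : IsStationaryBinaryField P H)
    (s : Fin d → ℤ) : P.real {ω | H s ω = 1} = 1 - pi0 P H := by
  have h : {ω | H s ω = 1} = {ω | H s ω = 0}ᶜ := by
    ext ω
    rcases hH.binary s ω with h | h <;> simp [h]
  have hm : MeasurableSet {ω | H s ω = 0} := hH.measurable s (measurableSet_singleton 0)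
  rw [h, probReal_compl_eq_one_sub hm, hH.measureReal_eq_zero]

theorem IsStationaryBinaryField.measureReal_eq_one_and_lt (hH : IsStationaryBinaryField P H)
    (hX : IsCondIndepModel P H X G) (s : Fin d → ℤ) {t : ℝ} (ht : t ∈ Set.Icc (0 : ℝ) 1) :
    P.real {ω | H s ω = 1 ∧ t < X s ω} = (1 - pi0 P H) * (1 - G t) := by
  have h : {ω | H s ω = 1 ∧ t < X s ω} = {ω | H s ω = 1} \ {ω | H s ω = 1 ∧ X s ω ≤ t} := by
    ext ω
    simp only [Set.mem_ofPred_eq, Set.mem_sdiff, not_and, not_le]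
    tauto
  have hm1 : MeasurableSet {ω | H s ω = 1} := hH.measurable s (measurableSet_singleton 1)
  have hm2 : MeasurableSet {ω | X s ω ≤ t} := hX.measurable s measurableSet_Iic
  rw [h, measureReal_sdiff (μ := P) (s₁ := {ω | H s ω = 1})
    (s₂ := {ω | H s ω = 1 ∧ X s ω ≤ t}) (fun ω hω => hω.1) (hm1.inter hm2),
    hX.measure_eq_and_le s (Or.inr rfl) ht, hH.measureReal_eq_one, if_neg one_ne_zero]
  ring

theorem integral_tildeDelta_n (hH : IsStationaryBinaryField P H)
    (hX : IsCondIndepModel P H X G) {m : Fin d → ℕ} (hm : size m ≠ 0) {t : ℝ}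
    (ht : t ∈ Set.Icc (0 : ℝ) 1) :
    ∫ ω, tildeDelta_n H X m t ω ∂P = (1 - pi0 P H) * (1 - G t) := by
  have hm' : (size m : ℝ) ≠ 0 := by exact_mod_cast hm
  have hms : ∀ s, MeasurableSet {ω | H s ω = 1 ∧ t < X s ω} := fun s =>
    (hH.measurable s (measurableSet_singleton 1)).inter (hX.measurable s measurableSet_Ioi)
  have heq : ∀ s ω, (H s ω * if t < X s ω then (1 : ℝ) else 0) =
      {ω | H s ω = 1 ∧ t < X s ω}.indicator (fun _ => (1 : ℝ)) ω := by
    intro s ω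
    rcases hH.binary s ω with h | h <;> simp [Set.indicator_apply, h]
  simp only [tildeDelta_n, heq]
  rw [integral_const_mul, integral_finsetSum _ fun s _ =>
    (integrable_const (1 : ℝ)).indicator (hms s)]
  simp only [integral_indicator_const _ (hms _), smul_eq_mul, mul_one, hH.measureReal_eq_one_and_lt hX _ ht,
    Finset.sum_const, card_cube, nsmul_eq_mul]
  field_simp

/-- Slutsky's lemma: a remainder o_P(n^{-1/2}) does not affect the limit law. -/
theorem exists_tendstoNormal_of_isLittleOP (hd : 0 < d) (hH : IsStationaryBinaryField P H)
    (hG : IsAlternativeCDF G g) (hX : IsCondIndepModel P H X G) (a b : ℝ) (ℓ : ℝ → ℝ) {t : ℝ}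
    (ht : t ∈ Set.Icc (0 : ℝ) 1) {Y R : (Fin d → ℕ) → Ω → ℝ} (hY : ∀ m, Measurable (Y m))
    (hR : IsLittleOP P atTop R fun m => (rootSize m)⁻¹ ^ 2)
    (h : ∀ m, size m ≠ 0 → ∀ ω, Y m ω = linProc P G H X a b ℓ m t ω + R m ω) :
    ∃ v : ℝ≥0, TendstoNormal P atTop (fun m ω => √(size m : ℝ) * Y m ω) v := by
  obtain ⟨v, hv⟩ := exists_tendstoNormal_linProc hd hH hG hX a b ℓ ht
  have hpos : ∀ᶠ m : Fin d → ℕ in atTop, 0 < rootSize m :=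
    (tendsto_rootSize hd).eventually_gt_atTop 0
  refine ⟨v, tendstoInDistribution_of_tendstoInMeasure_sub _ _ hv ?_
    fun m => ((hY m).const_mul _).aemeasurable⟩
  have hlim := hR.tendstoInMeasure (s := fun m => √(size m : ℝ)) ?_ ?_
  · convert hlim using 1
    ext m ω
    simp only [Pi.sub_apply]
    rcases eq_or_ne (size m) 0 with hm | hm
    · simp [hm]
    · rw [h m hm]
      ring
  · filter_upwards [hpos] with m hm
    rw [← rootSize_sq]
    positivity
  · filter_upwards [hpos] with m hm
    rw [← rootSize_sq, inv_pow, mul_inv_cancel₀ (by positivity)]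

omit [IsProbabilityMeasure P] in
theorem IsBigOP.isLittleOP_rootSize (hd : 0 < d) {Y : (Fin d → ℕ) → Ω → ℝ}
    (hY : IsBigOP P atTop Y fun m => (rootSize m)⁻¹ ^ 3) :
    IsLittleOP P atTop Y fun m => (rootSize m)⁻¹ ^ 2 := by
  refine hY.isLittleOP fun K hK η hη => ?_
  have h := (tendsto_inv_rootSize_pow hd one_ne_zero).const_mul K
  rw [mul_zero] at h
  filter_upwards [h.eventually_lt_const hη] with m hm
  rw [pow_one] at hm
  have := mul_le_mul_of_nonneg_right hm.le (inv_rootSize_pow_nonneg m 2)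
  calc K * (rootSize m)⁻¹ ^ 3 = K * (rootSize m)⁻¹ * (rootSize m)⁻¹ ^ 2 := by ring
    _ ≤ _ := this

end Mean

/-! ### Limit theorems -/

section Limits

variable {d : ℕ} {Ω : Type*} [MeasurableSpace Ω] {P : Measure Ω} [IsProbabilityMeasure P]
  {H X : (Fin d → ℤ) → Ω → ℝ} {G g : ℝ → ℝ} {α : ℝ}
  (hd : 0 < d) (hH : IsStationaryBinaryField P H) (hG : IsAlternativeCDF G g)
  (hX : IsCondIndepModel P H X G) (hα : α ∈ Set.Ioo (0 : ℝ) 1)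

section Degenerate

include hG hα in
-- Here F(α) = 1, that is, p(1 - α) + (1 - p)(1 - G(α)) = 0 with both terms nonnegative.
theorem eq_zero_and_eq_one_of_nu0_eq {p : ℝ} (hp : p ∈ Set.Icc (0 : ℝ) 1)
    (h : nu0 p G α = α) : p = 0 ∧ G α = 1 := by
  have hF := F_nu0 hG hp hα
  rw [h, div_self hα.1.ne', F] at hF
  have hGα := (hG.mem_Icc ⟨hα.1.le, hα.2.le⟩).2
  have h1 : p * (1 - α) = 0 := by
    nlinarith [mul_nonneg hp.1 (sub_nonneg.2 hα.2.le),
      mul_nonneg (sub_nonneg.2 hp.2) (sub_nonneg.2 hGα)]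
  have hp0 : p = 0 := (mul_eq_zero.1 h1).resolve_right (sub_pos.2 hα.2).ne'
  rw [hp0] at hF
  exact ⟨hp0, by linarith⟩

include hH hG hX hα in
-- Almost surely every hypothesis in the cube is false and every p-value is at most α, so F_n(α) =
-- 1, everything is rejected and the numerator vanishes.
theorem ae_Xi_n_nuBH_eq_zero (h : nu0 (pi0 P H) G α = α) (m : Fin d → ℕ) :
    ∀ᵐ ω ∂P, Xi_n H X m (nuBH X α m ω) ω = 0 := by
  obtain ⟨hp, hGα⟩ := eq_zero_and_eq_one_of_nu0_eq hG hα pi0_mem_Icc h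
  have hαI : α ∈ Set.Icc (0 : ℝ) 1 := ⟨hα.1.le, hα.2.le⟩
  have hae : ∀ᵐ ω ∂P, ∀ s ∈ cube m, X s ω ≤ α := by
    refine (ae_ball_iff (cube m).countable_toSet).2 fun s _ => ?_
    have h0 : ∀ᵐ ω ∂P, ¬ H s ω = 0 := by
      rw [ae_iff]
      simp only [not_not]
      rw [← measureReal_eq_zero_iff, hH.measureReal_eq_zero, hp]
    have h1 : ∀ᵐ ω ∂P, ¬ (H s ω = 1 ∧ α < X s ω) := by
      rw [ae_iff]
      simp only [not_not]
      rw [← measureReal_eq_zero_iff, hH.measureReal_eq_one_and_lt hX s hαI, hGα]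
      ring
    filter_upwards [h0, h1] with ω h0 h1
    by_contra hlt
    exact h1 ⟨(hH.binary s ω).resolve_left h0, not_le.1 hlt⟩
  filter_upwards [hae] with ω hω
  rcases eq_or_ne (size m) 0 with hm | hm
  · simp [Xi_n, tildeDelta_n, hm]
  have hle : α ≤ nuBH X α m ω :=
    le_crossing (φ := fun t => F_n X m t ω) hαI
      (by rw [div_self hα.1.ne', F_n_eq_one hm hω])
  rw [Xi_n, tildeDelta_n, Finset.sum_eq_zero fun s hs => ?_]
  · simp
  · rw [if_neg (not_lt.2 ((hω s hs).trans hle)), mul_zero]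

include hG hα in
theorem Xi_nu0_eq_zero {p : ℝ} (hp : p ∈ Set.Icc (0 : ℝ) 1) (h : nu0 p G α = α) :
    Xi p G (nu0 p G α) = 0 := by
  rw [Xi, F_nu0 hG hp hα, h, div_self hα.1.ne', sub_self, div_zero]

end Degenerate

variable (h0 : 0 < nu0 (pi0 P H) G α) (hf : f (pi0 P H) g (nu0 (pi0 P H) G α) < α⁻¹)

include hd hH hG hX hα h0 hf

theorem exists_tendstoNormal_Gam_n : ∃ v : ℝ≥0, TendstoNormal P atTop
    (fun (m : Fin d → ℕ) ω =>
      √(size m : ℝ) * (Gam_n H X m (nuBH X α m ω) ω - α * pi0 P H)) v := by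
  have hR := isBigOP_Gam_n_sub hd hH hG hX hα h0 hf
  set ν := nu0 (pi0 P H) G α
  have hν1 : ν ≤ 1 := (nu0_le hG pi0_mem_Icc hα).trans hα.2.le
  refine exists_tendstoNormal_of_isLittleOP hd hH hG hX (α / ν) 0 (fun t => -(α / ν * t))
    ⟨h0.le, hν1⟩ (fun m => (measurable_Gam_n hH.measurable hX.measurable m
      (measurable_nuBH hX.measurable hα m)).sub_const _) (hR.isLittleOP_rootSize hd) ?_
  intro m hm ω
  rw [Lam_n_sub_eq hH.binary hm]
  simp only [linProc]
  ring

theorem isBigOP_Xi_n (hg : (fun t => g t - g (nu0 (pi0 P H) G α)) =O[𝓝 (nu0 (pi0 P H) G α)]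
      (fun t => t - nu0 (pi0 P H) G α)) : IsBigOP P atTop
    (fun (m : Fin d → ℕ) ω =>
      (Xi_n H X m (nuBH X α m ω) ω - Xi (pi0 P H) G (nu0 (pi0 P H) G α)) -
        (cConst (pi0 P H) g α (nu0 (pi0 P H) G α) *
            (F_n X m (nu0 (pi0 P H) G α) ω - F (pi0 P H) G (nu0 (pi0 P H) G α)) /
              (1 - nu0 (pi0 P H) G α / α) ^ 2 +
          (tildeDelta_n H X m (nu0 (pi0 P H) G α) ω -
            ∫ ω', tildeDelta_n H X m (nu0 (pi0 P H) G α) ω' ∂P) / (1 - nu0 (pi0 P H) G α / α)))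
    (fun m => (rootSize m)⁻¹ ^ 3) := by
  have hr : ∀ᶠ m : Fin d → ℕ in atTop, 0 ≤ (rootSize m)⁻¹ ^ 3 :=
    Eventually.of_forall fun m => inv_rootSize_pow_nonneg m 3
  rcases (nu0_le hG (pi0_mem_Icc (P := P) (H := H)) hα).lt_or_eq with hlt | heq
  · refine ((isBigOP_Xi_n_sub hd hH hG hX hα h0 hf hlt).add
      ((isBigOP_second_order hd hH hG hX hα h0 hf hg).const_mul ((1 - pi0 P H) *
        (cConst (pi0 P H) g α (nu0 (pi0 P H) G α) / (1 - nu0 (pi0 P H) G α / α) ^ 2 -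
          1 / (1 - nu0 (pi0 P H) G α / α))) hr)).congr ?_
    filter_upwards [eventually_size_ne_zero hd] with m hm ω
    rw [integral_tildeDelta_n hH hX hm ⟨h0.le, (hlt.trans hα.2).le⟩]
    ring
  -- Degenerate case: 1 - ν₀/α = 0, and division by zero gives 0, so every term of the expansion
  -- vanishes almost surely.
  · refine isBigOP_of_ae_eq_zero hr (Eventually.of_forall fun m => ?_)
    filter_upwards [ae_Xi_n_nuBH_eq_zero hH hG hX hα heq m] with ω hω
    rw [hω, Xi_nu0_eq_zero hG hα pi0_mem_Icc heq, heq, div_self hα.1.ne']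
    simp

theorem exists_tendstoNormal_Xi_n : ∃ v : ℝ≥0, TendstoNormal P atTop
    (fun (m : Fin d → ℕ) ω => √(size m : ℝ) *
      (Xi_n H X m (nuBH X α m ω) ω - Xi (pi0 P H) G (nu0 (pi0 P H) G α))) v := by
  have hr : ∀ᶠ m : Fin d → ℕ in atTop, 0 ≤ (rootSize m)⁻¹ ^ 2 :=
    Eventually.of_forall fun m => inv_rootSize_pow_nonneg m 2
  have hm : ∀ m : Fin d → ℕ, Measurable fun ω =>
      Xi_n H X m (nuBH X α m ω) ω - Xi (pi0 P H) G (nu0 (pi0 P H) G α) := fun m =>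
    (measurable_Xi_n hH.measurable hX.measurable m
      (measurable_nuBH hX.measurable hα m)).sub_const _
  have hν1 : nu0 (pi0 P H) G α ≤ 1 := (nu0_le hG pi0_mem_Icc hα).trans hα.2.le
  rcases (nu0_le hG (pi0_mem_Icc (P := P) (H := H)) hα).lt_or_eq with hlt | heq
  · have hR := ((isBigOP_Xi_n_sub hd hH hG hX hα h0 hf hlt).isLittleOP_rootSize hd).add
      ((isLittleOP_second_order hd hH hG hX hα h0 hf).const_mul ((1 - pi0 P H) *
        (cConst (pi0 P H) g α (nu0 (pi0 P H) G α) / (1 - nu0 (pi0 P H) G α / α) ^ 2 -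
          1 / (1 - nu0 (pi0 P H) G α / α))) hr)
    set ν := nu0 (pi0 P H) G α
    set c := cConst (pi0 P H) g α ν
    set q := 1 - ν / α
    -- The coefficients add c/q² times those of F_n, namely (1, 1, G - t), to 1/q times those of
    -- Δ̃_n, namely (0, -1, 1 - G).
    refine exists_tendstoNormal_of_isLittleOP hd hH hG hX (c / q ^ 2) (c / q ^ 2 - 1 / q)
      (fun t => c / q ^ 2 * (G t - t) + 1 / q * (1 - G t)) ⟨h0.le, hν1⟩ hm hR ?_
    intro m hm ω
    rw [F_n_sub_eq hH.binary hm, tildeDelta_n_sub_eq hH.binary hm]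
    simp only [linProc]
    ring
  · have hR : IsBigOP P atTop (fun (m : Fin d → ℕ) ω =>
        Xi_n H X m (nuBH X α m ω) ω - Xi (pi0 P H) G (nu0 (pi0 P H) G α))
        fun m => (rootSize m)⁻¹ ^ 3 := by
      refine isBigOP_of_ae_eq_zero
        (Eventually.of_forall fun m => inv_rootSize_pow_nonneg m 3)
        (Eventually.of_forall fun m => ?_)
      filter_upwards [ae_Xi_n_nuBH_eq_zero hH hG hX hα heq m] with ω hω
      rw [hω, Xi_nu0_eq_zero hG hα pi0_mem_Icc heq, sub_self]
    refine exists_tendstoNormal_of_isLittleOP hd hH hG hX 0 0 0 ⟨h0.le, hν1⟩ hm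
      (hR.isLittleOP_rootSize hd) fun m _ ω => ?_
    simp [linProc]

end Limits

end FDP

/-! ### The theorem on false discovery and nondiscovery proportions -/

theorem theorem3 {d : ℕ} (hd : 0 < d) {Ω : Type*} [MeasurableSpace Ω] (P : Measure Ω)
    [IsProbabilityMeasure P] (H X : (Fin d → ℤ) → Ω → ℝ) (G g : ℝ → ℝ) (α p ν₀ : ℝ)
    (hα : α ∈ Set.Ioo (0 : ℝ) 1)
    (hH : FDP.IsStationaryBinaryField P H)
    (hG : FDP.IsAlternativeCDF G g)
    (hX : FDP.IsCondIndepModel P H X G)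
    (hp : p = FDP.pi0 P H)
    (hν₀ : ν₀ = FDP.nu0 p G α)
    (hα_star : α⁻¹ < (FDP.alphaStar p g)⁻¹)
    (hα_nu : FDP.f p g ν₀ < α⁻¹) :
    -- (i) expansion and central limit theorem for the false discovery proportion
    (FDP.IsBigOP P atTop
        (fun (m : Fin d → ℕ) ω =>
          (FDP.Gam_n H X m (FDP.nuBH X α m ω) ω - α * p)
            - α / ν₀ * (FDP.Lam_n H X m ν₀ ω - FDP.Lam p ν₀))
        (fun m => (FDP.size m : ℝ) ^ (-(3 / 4) : ℝ)) ∧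
      ∃ v : ℝ≥0, FDP.TendstoNormal P atTop
        (fun (m : Fin d → ℕ) ω =>
          √(FDP.size m : ℝ) * (FDP.Gam_n H X m (FDP.nuBH X α m ω) ω - α * p)) v) ∧
    -- (ii) expansion and central limit theorem for the false nondiscovery proportion;
    -- the rate in the expansion needs `g(t) - g(ν₀) = O(|t - ν₀|)` as `t → ν₀`
    (((fun t => g t - g ν₀) =O[𝓝 ν₀] (fun t => t - ν₀) →
        FDP.IsBigOP P atTop
          (fun (m : Fin d → ℕ) ω =>
            (FDP.Xi_n H X m (FDP.nuBH X α m ω) ω - FDP.Xi p G ν₀)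
              - (FDP.cConst p g α ν₀ * (FDP.F_n X m ν₀ ω - FDP.F p G ν₀) / (1 - ν₀ / α) ^ 2
                + (FDP.tildeDelta_n H X m ν₀ ω - ∫ ω', FDP.tildeDelta_n H X m ν₀ ω' ∂P)
                  / (1 - ν₀ / α)))
          (fun m => (FDP.size m : ℝ) ^ (-(3 / 4) : ℝ))) ∧
      ∃ v : ℝ≥0, FDP.TendstoNormal P atTop
        (fun (m : Fin d → ℕ) ω =>
          √(FDP.size m : ℝ) * (FDP.Xi_n H X m (FDP.nuBH X α m ω) ω - FDP.Xi p G ν₀)) v) := by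
  subst hp hν₀
  rw [FDP.alphaStar, one_div, inv_inv] at hα_star
  have h0 := FDP.nu0_pos hG hα_star
  simp only [FDP.rpow_size_eq]
  exact ⟨⟨FDP.isBigOP_Gam_n_sub hd hH hG hX hα h0 hα_nu,
    FDP.exists_tendstoNormal_Gam_n hd hH hG hX hα h0 hα_nu⟩,
    FDP.isBigOP_Xi_n hd hH hG hX hα h0 hα_nu,
    FDP.exists_tendstoNormal_Xi_n hd hH hG hX hα h0 hα_nu⟩
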